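/- An instance of Longest Common Subsequence (LCS) consists of positive integers $N,t$, a finite alphabet $\Sigma$ and strings $s_1,\dots,s_r\in\Sigma^N$, $r\ge 1$; the question is whether some string of length $t$ is a subsequence of every $s_i$. Let $M$ denote the total bitsize of the instance. Suppose that for every computable function $\delta:\mathbb N\to\mathbb N$ with $\delta(x)\to\infty$ as $x\to\infty$, there are no computable function $f$ and no algorithm that solves LCS on all instances with $t\le\delta(N)$ in time $M^{f(r)}$ and, simultaneously, space $f(r)\cdot M^{O(1)}$. For $d,k\in\mathbb N$, a $(d,k)$-tree-model of a graph $G$ consists of a rooted tree $T$ of depth $d$ whose leaves are identified with the vertices of $G$, a symmetric Boolean $k\times k$ matrix $M_a$ for every node $a$, a labelling $\lambda:V(G)\to[k]$, and a renaming function $\rho_{ab}:[k]\to[k]$ for every edge from a node $a$ to a child $b$. Put $\lambda_v(v)=\lambda(v)$ for every leaf $v$ and $\lambda_a(v)=\rho_{ab}(\lambda_b(v))$ whenever $b$ is a child of $a$ and $v$ is a leaf that lies below $b$ or equals $b$. It is required that distinct vertices $u,v$ are adjacent in $G$ if and only if $M_a[\lambda_a(u),\lambda_a(v)]=1$, where $a$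 is the least common ancestor of $u$ and $v$ in $T$. Then for every computable function $\delta:\mathbb N\to\mathbb N$ with $\delta(x)\to\infty$ as $x\to\infty$, there is no algorithm that, given an $n$-vertex graph $G$ together with a $(d,k)$-tree-model of $G$ satisfying $d\le\delta(k)$ and an integer $\ell\le n$, decides whether $G$ has an independent set of size at least $\ell$ in time $2^{O(k)}\cdot n^{O(1)}$ and, simultaneously, space $n^{O(1)}$. Here algorithms are programs of a random access machine with a read-only input; time is the number of operations, and space is the number of bits of work memory. -/

import Mathlib

/-! ## The machine model: a random access machine

Memory consists of registers `R 0, R 1, R 2, …`, each holding a natural number; all are `0` at the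
start. The input is a read-only array of natural numbers, which can be accessed at random and is not
charged for in the space. One operation costs one unit of time; space is measured in bits. -/

namespace RAM

/-- Contents of the work memory; all but finitely many registers hold `0`. -/
abbrev Mem := ℕ →₀ ℕ

/-- Number of bits that describe the work memory: the binary lengths of the addresses and of the
contents of all registers that are in use. -/
noncomputable def memBits (m : Mem) : ℕ :=
  m.sum fun i v => Nat.size i + Nat.size v

/-- Arithmetic operations (on natural numbers: truncated subtraction, integer division). -/
inductive Arith
  | add | sub | mul | div

def Arith.eval : Arith → ℕ → ℕ → ℕ
  | .add, a, b => a + b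
  | .sub, a, b => a - b
  | .mul, a, b => a * b
  | .div, a, b => a / b

/-- Elementary instructions. -/
inductive Instr
  /-- `R i ← c` -/
  | const (i c : ℕ)
  /-- `R i ← R j ∘ R l` -/
  | arith (o : Arith) (i j l : ℕ)
  /-- `R i ← R (R j)` -/
  | load (i j : ℕ)
  /-- `R (R i) ← R j` -/
  | store (i j : ℕ)
  /-- `R i ← x (R j)`, where `x` is the input array (continued by zeros) -/
  | read (i j : ℕ)

/-- The memory after one instruction, on input `x`. -/
noncomputable def Instr.apply (x : List ℕ) (m : Mem) : Instr → Mem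
  | .const i c => m.update i c
  | .arith o i j l => m.update i (o.eval (m j) (m l))
  | .load i j => m.update i (m (m j))
  | .store i j => m.update (m i) (m j)
  | .read i j => m.update i (x.getD (m j) 0)

/-- Programs: instructions, composed by sequencing, branching and loops. -/
inductive Program
  | skip
  | instr (a : Instr)
  | seq (P Q : Program)
  /-- if `R i ≠ 0` then `P` else `Q` -/
  | branch (i : ℕ) (P Q : Program)
  /-- while `R i ≠ 0` do `P` -/
  | loop (i : ℕ) (P : Program)

/-- `Exec x P m m' t s`: on input `x`, the program `P` started with memory `m` halts with memory
`m'`, after exactly `t` operations (instructions and tests), and `s` is the maximum number of bits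
of memory in use at any moment of the run. -/
inductive Exec (x : List ℕ) : Program → Mem → Mem → ℕ → ℕ → Prop
  | skip (m : Mem) : Exec x .skip m m 1 (memBits m)
  | instr (a : Instr) (m : Mem) :
      Exec x (.instr a) m (a.apply x m) 1 (max (memBits m) (memBits (a.apply x m)))
  | seq {P Q : Program} {m₀ m₁ m₂ : Mem} {t₁ t₂ s₁ s₂ : ℕ} :
      Exec x P m₀ m₁ t₁ s₁ → Exec x Q m₁ m₂ t₂ s₂ →
      Exec x (.seq P Q) m₀ m₂ (t₁ + t₂) (max s₁ s₂)
  | branch_then {i : ℕ} {P Q : Program} {m₀ m₁ : Mem} {t s : ℕ} :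
      m₀ i ≠ 0 → Exec x P m₀ m₁ t s → Exec x (.branch i P Q) m₀ m₁ (1 + t) s
  | branch_else {i : ℕ} {P Q : Program} {m₀ m₁ : Mem} {t s : ℕ} :
      m₀ i = 0 → Exec x Q m₀ m₁ t s → Exec x (.branch i P Q) m₀ m₁ (1 + t) s
  | loop_done {i : ℕ} {P : Program} {m : Mem} :
      m i = 0 → Exec x (.loop i P) m m 1 (memBits m)
  | loop_step {i : ℕ} {P : Program} {m₀ m₁ m₂ : Mem} {t₁ t₂ s₁ s₂ : ℕ} :
      m₀ i ≠ 0 → Exec x P m₀ m₁ t₁ s₁ → Exec x (.loop i P) m₁ m₂ t₂ s₂ →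
      Exec x (.loop i P) m₀ m₂ (1 + t₁ + t₂) (max s₁ s₂)

/-- On input `x`, the program halts within `T` operations, never uses more than `S` bits of work
memory, and answers correctly (`R 0 ≠ 0` meaning "yes") whether `answer` holds. -/
def Program.Decides (P : Program) (x : List ℕ) (answer : Prop) (T S : ℕ) : Prop :=
  ∃ (m : Mem) (t s : ℕ), Exec x P 0 m t s ∧ t ≤ T ∧ s ≤ S ∧ (m 0 ≠ 0 ↔ answer)

/-- Bitsize of an input array: each number is written in binary, with one bit to separate it from
the next one. -/
def bitSize (x : List ℕ) : ℕ :=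
  (x.map fun a => Nat.size a + 1).sum

end RAM

/-! ## Longest Common Subsequence -/

/-- An instance `(N, t, Σ, s₁, …, s_r)`, with `Σ = {0, …, σ - 1}`. -/
structure LCSInstance where
  /-- common length of the strings -/
  N : ℕ
  /-- length of the sought subsequence -/
  t : ℕ
  /-- size of the alphabet -/
  σ : ℕ
  /-- number of strings -/
  r : ℕ
  N_pos : 0 < N
  t_pos : 0 < t
  r_pos : 0 < r
  /-- the strings -/
  str : Fin r → Fin N → Fin σ

namespace LCSInstance

/-- Some string of length `t` is a subsequence of each of the given strings. -/
def IsYes (I : LCSInstance) : Prop :=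
  ∃ w : List (Fin I.σ), w.length = I.t ∧ ∀ p, w.Sublist (List.ofFn (I.str p))

/-- The instance as an input array. -/
def encode (I : LCSInstance) : List ℕ :=
  [I.N, I.t, I.σ, I.r] ++
    (List.ofFn fun p => List.ofFn fun j => (I.str p j : ℕ)).flatten

/-- The total bitsize `M` of the instance. -/
def size (I : LCSInstance) : ℕ := RAM.bitSize I.encode

end LCSInstance

/-- For some computable function `f`, Longest Common Subsequence restricted to the instances with
`t ≤ δ N` can be solved in time `M ^ f r` and, simultaneously, space `f r * M ^ O(1)`. -/
def LCSSolvable (δ : ℕ → ℕ) : Prop :=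
  ∃ (P : RAM.Program) (f : ℕ → ℕ) (c : ℕ), Computable f ∧
    ∀ I : LCSInstance, I.t ≤ δ I.N →
      P.Decides I.encode I.IsYes (I.size ^ f I.r) (f I.r * I.size ^ c)

/-! ## Tree-models -/

/-- A rooted tree on the node set `{0, …, m - 1}` whose leaves are identified with `n` vertices,
together with the matrices, the labelling and the renaming functions of a tree-model with `k`
labels. -/
structure LabelledTree (n k : ℕ) where
  /-- number of nodes -/
  m : ℕ
  root : Fin m
  /-- the parent of each node other than the root -/
  parent : Fin m → Fin m
  parent_root : parent root = root
  reaches_root : ∀ a, ∃ j, parent^[j] a = root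
  /-- the leaf that is identified with a vertex -/
  leaf : Fin n → Fin m
  leaf_injective : Function.Injective leaf
  /-- the nodes of the form `leaf v` are exactly those without children -/
  mem_range_leaf : ∀ a, a ∈ Set.range leaf ↔ ∀ b, b ≠ root → parent b ≠ a
  /-- the matrices `M_a` -/
  mat : Fin m → Fin k → Fin k → Bool
  mat_symm : ∀ a i j, mat a i j = mat a j i
  /-- the labelling of the vertices -/
  lab : Fin n → Fin k
  /-- `ren b` renames labels along the edge from `b` to its parent (meaningless for the root) -/
  ren : Fin m → Fin k → Fin k

namespace LabelledTree

variable {n k : ℕ}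

/-- The depth of the tree: the maximum number of edges from a node to the root. -/
def depth (T : LabelledTree n k) : ℕ :=
  Finset.univ.sup fun a => Nat.find (T.reaches_root a)

/-- `T.Label a v i`: the vertex `v` lies in `V_a`, that is, below the node `a` (possibly `v` is `a`),
and its label at `a` is `i`. -/
inductive Label (T : LabelledTree n k) : Fin T.m → Fin n → Fin k → Prop
  | leaf (v : Fin n) : Label T (T.leaf v) v (T.lab v)
  | up {b : Fin T.m} {v : Fin n} {i : Fin k} :
      b ≠ T.root → Label T b v i → Label T (T.parent b) v (T.ren b i)

/-- `v ∈ V_a` -/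
def Below (T : LabelledTree n k) (a : Fin T.m) (v : Fin n) : Prop :=
  ∃ i, T.Label a v i

/-- `a` is the least common ancestor of the leaves `u` and `v`. -/
def IsLCA (T : LabelledTree n k) (a : Fin T.m) (u v : Fin n) : Prop :=
  T.Below a u ∧ T.Below a v ∧
    ∀ b, b ≠ T.root → T.parent b = a → ¬ (T.Below b u ∧ T.Below b v)

/-- `T` is a tree-model of `G`: distinct vertices `u`, `v` are adjacent iff the matrix of their least
common ancestor has a one at the position given by their labels there. -/
def IsModelOf (T : LabelledTree n k) (G : SimpleGraph (Fin n)) : Prop :=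
  ∀ u v, u ≠ v → ∀ a, T.IsLCA a u v → ∀ i j, T.Label a u i → T.Label a v j →
    (G.Adj u v ↔ T.mat a i j = true)

/-- The tree as an array: number of nodes, root; leaf and label of every vertex; parent, renaming
function and matrix of every node. -/
def encode (T : LabelledTree n k) : List ℕ :=
  [T.m, (T.root : ℕ)] ++
    (List.ofFn fun v => [(T.leaf v : ℕ), (T.lab v : ℕ)]).flatten ++
    (List.ofFn fun a =>
      [(T.parent a : ℕ)] ++
        (List.ofFn fun i => (T.ren a i : ℕ)) ++
        (List.ofFn fun i => List.ofFn fun j => (T.mat a i j).toNat).flatten).flatten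

end LabelledTree

/-! ## Independent Set on graphs supplied with tree-models -/

/-- An `n`-vertex graph with a tree-model that uses `k` labels, and a target size. -/
structure ISInstance where
  n : ℕ
  G : SimpleGraph (Fin n)
  target : ℕ
  target_le : target ≤ n
  k : ℕ
  T : LabelledTree n k
  isModel : T.IsModelOf G

namespace ISInstance

/-- The graph has an independent set of at least the target size. -/
def IsYes (I : ISInstance) : Prop :=
  ∃ S : Finset (Fin I.n), I.G.IsIndepSet (S : Set (Fin I.n)) ∧ I.target ≤ S.card

open Classical in
/-- The instance as an input array: `n`, the target, the adjacency matrix, `k` in unary (so that `k`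
can be compared with `n` in little space, however large it is), the tree-model. -/
noncomputable def encode (I : ISInstance) : List ℕ :=
  [I.n, I.target] ++
    (List.ofFn fun u => List.ofFn fun v => if I.G.Adj u v then 1 else 0).flatten ++
    (List.replicate I.k 1 ++ [0]) ++
    I.T.encode

end ISInstance

/-- Independent Set on graphs supplied with `(d, k)`-tree-models such that `d ≤ δ k` can be solved
in time `2 ^ O(k) * n ^ O(1)` and, simultaneously, space `n ^ O(1)`. -/
def ISSolvable (δ : ℕ → ℕ) : Prop :=
  ∃ (P : RAM.Program) (c : ℕ), ∀ I : ISInstance, I.T.depth ≤ δ I.k →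
    P.Decides I.encode I.IsYes (c * 2 ^ (c * I.k) * I.n ^ c) (c * I.n ^ c)

/-! The contrapositive is proved: a program for Independent Set within the stated bounds for `δ`
gives one for LCS within its bounds for a slower function `slowed δ`.

Graph. Let `L` be the bit length of `N`. Each round `i < t` and each string `p` have a gadget of
`N³` groups, one per triple `(x, y, z)`: `y` is the position in string `p` matched with letter `i`,
`x` is a position of string 0 that carries this letter, and `z` is a guess for one plus the position
matched in the round before. A group has `3L` vertices, one for each bit of `x`, `y + 1` and `z`. It
is independent if the triple is admissible (the letters agree and `z ≤ y`), and a clique otherwise.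
Distinct groups of a gadget are completely joined, so the target `3L · t · r` forces one whole
admissible group per gadget. Edges between unequal bits make `x` agree over the strings of a round,
and make `y + 1` agree with the `z` of the next round on the same string; with `z ≤ y` the positions
increase strictly (`toIS_isYes_iff`).

Tree-model. Vertices hang below their groups, groups below gadgets, and the gadgets of round `i`
below the `i`-th node of a path, so the depth is at most `t + 3`. As only single bits are compared,
a label needs just a kind, a string, a bit index and a bit value; renaming along the path keeps the
bits of `y + 1` for one more round and forgets everything else (`isModel`). Hence `k = 10 r L`, so
`2 ^ O(k)` is `M ^ O(r)` (`two_pow_labels_le`), while the graph has polynomial size.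

Depth. The requirement `t + 3 ≤ δ k` involves `r` through `k`. If `r ≤ N`, then `k` lies in a window
that depends on `N` only and moves to infinity with `N`; `slowed` takes the minimum of `δ` there. If
`r > N`, exhaustive search over `N ^ t ≤ r ^ r` sequences is affordable.

Machine. The graph is never written down. The given program runs on shifted registers, and each
access to its input is replaced by the evaluation of an arithmetic expression for that entry
(`relocate_exec`, `compile_runs`, `toIS_encode_getD`). -/

namespace RAM

/-! ### Running programs on the low registers -/

/-- The part of `memBits` contributed by the registers from `h` on. -/
noncomputable def highBits (h : ℕ) (m : Mem) : ℕ :=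
  ∑ i ∈ m.support.filter (h ≤ ·), (Nat.size i + Nat.size (m i))

theorem size_le_self (n : ℕ) : Nat.size n ≤ n := Nat.size_le.2 Nat.lt_two_pow_self

/-- Separates the space of the `h` low registers, at most `h` address bits and `W` content bits
each, from that of the high ones, which a run on the low registers leaves alone. -/
theorem memBits_le {h W : ℕ} {m : Mem} (hm : ∀ i < h, Nat.size (m i) ≤ W) :
    memBits m ≤ h * (h + W) + highBits h m := by
  unfold memBits Finsupp.sum
  rw [← Finset.sum_filter_add_sum_filter_not m.support (· < h)]
  simp only [not_lt]
  refine Nat.add_le_add_right ?_ _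
  calc _ ≤ ∑ i ∈ m.support.filter (· < h), (h + W) := by
        refine Finset.sum_le_sum fun i hi => ?_
        have hi := (Finset.mem_filter.1 hi).2
        exact Nat.add_le_add ((size_le_self i).trans hi.le) (hm i hi)
    _ ≤ ∑ i ∈ Finset.range h, (h + W) := by
        refine Finset.sum_le_sum_of_subset fun i hi => ?_
        simpa using (Finset.mem_filter.1 hi).2
    _ = h * (h + W) := by simp

theorem highBits_congr {h : ℕ} {m m' : Mem} (hm : ∀ i ≥ h, m' i = m i) :
    highBits h m' = highBits h m := by
  unfold highBits
  refine Finset.sum_congr ?_ ?_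
  · ext i
    simp only [Finset.mem_filter, Finsupp.mem_support_iff]
    constructor <;> rintro ⟨a, b⟩ <;> simp_all
  · intro i hi
    rw [hm i (Finset.mem_filter.1 hi).2]

/-- The program runs from `m` to `m'` in at most `T` operations, changing only registers below `h`,
which hold numbers of at most `W` bits. -/
def Runs (h W : ℕ) (x : List ℕ) (P : Program) (m m' : Mem) (T : ℕ) : Prop :=
  (∃ t s, Exec x P m m' t s ∧ t ≤ T ∧ s ≤ h * (h + W) + highBits h m) ∧
    (∀ i ≥ h, m' i = m i) ∧ ∀ i < h, Nat.size (m' i) ≤ W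

variable {h W : ℕ} {x : List ℕ} {P Q : Program} {m m₁ m₂ : Mem} {T T₁ T₂ : ℕ}

theorem Runs.mono (hr : Runs h W x P m m₁ T₁) (hT : T₁ ≤ T₂) : Runs h W x P m m₁ T₂ := by
  obtain ⟨⟨t, s, he, ht, hs⟩, hrest⟩ := hr
  exact ⟨⟨t, s, he, ht.trans hT, hs⟩, hrest⟩

theorem Runs.seq (h₁ : Runs h W x P m m₁ T₁) (h₂ : Runs h W x Q m₁ m₂ T₂) :
    Runs h W x (.seq P Q) m m₂ (T₁ + T₂) := by
  obtain ⟨⟨t, s, he, ht, hs⟩, hh, hl⟩ := h₁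
  obtain ⟨⟨t', s', he', ht', hs'⟩, hh', hl'⟩ := h₂
  refine ⟨⟨_, _, he.seq he', Nat.add_le_add ht ht', max_le hs ?_⟩,
    fun i hi => (hh' i hi).trans (hh i hi), hl'⟩
  rwa [highBits_congr hh] at hs'

theorem Runs.loop_done {i : ℕ} (hm : ∀ i < h, Nat.size (m i) ≤ W) (hi : m i = 0) :
    Runs h W x (.loop i P) m m 1 :=
  ⟨⟨_, _, .loop_done hi, le_rfl, memBits_le hm⟩, fun _ _ => rfl, hm⟩

theorem Runs.loop_step {i : ℕ} (hi : m i ≠ 0) (h₁ : Runs h W x P m m₁ T₁)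
    (h₂ : Runs h W x (.loop i P) m₁ m₂ T₂) :
    Runs h W x (.loop i P) m m₂ (1 + T₁ + T₂) := by
  obtain ⟨⟨t, s, he, ht, hs⟩, hh, hl⟩ := h₁
  obtain ⟨⟨t', s', he', ht', hs'⟩, hh', hl'⟩ := h₂
  refine ⟨⟨_, _, .loop_step hi he he', by lia, max_le hs ?_⟩,
    fun i hi => (hh' i hi).trans (hh i hi), hl'⟩
  rwa [highBits_congr hh] at hs'

theorem Runs.branch_then {i : ℕ} (hi : m i ≠ 0) (h₁ : Runs h W x P m m₁ T₁) :
    Runs h W x (.branch i P Q) m m₁ (1 + T₁) := by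
  obtain ⟨⟨t, s, he, ht, hs⟩, hrest⟩ := h₁
  exact ⟨⟨_, _, .branch_then hi he, by lia, hs⟩, hrest⟩

theorem Runs.branch_else {i : ℕ} (hi : m i = 0) (h₁ : Runs h W x Q m m₁ T₁) :
    Runs h W x (.branch i P Q) m m₁ (1 + T₁) := by
  obtain ⟨⟨t, s, he, ht, hs⟩, hrest⟩ := h₁
  exact ⟨⟨_, _, .branch_else hi he, by lia, hs⟩, hrest⟩

theorem Runs.instr {a : Instr} {i v : ℕ} (hm : ∀ i < h, Nat.size (m i) ≤ W)
    (ha : a.apply x m = m.update i v) (hi : i < h) (hv : Nat.size v ≤ W) :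
    Runs h W x (.instr a) m (m.update i v) 1 := by
  have hh : ∀ j ≥ h, m.update i v j = m j := fun j hj => by
    simp [Function.update_of_ne (show j ≠ i by lia)]
  have hl : ∀ j < h, Nat.size (m.update i v j) ≤ W := fun j hj => by
    rw [Finsupp.coe_update, Function.update_apply]
    split_ifs
    exacts [hv, hm j hj]
  have he := Exec.instr (x := x) a m
  rw [ha] at he
  refine ⟨⟨_, _, he, le_rfl, max_le (memBits_le hm) ?_⟩, hh, hl⟩
  rw [← highBits_congr hh]
  exact memBits_le hl

theorem Runs.const {i c : ℕ} (hm : ∀ i < h, Nat.size (m i) ≤ W) (hi : i < h)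
    (hv : Nat.size c ≤ W) : Runs h W x (.instr (.const i c)) m (m.update i c) 1 :=
  Runs.instr hm rfl hi hv

theorem Runs.arith {o : Arith} {i j l : ℕ} (hm : ∀ i < h, Nat.size (m i) ≤ W) (hi : i < h)
    (hv : Nat.size (o.eval (m j) (m l)) ≤ W) :
    Runs h W x (.instr (.arith o i j l)) m (m.update i (o.eval (m j) (m l))) 1 :=
  Runs.instr hm rfl hi hv

/-- `R i ← R j`, for `i ≠ j`. -/
def Program.move (i j : ℕ) : Program :=
  .seq (.instr (.const i 0)) (.instr (.arith .add i j i))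

theorem Runs.move {i j : ℕ} (hm : ∀ i < h, Nat.size (m i) ≤ W) (hi : i < h) (hij : i ≠ j)
    (hv : Nat.size (m j) ≤ W) : Runs h W x (.move i j) m (m.update i (m j)) 2 := by
  have h₁ : Runs h W x (.instr (.const i 0)) m (m.update i 0) 1 := Runs.const hm hi (by simp)
  have h₂ := Runs.arith (x := x) (o := .add) (i := i) (j := j) (l := i) h₁.2.2 hi
    (by simpa [Arith.eval, Function.update_of_ne hij.symm] using hv)
  have e : (m.update i 0).update i (Arith.add.eval (m.update i 0 j) (m.update i 0 i)) =
      m.update i (m j) := by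
    refine Finsupp.ext fun l => ?_
    by_cases hl : l = i <;> simp [Arith.eval, hl, hij.symm]
  rw [e] at h₂
  exact h₁.seq h₂

theorem size_eval_le (o : Arith) (a b : ℕ) :
    Nat.size (o.eval a b) ≤ Nat.size a + Nat.size b + 1 := by
  have ha := Nat.lt_size_self a
  have hb := Nat.lt_size_self b
  have h1 := Nat.pow_le_pow_right (n := 2) (by lia) (Nat.le_add_right a.size b.size)
  have h2 := Nat.pow_le_pow_right (n := 2) (by lia) (Nat.le_add_left b.size a.size)
  rw [Nat.size_le, pow_succ]
  cases o
  · simp only [Arith.eval]; lia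
  · simp only [Arith.eval]; lia
  · simp only [Arith.eval]
    have : a * b < 2 ^ (a.size + b.size) := by
      rw [pow_add]; exact Nat.mul_lt_mul'' ha hb
    lia
  · simp only [Arith.eval]
    have := Nat.div_le_self a b
    lia

/-! ### Expressions with bounded iteration -/

/-- Expressions in `V` variables over the input array. -/
inductive Expr (V : ℕ)
  | const (c : ℕ)
  | var (i : Fin V)
  | input (e : Expr V)
  | op (o : Arith) (a b : Expr V)
  /-- iterate `o` over the values of `e`, as the variable `j` runs from (the value of) `n` down
  to `0`, starting with `c` -/
  | fold (o : Arith) (c : ℕ) (n j : Fin V) (e : Expr V)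

namespace Expr

variable {V : ℕ}

def eval (x : List ℕ) : Expr V → (Fin V → ℕ) → ℕ
  | const c, _ => c
  | var i, ρ => ρ i
  | input e, ρ => x.getD (e.eval x ρ) 0
  | op o a b, ρ => o.eval (a.eval x ρ) (b.eval x ρ)
  | fold o c n j e, ρ =>
      (List.range (ρ n)).foldr (fun a acc => o.eval acc (e.eval x (Function.update ρ j a))) c

/-- The number of scratch registers used by the evaluation. -/
def regs : Expr V → ℕ
  | const _ => 1
  | var _ => 1
  | input e => e.regs
  | op _ a b => max a.regs (b.regs + 1)
  | fold _ _ _ _ e => e.regs + 4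

/-- An exponent that governs the evaluation time and the size of the values. -/
def deg : Expr V → ℕ
  | const c => c + 1
  | var _ => 1
  | input e => e.deg + 1
  | op _ a b => a.deg + b.deg + 2
  | fold _ c _ _ e => e.deg + c + 6

/-- A program that evaluates the expression into register `s`, with variable `i` in register `i`. -/
def compile : Expr V → ℕ → Program
  | const c, s => .instr (.const s c)
  | var i, s => .move s i
  | input e, s => .seq (e.compile s) (.instr (.read s s))
  | op o a b, s => .seq (a.compile s) (.seq (b.compile (s + 1)) (.instr (.arith o s s (s + 1))))
  | fold o c n j e, s =>
      .seq (.instr (.const s c)) <| .seq (.move (s + 1) n) <| .seq (.move (s + 2) j) <|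
      .seq (.instr (.const (s + 3) 1)) <| .seq (.loop (s + 1)
        (.seq (.instr (.arith .sub (s + 1) (s + 1) (s + 3))) <| .seq (.move j (s + 1)) <|
          .seq (e.compile (s + 4)) (.instr (.arith o s s (s + 4)))))
      (.move j (s + 2))

theorem regs_pos (e : Expr V) : 0 < e.regs := by
  induction e <;> simp [regs] <;> omega

theorem size_foldr_le (o : Arith) (g : ℕ → ℕ) {D : ℕ} {n : ℕ} (hg : ∀ a < n, Nat.size (g a) ≤ D)
    (c : ℕ) :
    Nat.size ((List.range n).foldr (fun a acc => o.eval acc (g a)) c) ≤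
      Nat.size c + n * (D + 1) := by
  induction n generalizing c with
  | zero => simp
  | succ n ih =>
    rw [List.range_succ, List.foldr_append, List.foldr_cons, List.foldr_nil]
    refine (ih (fun a ha => hg a (by lia)) _).trans ?_
    have h1 := size_eval_le o c (g n)
    have h2 := hg n (by lia)
    rw [Nat.succ_mul]
    lia

/-- The cost of a fold: `B` passes of cost `X ^ d` plus overhead. In the exponent, `c` pays for the
initial value, one unit for the factor `B`, and five units (a factor of at least 32) for the
constants. -/
theorem fold_arith {X B d c : ℕ} (hX : B + 2 = X) :
    c + B * (X ^ d + 10) + 10 ≤ X ^ (d + c + 6) := by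
  have hc : c + 1 ≤ X ^ c := (Nat.lt_pow_self (n := c) (show 1 < X by lia))
  have hd : 1 ≤ X ^ d := Nat.one_le_pow _ _ (by lia)
  have h5 : 2 ^ 5 ≤ X ^ 5 := Nat.pow_le_pow_left (by lia) 5
  have e : X ^ (d + c + 6) = X ^ d * X ^ c * X * X ^ 5 := by ring
  rw [e]
  have hp : X ^ d * X ^ c ≥ X ^ d := Nat.le_mul_of_pos_right _ (by lia)
  have hq : X ^ d * X ^ c ≥ X ^ c := Nat.le_mul_of_pos_left _ (by lia)
  have h1 : X ^ d * X ^ c * X * 32 ≤ X ^ d * X ^ c * X * X ^ 5 := Nat.mul_le_mul_left _ (by lia)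
  generalize X ^ d * X ^ c = Y at *
  refine le_trans ?_ h1
  have : B * (X ^ d + 10) ≤ X * (Y + 10 * Y) := Nat.mul_le_mul (by lia) (by lia)
  have : Y ≤ Y * X := Nat.le_mul_of_pos_right _ (by lia)
  have : 2 * Y ≤ Y * X := by rw [mul_comm]; exact Nat.mul_le_mul_left _ (by lia)
  nlinarith

theorem op_arith {X a b : ℕ} (hX : 2 ≤ X) : X ^ a + X ^ b + 1 ≤ X ^ (a + b + 2) := by
  have ha : 1 ≤ X ^ a := Nat.one_le_pow _ _ (by lia)
  have hb : 1 ≤ X ^ b := Nat.one_le_pow _ _ (by lia)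
  have h2 : 2 ^ 2 ≤ X ^ 2 := Nat.pow_le_pow_left (by lia) 2
  rw [pow_add, pow_add]
  have hp : X ^ a * X ^ b ≥ X ^ a := Nat.le_mul_of_pos_right _ (by lia)
  have hq : X ^ a * X ^ b ≥ X ^ b := Nat.le_mul_of_pos_left _ (by lia)
  have h1 : X ^ a * X ^ b * 4 ≤ X ^ a * X ^ b * X ^ 2 := Nat.mul_le_mul_left _ (by lia)
  lia

theorem update_le {B : ℕ} {ρ : Fin V → ℕ} (hρ : ∀ i, ρ i ≤ B) {a : ℕ} (ha : a ≤ B) (j : Fin V) :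
    ∀ i, Function.update ρ j a i ≤ B := fun i => by
  rw [Function.update_apply]; split_ifs
  exacts [ha, hρ i]

/-- Variables are bounded in value because they serve as loop bounds; input entries only need few
bits. Each pass of a fold adds at most one bit more than the size of the body's value, so sizes stay
polynomial in `B`. -/
theorem size_eval_le {B : ℕ} (hx : ∀ i, Nat.size (x.getD i 0) ≤ B) (e : Expr V) {ρ : Fin V → ℕ}
    (hρ : ∀ i, ρ i ≤ B) : Nat.size (e.eval x ρ) ≤ (B + 2) ^ e.deg := by
  induction e generalizing ρ with
  | const c =>
    simp only [eval, deg]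
    have := size_le_self c
    have := (Nat.lt_pow_self (n := c + 1) (show 1 < B + 2 by lia))
    lia
  | var i =>
    simp only [eval, deg]
    have := size_le_self (ρ i)
    have := hρ i
    lia
  | input e ih =>
    simp only [eval, deg]
    refine (hx _).trans ?_
    rw [pow_succ]
    have := Nat.le_mul_of_pos_left (B + 2) (show 0 < (B + 2) ^ e.deg by positivity)
    lia
  | op o a b iha ihb =>
    simp only [eval, deg]
    refine (RAM.size_eval_le _ _ _).trans (le_trans ?_ (op_arith (by lia)))
    have := iha hρ
    have := ihb hρ
    lia
  | fold o c n j e ih =>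
    simp only [eval, deg]
    refine (size_foldr_le o (fun a => e.eval x (Function.update ρ j a))
      (D := (B + 2) ^ e.deg) ?_ c).trans (le_trans ?_ (fold_arith (d := e.deg) (B := B) rfl))
    · intro a ha
      exact ih (update_le hρ (ha.le.trans (hρ n)) j)
    · have := size_le_self c
      have : ρ n * ((B + 2) ^ e.deg + 1) ≤ B * ((B + 2) ^ e.deg + 10) :=
        Nat.mul_le_mul (hρ n) (by lia)
      lia

/-- Induction on the counter, for every accumulator `c`: the first pass treats the largest index,
just as `foldr` over `List.range` does. `hW` is a potential: a pass lengthens the accumulator by at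
most `D + 1` bits and lowers the counter by one. -/
theorem fold_loop {B s D : ℕ} {o : Arith} {j : Fin V} {e : Expr V} {c : ℕ}
    (hVs : V ≤ s) (hh : s + 4 + e.regs ≤ h) (hD : 0 < D)
    (ih : ∀ m : Mem, (∀ i < h, Nat.size (m i) ≤ W) → (∀ i : Fin V, m i ≤ B) →
      ∃ m', Runs h W x (e.compile (s + 4)) m m' D ∧ m' (s + 4) = e.eval x (fun i => m i) ∧
        ∀ i < s + 4, m' i = m i)
    (hDe : ∀ ρ : Fin V → ℕ, (∀ i, ρ i ≤ B) → Nat.size (e.eval x ρ) ≤ D)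
    {a : ℕ} (ha : a ≤ B) (hW : Nat.size c + a * (D + 1) ≤ W)
    {m : Mem} (hm : ∀ i < h, Nat.size (m i) ≤ W) (hB : ∀ i : Fin V, m i ≤ B)
    (hs : m s = c) (hs1 : m (s + 1) = a) (hs3 : m (s + 3) = 1) :
    ∃ m', Runs h W x (.loop (s + 1)
        (.seq (.instr (.arith .sub (s + 1) (s + 1) (s + 3))) <| .seq (.move j (s + 1)) <|
          .seq (e.compile (s + 4)) (.instr (.arith o s s (s + 4))))) m m' (1 + a * (D + 5)) ∧
      m' s = (List.range a).foldr
        (fun a acc => o.eval acc (e.eval x (Function.update (fun i : Fin V => m i) j a))) c ∧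
      m' (s + 2) = m (s + 2) ∧ ∀ i < s, i ≠ j → m' i = m i := by
  induction a generalizing m c with
  | zero => exact ⟨m, by simpa using Runs.loop_done hm hs1, by simpa using hs, rfl, fun _ _ _ => rfl⟩
  | succ a IH =>
    have hjs : (j : ℕ) < s := j.2.trans_le hVs
    have hD1 : a + 1 ≤ W := by
      have : (a + 1) * 1 ≤ (a + 1) * (D + 1) := Nat.mul_le_mul_left _ (by lia)
      lia
    have hsa : Nat.size a ≤ W := (size_le_self a).trans (by lia)
    have r1 := Runs.arith (x := x) (o := .sub) (i := s + 1) (j := s + 1) (l := s + 3) hm (by lia)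
      (by simpa [Arith.eval, hs1, hs3] using hsa)
    simp only [Arith.eval, hs1, hs3, Nat.add_sub_cancel] at r1
    have r2 := Runs.move (x := x) (i := j) (j := s + 1) r1.2.2 (by lia) (by lia)
      (by simpa using hsa)
    set m2 := (m.update (s + 1) a).update j ((m.update (s + 1) a) (s + 1)) with hm2
    have hm2j : m2 j = a := by simp [hm2]
    have hm2o : ∀ i : ℕ, i ≠ j → i ≠ s + 1 → m2 i = m i := fun i h1 h2 => by
      simp [hm2, h1, h2]
    have hm21 : m2 (s + 1) = a := by
      simp [hm2, Function.update_apply]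
    have hρ : (fun i : Fin V => m2 i) = Function.update (fun i : Fin V => m i) j a := by
      ext i
      rw [Function.update_apply]
      split_ifs with hi
      · rw [hi, hm2j]
      · exact hm2o i (fun h => hi (Fin.ext h)) (by have := i.2; lia)
    have hB2 : ∀ i : Fin V, m2 i ≤ B := fun i => by
      rw [show m2 i = _ from congrFun hρ i]
      exact update_le hB (by lia) j i
    obtain ⟨m3, r3, he3, hl3⟩ := ih m2 r2.2.2 hB2
    have hv : Nat.size (e.eval x (fun i => m2 i)) ≤ D := hDe _ hB2
    have hm3s : m3 s = c := by rw [hl3 s (by lia), hm2o s (by lia) (by lia), hs]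
    have hsz : Nat.size (o.eval c (e.eval x fun i => m2 i)) + a * (D + 1) ≤ W := by
      have := RAM.size_eval_le o c (e.eval x (fun i => m2 i))
      rw [Nat.succ_mul] at hW
      lia
    have r4 := Runs.arith (x := x) (o := o) (i := s) (j := s) (l := s + 4) r3.2.2 (by lia)
      (by rw [hm3s, he3]; lia)
    rw [hm3s, he3] at r4
    set m4 := m3.update s (o.eval c (e.eval x fun i => m2 i)) with hm4
    have hm4s : m4 s = o.eval c (e.eval x fun i => m2 i) := by simp [hm4]
    have hm4o : ∀ i < s + 4, i ≠ s → m4 i = m2 i := fun i h1 h2 => by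
      simp [hm4, h2, hl3 i h1]
    have hB4 : ∀ i : Fin V, m4 i ≤ B := fun i => by
      rw [hm4o i (by have := i.2; lia) (by have := i.2; lia)]; exact hB2 i
    obtain ⟨m5, r5, he5, h52, hl5⟩ := IH (c := o.eval c (e.eval x fun i => m2 i)) (by lia) hsz
      r4.2.2 hB4 hm4s (by rw [hm4o _ (by lia) (by lia), hm21])
      (by rw [hm4o _ (by lia) (by lia), hm2o _ (by lia) (by lia), hs3])
    refine ⟨m5, (Runs.loop_step (by lia) (r1.seq (r2.seq (r3.seq r4))) r5).mono (by
      rw [Nat.succ_mul]; lia), ?_, ?_, ?_⟩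
    · rw [he5, List.range_succ, List.foldr_append, List.foldr_cons, List.foldr_nil, hρ]
      have : ∀ b, Function.update (fun i : Fin V => m4 i) j b
          = Function.update (fun i : Fin V => m i) j b := fun b => by
        ext i
        simp only [Function.update_apply]
        split_ifs with hi
        · rfl
        · have := i.2
          rw [hm4o i (by lia) (by lia), hm2o i (fun h => hi (Fin.ext h)) (by lia)]
      simp only [this]
    · rw [h52, hm4o _ (by lia) (by lia), hm2o _ (by lia) (by lia)]
    · intro i hi hij
      rw [hl5 i hi hij, hm4o _ (by lia) (by lia), hm2o _ hij (by lia)]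

/-- All registers below `s` are preserved at the end, so scratch registers behave like a stack and
subexpressions can be evaluated one after the other. The same power of `B + 2` bounds the time and
the number of bits. -/
theorem compile_runs {B : ℕ} (hx : ∀ i, Nat.size (x.getD i 0) ≤ B) (e : Expr V) {s : ℕ}
    (hVs : V ≤ s) (hh : s + e.regs ≤ h) (hW : (B + 2) ^ e.deg ≤ W)
    (hm : ∀ i < h, Nat.size (m i) ≤ W) (hB : ∀ i : Fin V, m i ≤ B) :
    ∃ m', Runs h W x (e.compile s) m m' ((B + 2) ^ e.deg) ∧ m' s = e.eval x (fun i => m i) ∧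
      ∀ i < s, m' i = m i := by
  have hsize := e.size_eval_le hx hB
  induction e generalizing m s with
  | const c =>
    simp only [compile, deg, eval, regs] at *
    refine ⟨_, (Runs.const hm (by lia) (by lia)).mono (Nat.one_le_pow _ _ (by lia)), by simp,
      fun i hi => ?_⟩
    simp [Function.update_of_ne hi.ne]
  | var j =>
    simp only [compile, deg, eval, regs] at *
    have := j.2
    refine ⟨_, (Runs.move hm (by lia) (by lia) (hsize.trans hW)).mono (by lia), by simp,
      fun i hi => ?_⟩
    simp [Function.update_of_ne hi.ne]
  | input e ih =>
    simp only [compile, deg, eval, regs] at *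
    have hX : (B + 2) ^ e.deg * 2 ≤ (B + 2) ^ (e.deg + 1) := by
      rw [pow_succ]; exact Nat.mul_le_mul_left _ (by lia)
    have h1 : 1 ≤ (B + 2) ^ e.deg := Nat.one_le_pow _ _ (by lia)
    obtain ⟨m1, r1, he, hl⟩ := ih hVs hh (by lia) hm hB (e.size_eval_le hx hB)
    have r2 := Runs.instr (x := x) (a := .read s s) (i := s) r1.2.2 rfl
      (by have := e.regs_pos; lia) (by rw [he]; exact hsize.trans hW)
    refine ⟨_, (r1.seq r2).mono (by lia), by simp [he], fun i hi => ?_⟩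
    simp [Function.update_of_ne hi.ne, hl i hi]
  | op o a b iha ihb =>
    simp only [compile, deg, eval, regs] at *
    have hX := op_arith (X := B + 2) (a := a.deg) (b := b.deg) (by lia)
    obtain ⟨m1, r1, he1, hl1⟩ := iha hVs (by lia) (by lia) hm hB (a.size_eval_le hx hB)
    have hρ : (fun i : Fin V => m1 i) = fun i : Fin V => m i := by
      ext i; exact hl1 i (by lia)
    have hB1 : ∀ i : Fin V, m1 i ≤ B := fun i => by rw [congrFun hρ i]; exact hB i
    obtain ⟨m2, r2, he2, hl2⟩ := ihb (s := s + 1) (by lia) (by lia) (by lia) r1.2.2 hB1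
      (b.size_eval_le hx hB1)
    have r3 := Runs.arith (x := x) (o := o) (i := s) (j := s) (l := s + 1) r2.2.2 (by lia)
      (by rw [he2, hl2 s (by lia), he1, hρ]; exact hsize.trans hW)
    refine ⟨_, (r1.seq (r2.seq r3)).mono (by lia), ?_, fun i hi => ?_⟩
    · simp [he2, hl2 s, he1, hρ]
    · simp [Function.update_of_ne hi.ne, hl2 i (by lia), hl1 i hi]
  | fold o c n j e ih =>
    simp only [compile, deg, eval, regs] at *
    have hX := fold_arith (X := B + 2) (B := B) (d := e.deg) (c := c) rfl
    have hXW : (B + 2) ^ e.deg ≤ (B + 2) ^ (e.deg + c + 6) :=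
      Nat.pow_le_pow_right (by lia) (by lia)
    have hXe : 0 < (B + 2) ^ e.deg := by positivity
    have hjs : (j : ℕ) < s := j.2.trans_le hVs
    have hns : (n : ℕ) < s := n.2.trans_le hVs
    have hsc := size_le_self c
    have hsn : Nat.size (m n) ≤ W := hm n (by lia)
    have hsj : Nat.size (m j) ≤ W := hm j (by lia)
    have hnB : m n ≤ B := hB n
    have r1 := Runs.const (x := x) (i := s) (c := c) hm (by lia) (by lia)
    have r2 := Runs.move (x := x) (i := s + 1) (j := n) r1.2.2 (by lia) (by lia)
      (by simpa [Function.update_of_ne hns.ne] using hsn)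
    have r3 := Runs.move (x := x) (i := s + 2) (j := j) r2.2.2 (by lia) (by lia)
      (by simpa [Function.update_apply, hjs.ne, show (j : ℕ) ≠ s + 1 by lia] using hsj)
    have r4 := Runs.const (x := x) (i := s + 3) (c := 1) r3.2.2 (by lia) (by simp; lia)
    generalize hm4 : Finsupp.update (Finsupp.update _ (s + 2) _) (s + 3) 1 = m4 at r4
    have h4l : ∀ i < s, m4 i = m i := fun i hi => by
      simp [← hm4, Function.update_apply, show i ≠ s + 3 by lia, show i ≠ s + 2 by lia,
        show i ≠ s + 1 by lia, hi.ne]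
    have h40 : m4 s = c := by simp [← hm4, Function.update_apply]
    have h41 : m4 (s + 1) = m n := by simp [← hm4, Function.update_apply, hns.ne]
    have h42 : m4 (s + 2) = m j := by
      simp [← hm4, Function.update_apply, hjs.ne, show (j : ℕ) ≠ s + 1 by lia]
    have h43 : m4 (s + 3) = 1 := by simp [← hm4]
    have hρ : (fun i : Fin V => m4 i) = fun i : Fin V => m i := by
      ext i; exact h4l i (by lia)
    have hDn : m n * ((B + 2) ^ e.deg + 10) ≤ B * ((B + 2) ^ e.deg + 10) :=
      Nat.mul_le_mul_right _ hnB
    obtain ⟨m5, r5, he5, h52, hl5⟩ := fold_loop (o := o) (j := j) (e := e) (c := c)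
      (D := (B + 2) ^ e.deg) (m := m4) hVs (by lia) hXe
      (fun m hm hB => ih (by lia) (by lia) (by lia) hm hB (e.size_eval_le hx hB))
      (fun ρ hρ => e.size_eval_le hx hρ) hnB
      (by have : m n * ((B + 2) ^ e.deg + 1) ≤ m n * ((B + 2) ^ e.deg + 10) :=
            Nat.mul_le_mul_left _ (by lia)
          lia)
      r4.2.2 (fun i => by rw [congrFun hρ i]; exact hB i) h40 h41 h43
    -- The loop has overwritten the variable `j`; its old value was saved in register `s + 2`.
    have r6 := Runs.move (x := x) (i := j) (j := s + 2) r5.2.2 (by lia) (by lia)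
      (by rw [h52, h42]; exact hsj)
    refine ⟨_, (r1.seq (r2.seq (r3.seq (r4.seq (r5.seq r6))))).mono ?_, ?_, fun i hi => ?_⟩
    · have : m n * ((B + 2) ^ e.deg + 5) ≤ m n * ((B + 2) ^ e.deg + 10) :=
        Nat.mul_le_mul_left _ (by lia)
      lia
    · simp only [Finsupp.coe_update, Function.update_of_ne hjs.ne', he5, hρ]
    · by_cases hij : i = j
      · simp [hij, h52, h42]
      · simp [Function.update_of_ne hij, hl5 i hi hij, h4l i hi]

end Expr

end RAM

namespace RAM

/-! ### Running a program on a virtual input -/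

/-- Run a program with its registers shifted by `h`, on the virtual input whose length is given by
the variable `lv` and whose entry at the index `jv` is the value of `e`. -/
def Program.relocate {V : ℕ} (h : ℕ) (e : Expr V) (lv jv : Fin V) : Program → Program
  | .skip => .skip
  | .instr (.const i c) => .instr (.const (i + h) c)
  | .instr (.arith o i j l) => .instr (.arith o (i + h) (j + h) (l + h))
  | .instr (.load i j) => .seq (.instr (.const V h)) <|
      .seq (.instr (.arith .add V (j + h) V)) (.instr (.load (i + h) V))
  | .instr (.store i j) => .seq (.instr (.const V h)) <|
      .seq (.instr (.arith .add V (i + h) V)) (.instr (.store V (j + h)))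
  | .instr (.read i j) => .seq (.move V (j + h)) <| .seq (.instr (.arith .sub (V + 1) lv V)) <|
      .seq (.branch (V + 1) (.seq (.move jv V) (e.compile V)) (.instr (.const V 0))) <|
      .seq (.instr (.const (V + 1) 0)) (.instr (.arith .add (i + h) V (V + 1)))
  | .seq P Q => .seq (P.relocate h e lv jv) (Q.relocate h e lv jv)
  | .branch i P Q => .branch (i + h) (P.relocate h e lv jv) (Q.relocate h e lv jv)
  | .loop i P => .loop (i + h) (P.relocate h e lv jv)

theorem Exec.memBits_final_le {x : List ℕ} {P : Program} {m m' : Mem} {t s : ℕ}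
    (he : Exec x P m m' t s) : memBits m' ≤ s := by
  induction he with
  | skip => exact le_rfl
  | instr => exact le_max_right _ _
  | seq _ _ _ ih => exact ih.trans (le_max_right _ _)
  | branch_then _ _ ih => exact ih
  | branch_else _ _ ih => exact ih
  | loop_done => exact le_rfl
  | loop_step _ _ _ _ ih => exact ih.trans (le_max_right _ _)

theorem size_le_memBits (m : Mem) (i : ℕ) : Nat.size (m i) ≤ memBits m := by
  by_cases hi : m i = 0
  · simp [hi]
  · unfold memBits Finsupp.sum
    have := Finset.single_le_sum (f := fun i => Nat.size i + Nat.size (m i))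
      (fun _ _ => Nat.zero_le _) (Finsupp.mem_support_iff.2 hi)
    exact (Nat.le_add_left _ _).trans this

/-- Shifting by `h` lengthens an address by at most `h + 1` bits. A register in use holds a nonzero
number, hence at least one bit, so this additive overhead is covered by a constant factor. -/
theorem highBits_le {h : ℕ} {m M : Mem} (hM : ∀ i, M (i + h) = m i) :
    highBits h M ≤ (h + 2) * memBits m := by
  unfold highBits memBits Finsupp.sum
  have hs : M.support.filter (h ≤ ·) = m.support.image (· + h) := by
    ext i
    simp only [Finset.mem_filter, Finsupp.mem_support_iff, Finset.mem_image]
    constructor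
    · rintro ⟨h1, h2⟩
      refine ⟨i - h, ?_, by omega⟩
      rwa [← hM, Nat.sub_add_cancel h2]
    · rintro ⟨j, h1, rfl⟩
      exact ⟨by rwa [hM], by omega⟩
  rw [hs, Finset.sum_image (fun a _ b _ hab => Nat.add_right_cancel hab), Finset.mul_sum]
  refine Finset.sum_le_sum fun i hi => ?_
  rw [hM]
  have h1 : 0 < Nat.size (m i) := Nat.size_pos.2 (Nat.pos_of_ne_zero (Finsupp.mem_support_iff.1 hi))
  have h2 := size_eval_le .add i h
  simp only [Arith.eval] at h2
  have h3 := size_le_self h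
  have h4 : (h + 1) * 1 ≤ (h + 1) * (i.size + (m i).size) := Nat.mul_le_mul_left _ (by omega)
  change _ ≤ (h + 2) * (i.size + (m i).size)
  have e : (h + 2) * (i.size + (m i).size) =
      (h + 1) * (i.size + (m i).size) + (i.size + (m i).size) := by ring
  omega

/-- The memory `M` represents the virtual memory `m`, with the variables given by `ρ`. -/
structure Represents {V : ℕ} (h W B : ℕ) (ρ : Fin V → ℕ) (jv : Fin V) (m M : Mem) : Prop where
  high : ∀ i, M (i + h) = m i
  low : ∀ i < h, Nat.size (M i) ≤ W
  var : ∀ i : Fin V, i ≠ jv → M i = ρ i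
  idx : M jv ≤ B

variable {V h W B S : ℕ} {ρ : Fin V → ℕ} {jv lv : Fin V} {m m' M M' : Mem} {x y : List ℕ}
  {e : Expr V}

theorem Represents.memBits_le (hM : Represents h W B ρ jv m M) (hm : memBits m ≤ S) :
    memBits M ≤ h * (h + W) + (h + 2) * S :=
  (RAM.memBits_le hM.low).trans
    (Nat.add_le_add_left ((highBits_le hM.high).trans (Nat.mul_le_mul_left _ hm)) _)

/-- Writing a high register. -/
theorem Represents.update (hM : Represents h W B ρ jv m M) (hV : V ≤ h) (i v : ℕ) :
    Represents h W B ρ jv (m.update i v) (M.update (i + h) v) where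
  high k := by simp [Function.update_apply, hM.high]
  low k hk := by
    rw [Finsupp.coe_update, Function.update_of_ne (by omega)]; exact hM.low k hk
  var k hk := by
    have := k.2
    rw [Finsupp.coe_update, Function.update_of_ne (by omega)]; exact hM.var k hk
  idx := by
    have := jv.2
    rw [Finsupp.coe_update, Function.update_of_ne (by omega)]; exact hM.idx

/-- Working on the low registers. -/
theorem Represents.runs {P : Program} {T : ℕ} (hM : Represents h W B ρ jv m M)
    (hr : Runs h W x P M M' T) (hv : ∀ i : Fin V, i ≠ jv → M' i = M i) (hj : M' jv ≤ B) :
    Represents h W B ρ jv m M' where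
  high k := by rw [hr.2.1 _ (by omega), hM.high]
  low := hr.2.2
  var k hk := (hv k hk).trans (hM.var k hk)
  idx := hj

/-- A run on the low registers, followed by writing a high one. -/
theorem Represents.write {P : Program} {T : ℕ} {a : Instr} {i v : ℕ}
    (hM : Represents h W B ρ jv m M) (hV : V ≤ h) (hr : Runs h W x P M M' T)
    (hv : ∀ i : Fin V, i ≠ jv → M' i = M i) (hj : M' jv ≤ B) (ha : a.apply x M' = M'.update (i + h) v)
    (hm : memBits m ≤ S) (hm' : memBits (m.update i v) ≤ S) :
    ∃ M'' t' s', Exec x (.seq P (.instr a)) M M'' t' s' ∧ t' ≤ T + 1 ∧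
      s' ≤ h * (h + W) + (h + 2) * S ∧ Represents h W B ρ jv (m.update i v) M'' := by
  have hM' := hM.runs hr hv hj
  have hM'' := hM'.update hV i v
  obtain ⟨⟨t, s, he, ht, hs⟩, -⟩ := hr
  have he' := Exec.instr (x := x) a M'
  rw [ha] at he'
  refine ⟨_, _, _, he.seq he', by omega, max_le (hs.trans ?_)
    (max_le (hM'.memBits_le hm) (hM''.memBits_le hm')), hM''⟩
  exact Nat.add_le_add_left ((highBits_le hM.high).trans (Nat.mul_le_mul_left _ hm)) _

/-- Relocated instructions nest to the right, whereas `Represents.write` splits off the last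
instruction, the only one that touches the high registers. -/
theorem exec_seq_assoc {P Q R : Program} {m m' : Mem} {t s : ℕ}
    (he : Exec x (.seq (.seq P Q) R) m m' t s) : Exec x (.seq P (.seq Q R)) m m' t s := by
  cases he with
  | seq h1 h2 =>
    cases h1 with
    | seq h3 h4 =>
      have := h3.seq (h4.seq h2)
      rwa [← add_assoc, ← max_assoc] at this

/-- Only reading the virtual input costs more than a few operations. `W` includes `S` because
virtual contents pass through low registers, and `2 * h` because `h` is added to virtual addresses
there. The variable `jv` is overwritten by reads, so `Represents` keeps only a bound on it. -/
theorem relocate_instr (hV : V + e.regs ≤ h) (hV2 : V + 2 ≤ h) (hlj : lv ≠ jv)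
    (hx : ∀ i, Nat.size (x.getD i 0) ≤ B) (hρ : ∀ i, ρ i ≤ B)
    (hy : ∀ j, y.getD j 0 = if j < ρ lv then e.eval x (Function.update ρ jv j) else 0)
    (hW : S + 2 * h + B + (B + 2) ^ e.deg ≤ W) {a : Instr}
    (hm : memBits m ≤ S) (hm' : memBits (a.apply y m) ≤ S) (hM : Represents h W B ρ jv m M) :
    ∃ M' t' s', Exec x (Program.relocate h e lv jv (.instr a)) M M' t' s' ∧
      t' ≤ (B + 2) ^ e.deg + 12 ∧ s' ≤ h * (h + W) + (h + 2) * S ∧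
      Represents h W B ρ jv (a.apply y m) M' := by
  have hjv := jv.2
  have hsz : ∀ i, Nat.size (m i) ≤ S := fun i => (size_le_memBits m i).trans hm
  have hsh := size_le_self h
  cases a with
  | const i c =>
    have hM' := hM.update (by omega) i c
    exact ⟨_, _, _, .instr _ _, by omega, max_le (hM.memBits_le hm) (hM'.memBits_le hm'), hM'⟩
  | arith o i j l =>
    have hM' := hM.update (by omega) i (o.eval (m j) (m l))
    refine ⟨_, _, _, .instr _ _, by omega, max_le (hM.memBits_le hm) ?_, ?_⟩
    all_goals simp only [Instr.apply, hM.high]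
    exacts [hM'.memBits_le hm', hM']
  | load i j =>
    have r1 := Runs.const (x := x) (i := V) (c := h) hM.low (by omega) (by omega)
    have r2 := Runs.arith (x := x) (o := .add) (i := V) (j := j + h) (l := V) r1.2.2 (by omega) (by
      refine (size_eval_le _ _ _).trans ?_
      simp only [Finsupp.coe_update, Function.update_self,
        Function.update_of_ne (show j + h ≠ V by omega), hM.high]
      have := hsz j
      omega)
    simp only [Finsupp.coe_update, Function.update_self, Arith.eval,
        Function.update_of_ne (show j + h ≠ V by omega), hM.high] at r2
    obtain ⟨M'', t, s, he, ht, hs, hR⟩ := hM.write (S := S) (a := .load (i + h) V) (i := i)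
      (v := m (m j))
      (by omega) (r1.seq r2)
      (fun k _ => by
        simp [Function.update_of_ne (show (k : ℕ) ≠ V from k.2.ne)])
      (by simpa [Function.update_of_ne hjv.ne] using hM.idx)
      (by simp [Instr.apply, Function.update_of_ne (show m j + h ≠ V by omega), hM.high])
      hm hm'
    exact ⟨M'', t, s, exec_seq_assoc he, by omega, hs, hR⟩
  | store i j =>
    have r1 := Runs.const (x := x) (i := V) (c := h) hM.low (by omega) (by omega)
    have r2 := Runs.arith (x := x) (o := .add) (i := V) (j := i + h) (l := V) r1.2.2 (by omega) (by
      refine (size_eval_le _ _ _).trans ?_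
      simp only [Finsupp.coe_update, Function.update_self,
        Function.update_of_ne (show i + h ≠ V by omega), hM.high]
      have := hsz i
      omega)
    simp only [Finsupp.coe_update, Function.update_self, Arith.eval,
        Function.update_of_ne (show i + h ≠ V by omega), hM.high] at r2
    obtain ⟨M'', t, s, he, ht, hs, hR⟩ := hM.write (S := S) (a := .store V (j + h)) (i := m i)
      (v := m j)
      (by omega) (r1.seq r2)
      (fun k _ => by
        simp [Function.update_of_ne (show (k : ℕ) ≠ V from k.2.ne)])
      (by simpa [Function.update_of_ne hjv.ne] using hM.idx)
      (by simp [Instr.apply, Function.update_of_ne (show j + h ≠ V by omega), hM.high])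
      hm hm'
    exact ⟨M'', t, s, exec_seq_assoc he, by omega, hs, hR⟩
  | read i j =>
    have hlv := lv.2
    have hsl := size_le_self (ρ lv)
    have hlB := hρ lv
    have r1 := Runs.move (x := x) (i := V) (j := j + h) hM.low (by omega) (by omega)
      (by rw [hM.high]; have := hsz j; omega)
    rw [hM.high] at r1
    have hsub : Nat.size (ρ lv - m j) ≤ W := (size_le_self _).trans (by omega)
    have r2 := Runs.arith (x := x) (o := .sub) (i := V + 1) (j := lv) (l := V) r1.2.2 (by omega) (by
      simpa [Function.update_of_ne hlv.ne, hM.var lv hlj, Arith.eval] using hsub)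
    simp only [Finsupp.coe_update, Function.update_self, Arith.eval,
        Function.update_of_ne hlv.ne, hM.var lv hlj] at r2
    generalize hM2 : Finsupp.update (Finsupp.update M V (m j)) (V + 1) (ρ lv - m j) = M2 at r2
    have h2v : ∀ k : Fin V, M2 k = M k := fun k => by
      simp [← hM2, Function.update_of_ne (show (k : ℕ) ≠ V from k.2.ne),
        Function.update_of_ne (show (k : ℕ) ≠ V + 1 by omega)]
    have h2V : M2 V = m j := by simp [← hM2]
    have h2V1 : M2 (V + 1) = ρ lv - m j := by simp [← hM2]
    -- Register `V + 1` holds the truncated difference of length and index, which is nonzero exactly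
    -- for the indices inside the virtual input; outside, the value is `0`.
    have key : ∃ M3, Runs h W x
        (.branch (V + 1) (.seq (.move jv V) (e.compile V)) (.instr (.const V 0))) M2 M3
          ((B + 2) ^ e.deg + 3) ∧ M3 V = y.getD (m j) 0 ∧
        (∀ k : Fin V, k ≠ jv → M3 k = M k) ∧ M3 jv ≤ B := by
      rw [hy]
      split_ifs with hj
      · have r3 := Runs.move (x := x) (i := jv) (j := V) r2.2.2 (by omega) (by omega)
          (by rw [h2V]; have := hsz j; omega)
        rw [h2V] at r3
        have hρ' : (fun k : Fin V => M2.update jv (m j) k) = Function.update ρ jv (m j) := by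
          ext k
          by_cases hk : k = jv
          · simp [hk]
          · have : (k : ℕ) ≠ jv := fun h => hk (Fin.ext h)
            simp [hk, Function.update_of_ne this, h2v, hM.var k hk]
        obtain ⟨M3, r4, he4, hl4⟩ := e.compile_runs (s := V) hx le_rfl hV (by omega) r3.2.2
          (fun k => by
            rw [congrFun hρ' k]
            exact Expr.update_le hρ (by omega) _ _)
        refine ⟨M3, (Runs.branch_then (by omega) (r3.seq r4)).mono (by omega), ?_, ?_, ?_⟩
        · rw [he4, hρ']
        · intro k hk
          have : (k : ℕ) ≠ jv := fun h => hk (Fin.ext h)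
          rw [hl4 k k.2, ← h2v]
          simp [Function.update_of_ne this]
        · rw [hl4 _ hjv]
          simp
          omega
      · have r3 := Runs.const (x := x) (i := V) (c := 0) r2.2.2 (by omega) (by simp)
        refine ⟨_, (Runs.branch_else (by omega) r3).mono (by omega), by simp, ?_, ?_⟩
        · intro k hk
          simp [Function.update_of_ne (show (k : ℕ) ≠ V from k.2.ne), h2v]
        · simpa [Function.update_of_ne hjv.ne, h2v] using hM.idx
    obtain ⟨M3, r3, h3V, h3v, h3j⟩ := key
    have r4 := Runs.const (x := x) (i := V + 1) (c := 0) r3.2.2 (by omega) (by simp)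
    obtain ⟨M'', t, s, he, ht, hs, hR⟩ := hM.write (S := S) (a := .arith .add (i + h) V (V + 1))
      (i := i) (v := y.getD (m j) 0)
      (by omega) (r1.seq (r2.seq (r3.seq r4)))
      (fun k hk => by
        simp [Function.update_of_ne (show (k : ℕ) ≠ V + 1 by omega), h3v k hk])
      (by simpa [Function.update_of_ne (show (jv : ℕ) ≠ V + 1 by omega)] using h3j)
      (by simp [Instr.apply, Arith.eval, h3V])
      hm hm'
    refine ⟨M'', t, s, ?_, by omega, hs, hR⟩
    have := exec_seq_assoc he
    cases this with
    | seq g1 g2 =>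
      have g3 := exec_seq_assoc g2
      cases g3 with
      | seq g4 g5 => exact g1.seq (g4.seq (exec_seq_assoc g5))

/-- The simulation goes operation by operation: the time is multiplied by the cost of one entry,
while the space grows only by a constant factor and by the low registers, since the virtual input is
recomputed at every access. -/
theorem relocate_exec (hV : V + e.regs ≤ h) (hV2 : V + 2 ≤ h) (hlj : lv ≠ jv)
    (hx : ∀ i, Nat.size (x.getD i 0) ≤ B) (hρ : ∀ i, ρ i ≤ B)
    (hy : ∀ j, y.getD j 0 = if j < ρ lv then e.eval x (Function.update ρ jv j) else 0)
    (hW : S + 2 * h + B + (B + 2) ^ e.deg ≤ W) {P : Program} {t s : ℕ} (he : Exec y P m m' t s)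
    (hs : s ≤ S) (hM : Represents h W B ρ jv m M) :
    ∃ M' t' s', Exec x (P.relocate h e lv jv) M M' t' s' ∧
      t' ≤ t * ((B + 2) ^ e.deg + 12) ∧ s' ≤ h * (h + W) + (h + 2) * S ∧
      Represents h W B ρ jv m' M' := by
  generalize hD : (B + 2) ^ e.deg + 12 = D
  have hD1 : 1 ≤ D := by omega
  induction he generalizing M with
  | skip m => exact ⟨M, _, _, .skip M, by omega, hM.memBits_le hs, hM⟩
  | instr a m =>
    obtain ⟨M', t', s', h1, h2, h3, h4⟩ := relocate_instr hV hV2 hlj hx hρ hy hW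
      ((le_max_left _ _).trans hs) ((le_max_right _ _).trans hs) hM
    exact ⟨M', t', s', h1, by omega, h3, h4⟩
  | seq _ _ ih1 ih2 =>
    obtain ⟨M1, t1, s1, h1, h2, h3, h4⟩ := ih1 ((le_max_left _ _).trans hs) hM
    obtain ⟨M2, t2, s2, k1, k2, k3, k4⟩ := ih2 ((le_max_right _ _).trans hs) h4
    exact ⟨M2, _, _, h1.seq k1, by rw [add_mul]; omega, max_le h3 k3, k4⟩
  | branch_then hi _ ih =>
    obtain ⟨M1, t1, s1, h1, h2, h3, h4⟩ := ih hs hM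
    exact ⟨M1, _, _, .branch_then (by rwa [hM.high]) h1, by rw [add_mul]; omega, h3, h4⟩
  | branch_else hi _ ih =>
    obtain ⟨M1, t1, s1, h1, h2, h3, h4⟩ := ih hs hM
    exact ⟨M1, _, _, .branch_else (by rwa [hM.high]) h1, by rw [add_mul]; omega, h3, h4⟩
  | loop_done hi =>
    exact ⟨M, _, _, .loop_done (by rwa [hM.high]), by omega, hM.memBits_le hs, hM⟩
  | loop_step hi _ _ ih1 ih2 =>
    obtain ⟨M1, t1, s1, h1, h2, h3, h4⟩ := ih1 ((le_max_left _ _).trans hs) hM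
    obtain ⟨M2, t2, s2, k1, k2, k3, k4⟩ := ih2 ((le_max_right _ _).trans hs) h4
    exact ⟨M2, _, _, .loop_step (by rwa [hM.high]) h1 k1,
      by rw [add_mul, add_mul]; omega, max_le h3 k3, k4⟩

end RAM

/-! ## The reduction to Independent Set -/

namespace LCSInstance

variable (I : LCSInstance)

/-- Number of bits used for positions. -/
def L : ℕ := Nat.size I.N

/-- Number of gadgets. -/
def n2 : ℕ := I.t * I.r

/-- Number of groups. -/
def n1 : ℕ := I.n2 * (I.N * I.N * I.N)

/-- Number of vertices. -/
def n0 : ℕ := I.n1 * (3 * I.L)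

/-- Index of the first node of the spine of the tree. -/
def base : ℕ := I.n0 + I.n1 + I.n2

/-- Number of nodes of the tree. -/
def nodes : ℕ := I.base + I.t

/-- Number of labels of each kind. -/
def lw : ℕ := 2 * (I.r * I.L)

/-- Number of labels. -/
def labels : ℕ := 5 * I.lw

/-- The `j`-th symbol of the `p`-th string. -/
def sym (p j : ℕ) : ℕ := I.encode.getD (4 + (p * I.N + j)) 0

/-- The group of a vertex. -/
def grp (v : ℕ) : ℕ := v / (3 * I.L)

/-- The gadget of a vertex. -/
def gad (v : ℕ) : ℕ := I.grp v / (I.N * I.N * I.N)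

/-- The round of a vertex. -/
def rnd (v : ℕ) : ℕ := I.gad v / I.r

/-- The string of a vertex. -/
def row (v : ℕ) : ℕ := I.gad v % I.r

/-- The slot of a vertex in its group: letter, position, or successor of the previous position. -/
def slot (v : ℕ) : ℕ := v % (3 * I.L) / I.L

/-- The index of the bit that a vertex stands for. -/
def bit (v : ℕ) : ℕ := v % I.L

/-- The position that names the letter chosen by a group. -/
def gx (g : ℕ) : ℕ := g / (I.N * I.N) % I.N

/-- The position chosen by a group. -/
def gy (g : ℕ) : ℕ := g / I.N % I.N

/-- The successor of the previous position, as chosen by a group. -/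
def gz (g : ℕ) : ℕ := g % I.N

/-- The number chosen by a group in a slot. -/
def num (g s : ℕ) : ℕ := if s = 0 then I.gx g else if s = 1 then I.gy g + 1 else I.gz g

/-- The value of the bit that a vertex stands for. -/
def val (v : ℕ) : ℕ := I.num (I.grp v) (I.slot v) / 2 ^ I.bit v % 2

/-- The choice of a group is admissible. -/
def Good (g : ℕ) : Prop :=
  I.sym 0 (I.gx g) = I.sym (g / (I.N * I.N * I.N) % I.r) (I.gy g) ∧ I.gz g ≤ I.gy g

instance (g : ℕ) : Decidable (I.Good g) := inferInstanceAs (Decidable (_ ∧ _))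

/-- Conflicting vertices of consecutive rounds. -/
def Link (u v : ℕ) : Prop :=
  I.slot u = 1 ∧ I.slot v = 2 ∧ I.row u = I.row v ∧ I.bit u = I.bit v ∧ I.val u ≠ I.val v

/-- Adjacency of distinct vertices. -/
def Conflict (u v : ℕ) : Prop :=
  if I.grp u = I.grp v then ¬ I.Good (I.grp u)
  else if I.gad u = I.gad v then True
  else if I.rnd u = I.rnd v then
    I.slot u = 0 ∧ I.slot v = 0 ∧ I.bit u = I.bit v ∧ I.val u ≠ I.val v
  else if I.rnd u + 1 = I.rnd v then I.Link u v
  else if I.rnd v + 1 = I.rnd u then I.Link v u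
  else False

theorem Conflict.symm {I : LCSInstance} {u v : ℕ} (h : I.Conflict u v) : I.Conflict v u := by
  unfold Conflict at *
  split_ifs at h with h1 h2 h3 h4 h5
  · rw [if_pos h1.symm, ← h1]; exact h
  · rw [if_neg (Ne.symm h1), if_pos h2.symm]; trivial
  · rw [if_neg (Ne.symm h1), if_neg (Ne.symm h2), if_pos h3.symm]
    exact ⟨h.2.1, h.1, h.2.2.1.symm, h.2.2.2.symm⟩
  · rw [if_neg (Ne.symm h1), if_neg (Ne.symm h2), if_neg (Ne.symm h3), if_neg (by omega), if_pos h4]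
    exact h
  · rw [if_neg (Ne.symm h1), if_neg (Ne.symm h2), if_neg (Ne.symm h3), if_pos h5]
    exact h

/-- The graph of the reduction. -/
def graph : SimpleGraph (Fin I.n0) where
  Adj u v := u ≠ v ∧ I.Conflict u v
  symm := ⟨fun _ _ h => ⟨h.1.symm, h.2.symm⟩⟩
  loopless := ⟨fun _ h => h.1 rfl⟩

/-! ### Ranges -/

theorem L_pos : 0 < I.L := Nat.size_pos.2 I.N_pos

theorem cube_pos : 0 < I.N * I.N * I.N := by
  have := I.N_pos; positivity

theorem lw_pos : 0 < I.lw := by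
  have := I.r_pos; have := I.L_pos; unfold lw; positivity

variable {I} {u v : ℕ}

theorem grp_lt (hv : v < I.n0) : I.grp v < I.n1 := by
  have := I.L_pos
  exact (Nat.div_lt_iff_lt_mul (by omega)).2 hv

theorem gad_lt (hv : v < I.n0) : I.gad v < I.n2 :=
  (Nat.div_lt_iff_lt_mul I.cube_pos).2 (grp_lt hv)

theorem rnd_lt (hv : v < I.n0) : I.rnd v < I.t :=
  (Nat.div_lt_iff_lt_mul I.r_pos).2 (gad_lt hv)

theorem row_lt : I.row v < I.r := Nat.mod_lt _ I.r_pos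

theorem slot_lt : I.slot v < 3 := by
  have := I.L_pos
  exact (Nat.div_lt_iff_lt_mul this).2 (Nat.mod_lt _ (by omega))

theorem bit_lt : I.bit v < I.L := Nat.mod_lt _ I.L_pos

theorem val_lt : I.val v < 2 := Nat.mod_lt _ (by omega)

/-! ### Labels -/

variable (I) in
/-- The label with the given kind, string, bit index and bit value. -/
def mkLabel (s p b c : ℕ) : ℕ := s * I.lw + ((p * I.L + b) * 2 + c)

variable (I) in
/-- The initial label of a vertex. -/
def label (v : ℕ) : ℕ := I.mkLabel (I.slot v) (I.row v) (I.bit v) (I.val v)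

variable (I) in
/-- Renaming along an edge of the spine. -/
def renSpine (l : ℕ) : ℕ := if l / I.lw = 1 then l + 2 * I.lw else 4 * I.lw

variable (I) in
/-- The matrix of the nodes of the spine. -/
def MatSpine (i j : ℕ) : Prop :=
  i % I.lw % 2 ≠ j % I.lw % 2 ∧
    ((i / I.lw = 0 ∧ j / I.lw = 0 ∧ i % I.lw / 2 % I.L = j % I.lw / 2 % I.L) ∨
      ((i / I.lw = 2 ∧ j / I.lw = 3 ∨ i / I.lw = 3 ∧ j / I.lw = 2) ∧
        i % I.lw / 2 = j % I.lw / 2))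

instance (i j : ℕ) : Decidable (I.MatSpine i j) := inferInstanceAs (Decidable (_ ∧ _))

theorem MatSpine.symm {i j : ℕ} (h : I.MatSpine i j) : I.MatSpine j i := by
  unfold MatSpine at *
  obtain ⟨h1, h2⟩ := h
  refine ⟨h1.symm, ?_⟩
  rcases h2 with ⟨a, b, c⟩ | ⟨a, b⟩
  · exact Or.inl ⟨b, a, c.symm⟩
  · exact Or.inr ⟨a.symm.imp And.symm And.symm, b.symm⟩

section

variable {s p b c s' p' b' c' : ℕ}

theorem code_lt (hp : p < I.r) (hb : b < I.L) (hc : c < 2) : (p * I.L + b) * 2 + c < I.lw := by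
  have : (p + 1) * I.L ≤ I.r * I.L := Nat.mul_le_mul_right _ hp
  rw [add_mul] at this
  unfold lw
  omega

theorem mkLabel_div (hp : p < I.r) (hb : b < I.L) (hc : c < 2) :
    I.mkLabel s p b c / I.lw = s := by
  have := code_lt hp hb hc
  rw [mkLabel, mul_comm, Nat.mul_add_div I.lw_pos, Nat.div_eq_of_lt this, add_zero]

theorem mkLabel_mod (hp : p < I.r) (hb : b < I.L) (hc : c < 2) :
    I.mkLabel s p b c % I.lw = (p * I.L + b) * 2 + c := by
  have := code_lt hp hb hc
  rw [mkLabel, mul_comm, Nat.mul_add_mod, Nat.mod_eq_of_lt this]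

theorem mkLabel_lt (hs : s < 5) (hp : p < I.r) (hb : b < I.L) (hc : c < 2) :
    I.mkLabel s p b c < I.labels := by
  have := code_lt hp hb hc
  have h : (s + 1) * I.lw ≤ 5 * I.lw := Nat.mul_le_mul_right _ hs
  rw [add_mul] at h
  unfold mkLabel labels
  omega

/-- Kind 0 ignores the string, since all strings share the letter of a round. Kinds 2 and 3 compare
the string as well, since positions are linked within one string. -/
theorem matSpine_mkLabel (hp : p < I.r) (hb : b < I.L) (hc : c < 2) (hp' : p' < I.r)
    (hb' : b' < I.L) (hc' : c' < 2) :
    I.MatSpine (I.mkLabel s p b c) (I.mkLabel s' p' b' c') ↔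
      c ≠ c' ∧ ((s = 0 ∧ s' = 0 ∧ b = b') ∨
        ((s = 2 ∧ s' = 3 ∨ s = 3 ∧ s' = 2) ∧ p = p' ∧ b = b')) := by
  have e1 : ∀ a c, c < 2 → (a * 2 + c) % 2 = c := fun a c h => by omega
  have e2 : ∀ a c, c < 2 → (a * 2 + c) / 2 = a := fun a c h => by omega
  have e3 : ∀ p b, b < I.L → (p * I.L + b) % I.L = b := fun p b h => by
    rw [mul_comm, Nat.mul_add_mod, Nat.mod_eq_of_lt h]
  have e4 : ∀ p b, b < I.L → (p * I.L + b) / I.L = p := fun p b h => by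
    rw [mul_comm, Nat.mul_add_div I.L_pos, Nat.div_eq_of_lt h, add_zero]
  have e5 : p * I.L + b = p' * I.L + b' ↔ p = p' ∧ b = b' := by
    constructor
    · intro h
      constructor
      · rw [← e4 p b hb, h, e4 _ _ hb']
      · rw [← e3 p b hb, h, e3 _ _ hb']
    · rintro ⟨rfl, rfl⟩; rfl
  simp only [MatSpine, mkLabel_div hp hb hc, mkLabel_div hp' hb' hc', mkLabel_mod hp hb hc,
    mkLabel_mod hp' hb' hc', e1 _ _ hc, e1 _ _ hc', e2 _ _ hc, e2 _ _ hc', e3 _ _ hb, e3 _ _ hb', e5,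
    ne_eq]

end

theorem label_lt : I.label v < I.labels :=
  mkLabel_lt (slot_lt.trans (by omega)) row_lt bit_lt val_lt

theorem renSpine_lt (l : ℕ) : I.renSpine l < I.labels := by
  have := I.lw_pos
  unfold renSpine labels
  split_ifs with h
  · have := Nat.lt_mul_div_succ l this
    rw [h] at this
    omega
  · omega

variable (I) in
/-- The label of a vertex at the `i`-th node of the spine. -/
def labelAt (v i : ℕ) : ℕ :=
  if i = I.rnd v then I.label v
  else if i = I.rnd v + 1 ∧ I.slot v = 1 then I.mkLabel 3 (I.row v) (I.bit v) (I.val v)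
  else I.mkLabel 4 0 0 0

/-- A vertex matters in its own round and, if in slot 1, in the next one, where adding `2 * lw` has
turned kind 1 into kind 3. Any other kind becomes the dead label `4 * lw`, which is fixed by further
renaming. -/
theorem renSpine_labelAt {i : ℕ} (hi : I.rnd v ≤ i) :
    I.renSpine (I.labelAt v i) = I.labelAt v (i + 1) := by
  have hd : I.mkLabel 4 0 0 0 = 4 * I.lw := by simp [mkLabel]
  unfold labelAt renSpine
  split_ifs with h1 h2 h3 h4 h5 h6 h7 h8 h9 h10 h11 <;> try omega
  all_goals try simp only [label, mkLabel_div row_lt bit_lt val_lt,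
    mkLabel_div I.r_pos I.L_pos (show 0 < 2 by omega)] at *
  all_goals first
    | omega
    | (rw [hd])
    | (rw [mkLabel, mkLabel, h2]; ring)

/-! ### The tree -/

variable (I) in
/-- The parent of a node. -/
def par (a : ℕ) : ℕ :=
  if a < I.n0 then I.n0 + a / (3 * I.L)
  else if a < I.n0 + I.n1 then I.n0 + I.n1 + (a - I.n0) / (I.N * I.N * I.N)
  else if a < I.base then I.base + (a - (I.n0 + I.n1)) / I.r
  else if a + 1 < I.nodes then a + 1 else a

variable (I) in
/-- Renaming along the edge above the node `b`. -/
def renAt (b l : ℕ) : ℕ := if b < I.base then l else I.renSpine l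

variable (I) in
/-- The matrix at the node `a`. -/
def MatAt (a i j : ℕ) : Prop :=
  if a < I.n0 then False
  else if a < I.n0 + I.n1 then ¬ I.Good (a - I.n0)
  else if a < I.base then True
  else I.MatSpine i j

instance (a i j : ℕ) : Decidable (I.MatAt a i j) := by unfold MatAt; infer_instance

theorem MatAt.symm {a i j : ℕ} (h : I.MatAt a i j) : I.MatAt a j i := by
  unfold MatAt at *
  split_ifs at * <;> first | exact h | exact MatSpine.symm h

theorem par_leaf (hv : v < I.n0) : I.par v = I.n0 + I.grp v := by
  rw [par, if_pos hv, grp]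

theorem par_group {g : ℕ} (hg : g < I.n1) :
    I.par (I.n0 + g) = I.n0 + I.n1 + g / (I.N * I.N * I.N) := by
  rw [par, if_neg (by omega), if_pos (by omega), Nat.add_sub_cancel_left]

theorem par_gadget {q : ℕ} (hq : q < I.n2) : I.par (I.n0 + I.n1 + q) = I.base + q / I.r := by
  rw [par, if_neg (by omega), if_neg (by omega), if_pos (by unfold base; omega),
    Nat.add_sub_cancel_left]

theorem par_spine {i : ℕ} : I.par (I.base + i) = if i + 1 < I.t then I.base + (i + 1)
    else I.base + i := by
  have : I.n0 + I.n1 ≤ I.base := by unfold base; omega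
  rw [par, if_neg (by omega), if_neg (by omega), if_neg (by omega)]
  unfold nodes
  split_ifs <;> omega

theorem node_cases {a : ℕ} (ha : a < I.nodes) : a < I.n0 ∨ (∃ g < I.n1, a = I.n0 + g) ∨
    (∃ q < I.n2, a = I.n0 + I.n1 + q) ∨ ∃ i < I.t, a = I.base + i := by
  unfold nodes base at *
  rcases lt_or_ge a I.n0 with h | h
  · exact Or.inl h
  rcases lt_or_ge a (I.n0 + I.n1) with h' | h'
  · exact Or.inr (Or.inl ⟨a - I.n0, by omega, by omega⟩)
  rcases lt_or_ge a (I.n0 + I.n1 + I.n2) with h'' | h''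
  · exact Or.inr (Or.inr (Or.inl ⟨a - (I.n0 + I.n1), by omega, by omega⟩))
  · exact Or.inr (Or.inr (Or.inr ⟨a - (I.n0 + I.n1 + I.n2), by omega, by omega⟩))

theorem group_parent_lt {g : ℕ} (hg : g < I.n1) : g / (I.N * I.N * I.N) < I.n2 :=
  (Nat.div_lt_iff_lt_mul I.cube_pos).2 hg

theorem gadget_parent_lt {q : ℕ} (hq : q < I.n2) : q / I.r < I.t :=
  (Nat.div_lt_iff_lt_mul I.r_pos).2 hq

theorem par_lt {a : ℕ} (ha : a < I.nodes) : I.par a < I.nodes := by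
  have ht := I.t_pos
  have hn : I.nodes = I.n0 + I.n1 + I.n2 + I.t := rfl
  have hb : I.base = I.n0 + I.n1 + I.n2 := rfl
  rcases node_cases ha with h | ⟨g, hg, rfl⟩ | ⟨q, hq, rfl⟩ | ⟨i, hi, rfl⟩
  · have := grp_lt h
    rw [par_leaf h]; omega
  · have := group_parent_lt hg
    rw [par_group hg]; omega
  · have := gadget_parent_lt hq
    rw [par_gadget hq]; omega
  · rw [par_spine]; split_ifs <;> omega

variable (I) in
/-- The parent function of the tree. -/
def parent (a : Fin I.nodes) : Fin I.nodes := ⟨I.par a, par_lt a.2⟩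

variable (I) in
/-- The root of the tree. -/
def root : Fin I.nodes := ⟨I.nodes - 1, by have := I.t_pos; unfold nodes; omega⟩

theorem root_val : (I.root : ℕ) = I.base + (I.t - 1) := by
  have := I.t_pos
  simp only [root, nodes]
  omega

theorem iterate_parent_spine {a : Fin I.nodes} (ha : I.base ≤ a) (j : ℕ) :
    ((I.parent^[j] a : Fin I.nodes) : ℕ) = min (a + j) (I.nodes - 1) := by
  have hn : I.nodes = I.base + I.t := rfl
  induction j with
  | zero => have := a.2; simp; omega
  | succ j ih =>
    rw [Function.iterate_succ_apply']
    change I.par (I.parent^[j] a : Fin I.nodes) = _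
    obtain ⟨i, hi⟩ := Nat.exists_eq_add_of_le
      (show I.base ≤ (I.parent^[j] a : Fin I.nodes) by
        rw [ih]; have := I.t_pos; omega)
    rw [hi, par_spine]
    rw [hi] at ih
    split_ifs <;> omega

theorem base_le_parent {a : Fin I.nodes} (ha : I.base ≤ a) : I.base ≤ (I.parent a : ℕ) := by
  have := iterate_parent_spine ha 1
  have hn : I.nodes = I.base + I.t := rfl
  have := I.t_pos
  simp only [Function.iterate_one] at *
  omega

theorem n0_le_par (a : ℕ) : I.n0 ≤ I.par a := by
  unfold par base
  split_ifs
  · exact Nat.le_add_right _ _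
  · exact (Nat.le_add_right _ _).trans (Nat.le_add_right _ _)
  · exact ((Nat.le_add_right _ _).trans (Nat.le_add_right _ _)).trans (Nat.le_add_right _ _)
  all_goals omega

theorem base_le_parent_three (a : Fin I.nodes) : I.base ≤ (I.parent^[3] a : Fin I.nodes) := by
  have h3 : ∀ q : Fin I.nodes, I.n0 + I.n1 ≤ q → I.base ≤ (I.parent q : ℕ) := fun q hq => by
    rcases lt_or_ge (q : ℕ) I.base with h | h
    · change I.base ≤ I.par q
      rw [par, if_neg (by omega), if_neg (by omega), if_pos h]; exact Nat.le_add_right _ _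
    · exact base_le_parent h
  have hb : I.base = I.n0 + I.n1 + I.n2 := rfl
  have h2 : ∀ q : Fin I.nodes, I.n0 ≤ q → I.n0 + I.n1 ≤ (I.parent q : ℕ) := fun q hq => by
    rcases lt_or_ge (q : ℕ) (I.n0 + I.n1) with h | h
    · change _ ≤ I.par q
      rw [par, if_neg (by omega), if_pos h]; exact Nat.le_add_right _ _
    · exact le_trans (by omega) (h3 q h)
  exact h3 _ (h2 _ (n0_le_par a))

/-- At most three steps lead from any node to the spine, and its `t` nodes end at the root. Surplus
steps do no harm because the root is its own parent. -/
theorem iterate_parent_eq_root (a : Fin I.nodes) : I.parent^[I.t + 3] a = I.root := by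
  rw [Function.iterate_add_apply]
  ext
  have h := base_le_parent_three a
  have h2 := iterate_parent_spine h I.t
  have hn : I.nodes = I.base + I.t := rfl
  rw [h2]
  simp only [root]
  omega

theorem parent_root_eq : I.parent I.root = I.root := by
  ext
  have h := iterate_parent_spine (I := I) (a := I.root) (by rw [root_val]; omega) 1
  simp only [Function.iterate_one] at h
  rw [h]
  simp [root]

/-- No node outside the vertices is a leaf, as every block is non-empty. The witness is the first
vertex of the group, first group of the gadget, or first gadget of the round. -/
theorem exists_child {a : Fin I.nodes} (ha : I.n0 ≤ a) : ∃ b, b ≠ I.root ∧ I.parent b = a := by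
  have ht := I.t_pos
  have hL := I.L_pos
  have hr := I.r_pos
  have hn : I.nodes = I.n0 + I.n1 + I.n2 + I.t := rfl
  have hb : I.base = I.n0 + I.n1 + I.n2 := rfl
  rcases node_cases a.2 with h | ⟨g, hg, h⟩ | ⟨q, hq, h⟩ | ⟨i, hi, h⟩
  · omega
  · have hlt : g * (3 * I.L) < I.n0 := Nat.mul_lt_mul_of_pos_right hg (by omega)
    refine ⟨⟨g * (3 * I.L), by omega⟩, fun h => ?_, ?_⟩
    · have := congrArg Fin.val h
      simp only [root_val] at this
      omega
    · ext
      change I.par (g * (3 * I.L)) = a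
      rw [par_leaf hlt, grp, Nat.mul_div_cancel _ (by omega), h]
  · have hlt : q * (I.N * I.N * I.N) < I.n1 := Nat.mul_lt_mul_of_pos_right hq I.cube_pos
    refine ⟨⟨I.n0 + q * (I.N * I.N * I.N), by omega⟩, fun h => ?_, ?_⟩
    · have := congrArg Fin.val h
      simp only [root_val] at this
      omega
    · ext
      change I.par (I.n0 + q * (I.N * I.N * I.N)) = a
      rw [par_group hlt, Nat.mul_div_cancel _ I.cube_pos, h]
  · have hlt : i * I.r < I.n2 := Nat.mul_lt_mul_of_pos_right hi hr
    refine ⟨⟨I.n0 + I.n1 + i * I.r, by omega⟩, fun h => ?_, ?_⟩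
    · have := congrArg Fin.val h
      simp only [root_val] at this
      omega
    · ext
      change I.par (I.n0 + I.n1 + i * I.r) = a
      rw [par_gadget hlt, Nat.mul_div_cancel _ hr, h]

theorem n0_le_nodes : I.n0 ≤ I.nodes := by unfold nodes base; omega

theorem renAt_lt {b l : ℕ} (hl : l < I.labels) : I.renAt b l < I.labels := by
  unfold renAt; split_ifs
  exacts [hl, renSpine_lt l]

variable (I) in
/-- The tree-model of the graph. -/
def tree : LabelledTree I.n0 I.labels where
  m := I.nodes
  root := I.root
  parent := I.parent
  parent_root := parent_root_eq
  reaches_root a := ⟨_, iterate_parent_eq_root a⟩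
  leaf := Fin.castLE n0_le_nodes
  leaf_injective := Fin.castLE_injective _
  mem_range_leaf a := by
    constructor
    · rintro ⟨v, rfl⟩ b _ hb
      have h1 : I.par b = v := congrArg Fin.val hb
      have h2 := n0_le_par (I := I) b
      have := v.2
      omega
    · intro h
      rcases lt_or_ge (a : ℕ) I.n0 with ha | ha
      · exact ⟨⟨a, ha⟩, rfl⟩
      · obtain ⟨b, h1, h2⟩ := exists_child ha
        exact absurd h2 (h b h1)
  mat a i j := decide (I.MatAt a i j)
  mat_symm a i j := decide_eq_decide.2 ⟨MatAt.symm, MatAt.symm⟩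
  lab v := ⟨I.label v, label_lt⟩
  ren b l := ⟨I.renAt b l, renAt_lt l.2⟩

theorem tree_depth_le : I.tree.depth ≤ I.t + 3 :=
  Finset.sup_le fun a _ => Nat.find_min' _ (iterate_parent_eq_root (I := I) a)

end LCSInstance

namespace LCSInstance

variable {I : LCSInstance}

/-! ### The tree is a tree-model of the graph -/

variable (I) in
/-- Description of the labels of `v` at its ancestors. -/
def LabelSpec (a v l : ℕ) : Prop :=
  (a = v ∧ l = I.label v) ∨ (a = I.n0 + I.grp v ∧ l = I.label v) ∨
    (a = I.n0 + I.n1 + I.gad v ∧ l = I.label v) ∨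
    ∃ i, I.rnd v ≤ i ∧ i < I.t ∧ a = I.base + i ∧ l = I.labelAt v i

/-- Pins down the ancestors of a vertex together with its labels there. A vertex keeps its initial
label up to the spine, enters the spine at the node of its round, and from then on is governed by
`labelAt`. -/
theorem label_spec {a : Fin I.tree.m} {v : Fin I.n0} {l : Fin I.labels}
    (h : I.tree.Label a v l) : I.LabelSpec a v l := by
  have hb : I.base = I.n0 + I.n1 + I.n2 := rfl
  induction h with
  | leaf v => exact Or.inl ⟨rfl, rfl⟩
  | @up b v l hb' _ ih =>
    have hv := v.2
    change I.LabelSpec (I.par b) v (I.renAt b l)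
    rcases ih with ⟨h1, h2⟩ | ⟨h1, h2⟩ | ⟨h1, h2⟩ | ⟨i, h1, h2, h3, h4⟩
    · refine Or.inr (Or.inl ⟨?_, ?_⟩)
      · rw [h1, par_leaf hv]
      · rw [renAt, if_pos (by omega), h2]
    · have := grp_lt hv
      refine Or.inr (Or.inr (Or.inl ⟨?_, ?_⟩))
      · rw [h1, par_group (grp_lt hv), gad]
      · rw [renAt, if_pos (by omega), h2]
    · have := gad_lt hv
      refine Or.inr (Or.inr (Or.inr ⟨I.rnd v, le_rfl, rnd_lt hv, ?_, ?_⟩))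
      · rw [h1, par_gadget (gad_lt hv), rnd]
      · rw [renAt, if_pos (by omega), h2, labelAt, if_pos rfl]
    · have hi : i + 1 < I.t := by
        by_contra hcon
        refine hb' (Fin.ext ?_)
        change (b : ℕ) = (I.root : ℕ)
        rw [h3, root_val]
        omega
      refine Or.inr (Or.inr (Or.inr ⟨i + 1, by omega, hi, ?_, ?_⟩))
      · rw [h3, par_spine, if_pos hi]
      · rw [renAt, if_neg (by omega), h4, renSpine_labelAt h1]

theorem below_parent {a : Fin I.nodes} {v : Fin I.n0} (h : I.tree.Below a v) :
    I.tree.Below (I.parent a) v := by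
  by_cases ha : a = I.root
  · rw [ha, parent_root_eq, ← ha]; exact h
  · obtain ⟨l, hl⟩ := h
    exact ⟨_, .up ha hl⟩

theorem below_of_eq_par {a b : Fin I.nodes} {v : Fin I.n0} (h : I.tree.Below b v)
    (hab : (a : ℕ) = I.par b) : I.tree.Below a v := by
  rw [show a = I.parent b from Fin.ext hab]
  exact below_parent h

theorem below_leaf (v : Fin I.n0) : I.tree.Below (Fin.castLE n0_le_nodes v) v := ⟨_, .leaf v⟩

theorem below_group (v : Fin I.n0) {a : Fin I.nodes} (ha : (a : ℕ) = I.n0 + I.grp v) :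
    I.tree.Below a v :=
  below_of_eq_par (below_leaf v) (ha.trans (par_leaf v.2).symm)

theorem group_lt_nodes {g : ℕ} (hg : g < I.n1) : I.n0 + g < I.nodes := by
  unfold nodes base; omega

theorem gadget_lt_nodes {q : ℕ} (hq : q < I.n2) : I.n0 + I.n1 + q < I.nodes := by
  unfold nodes base; omega

theorem spine_lt_nodes {i : ℕ} (hi : i < I.t) : I.base + i < I.nodes := by
  unfold nodes; omega

theorem below_gadget (v : Fin I.n0) {a : Fin I.nodes} (ha : (a : ℕ) = I.n0 + I.n1 + I.gad v) :
    I.tree.Below a v :=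
  below_of_eq_par (below_group v (a := ⟨_, group_lt_nodes (grp_lt v.2)⟩) rfl)
    (ha.trans (par_group (grp_lt v.2)).symm)

theorem below_spine (v : Fin I.n0) {i : ℕ} (hi : I.rnd v ≤ i) {a : Fin I.nodes}
    (ha : (a : ℕ) = I.base + i) : I.tree.Below a v := by
  induction i, hi using Nat.le_induction generalizing a with
  | base =>
    exact below_of_eq_par (below_gadget v (a := ⟨_, gadget_lt_nodes (gad_lt v.2)⟩) rfl)
      (ha.trans (par_gadget (gad_lt v.2)).symm)
  | succ i hi ih =>
    have hlt := a.2
    have hn : I.nodes = I.base + I.t := rfl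
    refine below_of_eq_par (ih (a := ⟨_, spine_lt_nodes (i := i) (by omega)⟩) rfl) ?_
    rw [ha, par_spine, if_pos (by omega)]

theorem ne_root_of_lt {a : Fin I.nodes} {i : ℕ} (ha : (a : ℕ) < I.base + i) (hi : i < I.t) :
    a ≠ I.root := fun h => by
  have := congrArg Fin.val h
  rw [root_val] at this
  omega

theorem MatAt_spine {i l l' : ℕ} : I.MatAt (I.base + i) l l' ↔ I.MatSpine l l' := by
  have hb : I.base = I.n0 + I.n1 + I.n2 := rfl
  rw [MatAt, if_neg (by omega), if_neg (by omega), if_neg (by omega)]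

/-- Here `u` enters the spine at node `i`, and `v` has entered earlier. Then `v` either has kind 3,
being in slot 1 of the preceding round, or is dead; these cases match `Link` and the absence of an
edge. -/
theorem isModel_spine_aux {u v i : ℕ} (hu : I.rnd u = i) (hv : I.rnd v < i) :
    I.Conflict u v ↔ I.MatSpine (I.label u) (I.labelAt v i) := by
  have h1 : I.gad u ≠ I.gad v := fun h => by
    have : I.rnd u = I.rnd v := by rw [rnd, rnd, h]
    omega
  have h2 : I.grp u ≠ I.grp v := fun h => h1 (by rw [gad, gad, h])
  rw [Conflict, if_neg h2, if_neg h1, if_neg (by omega),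
    if_neg (show I.rnd u + 1 ≠ I.rnd v by omega), labelAt, if_neg (show i ≠ I.rnd v by omega), hu]
  have hdead : ¬ I.MatSpine (I.label u) (I.mkLabel 4 0 0 0) := by
    rw [label, matSpine_mkLabel row_lt bit_lt val_lt I.r_pos I.L_pos (by omega)]
    omega
  split_ifs with h3 h4 h4
  · rw [label, matSpine_mkLabel row_lt bit_lt val_lt row_lt bit_lt val_lt, Link]
    have := h4.2
    constructor
    · rintro ⟨a, b, c, d, e⟩
      exact ⟨e.symm, Or.inr ⟨Or.inl ⟨b, rfl⟩, c.symm, d.symm⟩⟩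
    · rintro ⟨a, ⟨_, b, _⟩ | ⟨⟨b, _⟩ | ⟨_, b⟩, c, d⟩⟩
      · omega
      · exact ⟨this, b, c.symm, d.symm, a.symm⟩
      · omega
  · simp only [hdead, iff_false]
    rintro ⟨a, -⟩
    exact h4 ⟨h3.symm, a⟩
  · omega
  · simp only [hdead]

/-- The least common ancestor is the common group, else the common gadget, else the spine node of
the later round. The matrices at these three levels follow the cases of `Conflict`. -/
theorem isModel : I.tree.IsModelOf I.graph := by
  have hb : I.base = I.n0 + I.n1 + I.n2 := rfl
  rintro u v huv a ⟨-, -, hlca⟩ i j hi hj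
  have hu := u.2
  have hv := v.2
  have hlca : ∀ b : Fin I.nodes, b ≠ I.root → I.par b = a →
      ¬ (I.tree.Below b u ∧ I.tree.Below b v) := fun b h1 h2 => hlca b h1 (Fin.ext h2)
  have hne : (u : ℕ) ≠ v := fun h => huv (Fin.ext h)
  have gu := grp_lt hu
  have gv := grp_lt hv
  have qu := gad_lt hu
  have qv := gad_lt hv
  have ht := I.t_pos
  change (u ≠ v ∧ I.Conflict u v) ↔ decide (I.MatAt a i j) = true
  rw [decide_eq_true_iff, and_iff_right huv]
  have hi := label_spec hi
  have hj := label_spec hj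
  -- With equal groups, the group node would be a lower common ancestor than the gadget node.
  have hgroup : ∀ q : ℕ, (a : ℕ) = I.n0 + I.n1 + q → q = I.gad u → q = I.gad v →
      I.grp u ≠ I.grp v := fun q h1 h2 h3 h4 => by
    refine hlca ⟨I.n0 + I.grp u, group_lt_nodes gu⟩
      (ne_root_of_lt (i := 0) (by simp only; omega) ht) ?_ ⟨below_group u rfl, below_group v ?_⟩
    · rw [par_group gu, h1, h2, gad]
    · rw [← h4]
  -- The levels occupy disjoint ranges of nodes and distinct vertices share no leaf, so only the
  -- three diagonal cases survive: group, gadget, spine.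
  rcases hi with ⟨h1, h2⟩ | ⟨h1, h2⟩ | ⟨h1, h2⟩ | ⟨n, h1, h2, h3, h4⟩ <;>
    rcases hj with ⟨k1, k2⟩ | ⟨k1, k2⟩ | ⟨k1, k2⟩ | ⟨n', k1, k2, k3, k4⟩ <;>
    try omega
  · have : I.grp u = I.grp v := by omega
    rw [Conflict, if_pos this, MatAt, if_neg (by omega), if_pos (by omega), h1,
      Nat.add_sub_cancel_left]
  · have h : I.gad u = I.gad v := by omega
    rw [Conflict, if_neg (hgroup _ h1 rfl h), if_pos h, MatAt, if_neg (by omega), if_neg (by omega),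
      if_pos (by omega)]
  · have hn : n' = n := by omega
    subst hn
    rw [h3, MatAt_spine, h4, k4]
    have hgad : I.rnd u = n' → I.gad u ≠ I.gad v := fun h5 h6 => by
      refine hlca ⟨I.n0 + I.n1 + I.gad u, gadget_lt_nodes qu⟩
        (ne_root_of_lt (i := 0) (by simp only; omega) ht) ?_
        ⟨below_gadget u rfl, below_gadget v (by simp only [h6])⟩
      rw [par_gadget qu, h3, ← h5, rnd]
    rcases h1.eq_or_lt with h5 | h5 <;> rcases k1.eq_or_lt with k5 | k5
    · have h6 := hgad h5
      have h7 : I.grp u ≠ I.grp v := fun h => h6 (by rw [gad, gad, h])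
      rw [Conflict, if_neg h7, if_neg h6, if_pos (by omega), labelAt, if_pos h5.symm, labelAt,
        if_pos k5.symm, label, label,
        matSpine_mkLabel row_lt bit_lt val_lt row_lt bit_lt val_lt]
      have := slot_lt (I := I) (v := u)
      have := slot_lt (I := I) (v := v)
      constructor
      · rintro ⟨b, c, d, e⟩
        exact ⟨e, Or.inl ⟨b, c, d⟩⟩
      · rintro ⟨e, ⟨b, c, d⟩ | ⟨b, -⟩⟩
        · exact ⟨b, c, d, e⟩
        · omega
    · rw [isModel_spine_aux h5 k5, show I.labelAt u n' = I.label u by rw [labelAt, if_pos h5.symm]]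
    · rw [show I.Conflict u v ↔ I.Conflict v u from ⟨Conflict.symm, Conflict.symm⟩,
        isModel_spine_aux k5 h5]
      rw [show I.labelAt v n' = I.label v by rw [labelAt, if_pos k5.symm]]
      exact ⟨MatSpine.symm, MatSpine.symm⟩
    -- If both vertices entered the spine earlier, the preceding spine node is a common ancestor
    -- already.
    · refine absurd ?_ (hlca ⟨I.base + (n' - 1), spine_lt_nodes (by omega)⟩
        (ne_root_of_lt (i := n') (by simp only; omega) h2) ?_)
      · exact ⟨below_spine u (i := n' - 1) (by omega) rfl, below_spine v (i := n' - 1) (by omega) rfl⟩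
      · rw [par_spine, if_pos (by omega), h3]; omega

theorem target_le : I.n2 * (3 * I.L) ≤ I.n0 := by
  unfold n0 n1
  exact Nat.mul_le_mul_right _ (Nat.le_mul_of_pos_right _ I.cube_pos)

variable (I) in
/-- The instance of Independent Set. -/
def toIS : ISInstance where
  n := I.n0
  G := I.graph
  target := I.n2 * (3 * I.L)
  target_le := target_le
  k := I.labels
  T := I.tree
  isModel := isModel

end LCSInstance

/-! ### Entries of flattened lists; numbers determined by their bits -/

theorem List.length_flatten_ofFn {a b : ℕ} {α : Type*} (f : Fin a → List α)
    (hf : ∀ i, (f i).length = b) : (List.ofFn f).flatten.length = a * b := by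
  rw [List.length_flatten, List.map_ofFn, List.sum_ofFn]
  simp [hf]

theorem List.getD_flatten_ofFn {a b : ℕ} {α : Type*} (f : Fin a → List α)
    (hf : ∀ i, (f i).length = b) (i : Fin a) {o : ℕ} (ho : o < b) (d : α) :
    (List.ofFn f).flatten.getD (i * b + o) d = (f i).getD o d := by
  induction a with
  | zero => exact i.elim0
  | succ a ih =>
    rw [List.ofFn_succ, List.flatten_cons]
    induction i using Fin.cases with
    | zero => rw [List.getD_append _ _ _ _ (by rw [hf]; simpa using ho)]; simp
    | succ i =>
      have e : ((i.succ : Fin (a + 1)) : ℕ) * b + o = b + ((i : ℕ) * b + o) := by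
        rw [Fin.val_succ, add_mul]; omega
      rw [e, List.getD_append_right _ _ _ _ (by rw [hf]; omega), hf, Nat.add_sub_cancel_left]
      exact ih (fun i => f i.succ) (fun i => hf _) i

theorem Nat.eq_of_bits {a b L : ℕ} (ha : a < 2 ^ L) (hb : b < 2 ^ L)
    (h : ∀ i < L, a / 2 ^ i % 2 = b / 2 ^ i % 2) : a = b := by
  refine Nat.eq_of_testBit_eq fun i => ?_
  rcases lt_or_ge i L with hi | hi
  · rw [Nat.testBit_eq_decide_div_mod_eq, Nat.testBit_eq_decide_div_mod_eq, h i hi]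
  · have := Nat.pow_le_pow_right (n := 2) (by omega) hi
    rw [Nat.testBit_lt_two_pow (by omega), Nat.testBit_lt_two_pow (by omega)]

namespace LCSInstance

variable {I : LCSInstance}

theorem sym_eq (p : Fin I.r) (j : Fin I.N) : I.sym p j = I.str p j := by
  unfold sym encode
  rw [List.getD_append_right _ _ _ _ (by simp)]
  simp only [List.length_cons, List.length_nil, Nat.add_sub_cancel_left]
  rw [List.getD_flatten_ofFn _ (fun _ => List.length_ofFn) p j.2]
  simp

/-- A solution in terms of positions. -/
theorem isYes_iff : I.IsYes ↔ ∃ y : ℕ → ℕ → ℕ, (∀ p < I.r, ∀ i < I.t, y p i < I.N) ∧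
    (∀ p < I.r, ∀ i, i + 1 < I.t → y p i < y p (i + 1)) ∧
    ∀ p < I.r, ∀ i < I.t, I.sym p (y p i) = I.sym 0 (y 0 i) := by
  constructor
  · rintro ⟨w, hw, hsub⟩
    have h := fun p => List.sublist_iff_exists_fin_orderEmbedding_get_eq.1 (hsub p)
    choose f hf using h
    have hlt : ∀ p i, (f p i : ℕ) < I.N := fun p i => by
      simpa using (f p i).2
    have hs : ∀ p (hp : p < I.r) i (hi : i < w.length),
        I.sym p (f ⟨p, hp⟩ ⟨i, hi⟩) = (w.get ⟨i, hi⟩ : ℕ) := fun p hp i hi => by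
      rw [hf ⟨p, hp⟩ ⟨i, hi⟩]
      have := sym_eq ⟨p, hp⟩ ⟨_, hlt ⟨p, hp⟩ ⟨i, hi⟩⟩
      simpa using this
    -- The embeddings live on `Fin`; the default `0` outside the ranges is never looked at.
    refine ⟨fun p i => if h : p < I.r ∧ i < w.length then f ⟨p, h.1⟩ ⟨i, h.2⟩ else 0, ?_, ?_, ?_⟩
    · intro p hp i hi
      simp only [dif_pos (show p < I.r ∧ i < w.length from ⟨hp, by omega⟩)]
      exact hlt _ _
    · intro p hp i hi
      simp only [dif_pos (show p < I.r ∧ i < w.length from ⟨hp, by omega⟩),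
        dif_pos (show p < I.r ∧ i + 1 < w.length from ⟨hp, by omega⟩)]
      exact Fin.lt_def.1 ((f ⟨p, hp⟩).strictMono (Fin.mk_lt_mk.2 (Nat.lt_succ_self i)))
    · intro p hp i hi
      simp only [dif_pos (show p < I.r ∧ i < w.length from ⟨hp, by omega⟩),
        dif_pos (show 0 < I.r ∧ i < w.length from ⟨I.r_pos, by omega⟩)]
      rw [hs, hs]
  · rintro ⟨y, h1, h2, h3⟩
    refine ⟨List.ofFn fun i : Fin I.t => I.str ⟨0, I.r_pos⟩ ⟨y 0 i, h1 0 I.r_pos i i.2⟩, by simp,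
      fun p => ?_⟩
    rw [List.sublist_iff_exists_fin_orderEmbedding_get_eq]
    have hmono : ∀ i j, i < j → j < I.t → y p i < y p j := fun i j hij hj => by
      induction j, hij using Nat.le_induction with
      | base => exact h2 p p.2 i hj
      | succ j hij ih => exact (ih (by omega)).trans (h2 p p.2 j hj)
    refine ⟨OrderEmbedding.ofStrictMono (fun i => ⟨y p i, ?_⟩) ?_, ?_⟩
    · exact (h1 p p.2 i (i.2.trans_eq List.length_ofFn)).trans_eq List.length_ofFn.symm
    · intro i j hij
      exact Fin.mk_lt_mk.2 (hmono i j hij (j.2.trans_eq List.length_ofFn))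
    · intro i
      have hi : (i : ℕ) < I.t := i.2.trans_eq List.length_ofFn
      simp only [List.get_ofFn]
      have e1 := sym_eq (I := I) ⟨0, I.r_pos⟩ ⟨y 0 i, h1 0 I.r_pos i hi⟩
      have e2 := sym_eq (I := I) p ⟨y p i, h1 p p.2 i hi⟩
      ext
      rw [show (Fin.cast List.length_ofFn i : Fin I.t) = ⟨i, hi⟩ from rfl]
      exact e1.symm.trans ((h3 p p.2 i hi).symm.trans e2)

/-! ### Correctness of the reduction -/

theorem code_decode {q x y z : ℕ} (hx : x < I.N) (hy : y < I.N) (hz : z < I.N) :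
    let g := q * (I.N * I.N * I.N) + ((x * I.N + y) * I.N + z)
    g / (I.N * I.N * I.N) = q ∧ I.gx g = x ∧ I.gy g = y ∧ I.gz g = z := by
  intro g
  have hN := I.N_pos
  have key : ∀ a b, b < I.N → (a * I.N + b) / I.N = a := fun a b hb => by
    rw [mul_comm, Nat.mul_add_div hN, Nat.div_eq_of_lt hb, add_zero]
  have key' : ∀ a b, b < I.N → (a * I.N + b) % I.N = b := fun a b hb => by
    rw [mul_comm, Nat.mul_add_mod, Nat.mod_eq_of_lt hb]
  have hg : g = ((q * I.N + x) * I.N + y) * I.N + z := by simp only [g]; ring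
  refine ⟨?_, ?_, ?_, ?_⟩
  · rw [hg, ← Nat.div_div_eq_div_mul, ← Nat.div_div_eq_div_mul, key _ _ hz, key _ _ hy, key _ _ hx]
  · rw [gx, hg, ← Nat.div_div_eq_div_mul, key _ _ hz, key _ _ hy, key' _ _ hx]
  · rw [gy, hg, key _ _ hz, key' _ _ hy]
  · rw [gz, hg, key' _ _ hz]

theorem decode_vertex {g o : ℕ} (ho : o < 3 * I.L) :
    I.grp (g * (3 * I.L) + o) = g ∧ I.slot (g * (3 * I.L) + o) = o / I.L ∧
      I.bit (g * (3 * I.L) + o) = o % I.L := by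
  have hL := I.L_pos
  refine ⟨?_, ?_, ?_⟩
  · rw [grp, mul_comm, Nat.mul_add_div (by omega), Nat.div_eq_of_lt ho, add_zero]
  · rw [slot, mul_comm, Nat.mul_add_mod, Nat.mod_eq_of_lt ho]
  · rw [bit, ← mul_assoc, mul_comm, Nat.mul_add_mod]

theorem vertex_lt {g o : ℕ} (hg : g < I.n1) (ho : o < 3 * I.L) : g * (3 * I.L) + o < I.n0 := by
  have : (g + 1) * (3 * I.L) ≤ I.n0 := Nat.mul_le_mul_right _ hg
  rw [add_mul] at this
  omega

theorem toIS_isYes_iff_exists : I.toIS.IsYes ↔ ∃ S : Finset (Fin I.n0),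
    (∀ u ∈ S, ∀ v ∈ S, u ≠ v → ¬ I.Conflict u v) ∧ I.n2 * (3 * I.L) ≤ S.card := by
  constructor
  · rintro ⟨S, h1, h2⟩
    exact ⟨S, fun u hu v hv huv hcon => h1 hu hv huv ⟨huv, hcon⟩, h2⟩
  · rintro ⟨S, h1, h2⟩
    exact ⟨S, fun u hu v hv huv hcon => h1 u hu v hv huv hcon.2, h2⟩

/-- The independent set consists of all vertices of the groups that record the positions of a
solution. Linked bits are then bits of one and the same number, hence never in conflict. -/
theorem toIS_isYes_of_isYes (h : I.IsYes) : I.toIS.IsYes := by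
  obtain ⟨y, h1, h2, h3⟩ := isYes_iff.1 h
  have hr := I.r_pos
  have ht := I.t_pos
  -- The first round has no predecessor; `0` makes the condition `z ≤ y` void there.
  let z : ℕ → ℕ → ℕ := fun p i => if i = 0 then 0 else y p (i - 1) + 1
  have hzy : ∀ p < I.r, ∀ i < I.t, z p i ≤ y p i := fun p hp i hi => by
    simp only [z]
    split_ifs with h
    · exact Nat.zero_le _
    · have := h2 p hp (i - 1) (by omega)
      rwa [Nat.sub_add_cancel (by omega)] at this
  let c : ℕ → ℕ := fun q => q * (I.N * I.N * I.N) +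
    ((y 0 (q / I.r) * I.N + y (q % I.r) (q / I.r)) * I.N + z (q % I.r) (q / I.r))
  have hc : ∀ q < I.n2, c q / (I.N * I.N * I.N) = q ∧ I.gx (c q) = y 0 (q / I.r) ∧
      I.gy (c q) = y (q % I.r) (q / I.r) ∧ I.gz (c q) = z (q % I.r) (q / I.r) := fun q hq => by
    have h4 := gadget_parent_lt hq
    have h5 := Nat.mod_lt q hr
    exact code_decode (h1 _ hr _ h4) (h1 _ h5 _ h4) ((hzy _ h5 _ h4).trans_lt (h1 _ h5 _ h4))
  have hclt : ∀ q < I.n2, c q < I.n1 := fun q hq =>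
    (Nat.div_lt_iff_lt_mul I.cube_pos).1 ((hc q hq).1.trans_lt hq)
  let F : Fin I.n2 × Fin (3 * I.L) → Fin I.n0 := fun a =>
    ⟨c a.1 * (3 * I.L) + a.2, vertex_lt (hclt _ a.1.2) a.2.2⟩
  have hF : Function.Injective F := fun a b hab => by
    have hab : c a.1 * (3 * I.L) + a.2 = c b.1 * (3 * I.L) + b.2 := congrArg Fin.val hab
    have e1 : c a.1 = c b.1 := by
      rw [← (decode_vertex (g := c a.1) a.2.2).1, hab, (decode_vertex b.2.2).1]
    have e2 : (a.1 : ℕ) = b.1 := by rw [← (hc a.1 a.1.2).1, e1, (hc b.1 b.1.2).1]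
    rw [e1] at hab
    exact Prod.ext (Fin.ext e2) (Fin.ext (Nat.add_left_cancel hab))
  refine toIS_isYes_iff_exists.2 ⟨Finset.univ.image F, ?_, ?_⟩
  · intro u hu v hv huv hcon
    obtain ⟨⟨a, o⟩, -, rfl⟩ := Finset.mem_image.1 hu
    obtain ⟨⟨b, o'⟩, -, rfl⟩ := Finset.mem_image.1 hv
    have key : ∀ (a : Fin I.n2) (o : Fin (3 * I.L)), I.grp (F (a, o)) = c a := fun a o =>
      (decode_vertex o.2).1
    have keyg : ∀ (a : Fin I.n2) (o : Fin (3 * I.L)), I.gad (F (a, o)) = a := fun a o => by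
      rw [gad, key, (hc a a.2).1]
    have link : ∀ (a b : Fin I.n2) (o o' : Fin (3 * I.L)),
        I.rnd (F (a, o)) + 1 = I.rnd (F (b, o')) → ¬ I.Link (F (a, o)) (F (b, o')) := by
      rintro a b o o' h ⟨k1, k2, k3, k4, k5⟩
      apply k5
      rw [rnd, rnd, keyg, keyg] at h
      rw [row, row, keyg, keyg] at k3
      rw [val, val, k4, k1, k2, key, key, num, num, if_neg (by omega), if_pos rfl, if_neg (by omega),
        if_neg (by omega), (hc a a.2).2.2.1, (hc b b.2).2.2.2, ← h, k3]
      simp [z]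
    unfold Conflict at hcon
    split_ifs at hcon with g1 g2 g3 g4 g5
    · apply hcon
      rw [key, Good, (hc a a.2).1, (hc a a.2).2.1, (hc a a.2).2.2.1, (hc a a.2).2.2.2]
      have h4 := gadget_parent_lt a.2
      have h5 := Nat.mod_lt a hr
      exact ⟨(h3 _ h5 _ h4).symm, hzy _ h5 _ h4⟩
    · rw [keyg, keyg] at g2
      rw [key, key, g2] at g1
      exact g1 rfl
    · obtain ⟨k1, k2, k3, k4⟩ := hcon
      apply k4
      rw [rnd, rnd, keyg, keyg] at g3
      rw [val, val, k3, k1, k2, key, key, num, num, if_pos rfl, if_pos rfl, (hc a a.2).2.1,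
        (hc b b.2).2.1, g3]
    · exact link _ _ _ _ g4 hcon
    · exact link _ _ _ _ g5 hcon
  · rw [Finset.card_image_of_injective _ hF]
    simp

/-- A counting argument. Inside a gadget the set meets a single group, so it has at most `3 * L`
vertices there, and the target forces equality everywhere. Whole groups fix all bits of their three
numbers, so the absence of conflicts turns into equations between these numbers. -/
theorem isYes_of_toIS_isYes (h : I.toIS.IsYes) : I.IsYes := by
  obtain ⟨S, hS, hcard⟩ := toIS_isYes_iff_exists.1 h
  have hL := I.L_pos
  have hr := I.r_pos
  have hN := I.N_pos
  have hgrp : ∀ u ∈ S, ∀ v ∈ S, I.gad u = I.gad v → I.grp u = I.grp v := by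
    intro u hu v hv h
    by_contra hne
    refine hS u hu v hv (fun h => hne (by rw [h])) ?_
    rw [Conflict, if_neg hne, if_pos h]
    trivial
  -- The residue modulo `3 * L` is the place of a vertex in its group; it identifies the vertex once
  -- the group is known.
  have hmaps : ∀ q, Set.MapsTo (fun v : Fin I.n0 => (v : ℕ) % (3 * I.L))
      (S.filter fun v : Fin I.n0 => I.gad v = q) (Finset.range (3 * I.L)) := fun q v _ =>
    Finset.mem_coe.2 (Finset.mem_range.2 (Nat.mod_lt _ (by omega)))
  have hinj : ∀ q, Set.InjOn (fun v : Fin I.n0 => (v : ℕ) % (3 * I.L))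
      (S.filter fun v : Fin I.n0 => I.gad v = q) := by
    intro q u hu v hv huv
    obtain ⟨hu, hu'⟩ := Finset.mem_filter.1 (Finset.mem_coe.1 hu)
    obtain ⟨hv, hv'⟩ := Finset.mem_filter.1 (Finset.mem_coe.1 hv)
    have e := hgrp u hu v hv (hu'.trans hv'.symm)
    simp only at huv
    ext
    rw [← Nat.div_add_mod (u : ℕ) (3 * I.L), ← Nat.div_add_mod (v : ℕ) (3 * I.L), huv]
    unfold grp at e
    rw [e]
  have hle : ∀ q, (S.filter fun v : Fin I.n0 => I.gad v = q).card ≤ 3 * I.L := fun q => by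
    simpa using Finset.card_le_card_of_injOn _ (hmaps q) (hinj q)
  have hsum : S.card = ∑ q ∈ Finset.range I.n2, (S.filter fun v : Fin I.n0 => I.gad v = q).card :=
    Finset.card_eq_sum_card_fiberwise fun v _ => Finset.mem_coe.2 (Finset.mem_range.2 (gad_lt v.2))
  have heq : ∀ q < I.n2, (S.filter fun v : Fin I.n0 => I.gad v = q).card = 3 * I.L := by
    have : ∑ q ∈ Finset.range I.n2, (S.filter fun v : Fin I.n0 => I.gad v = q).card =
        ∑ q ∈ Finset.range I.n2, 3 * I.L := by
      refine le_antisymm (Finset.sum_le_sum fun q _ => hle q) ?_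
      rw [← hsum]
      simpa using hcard
    intro q hq
    exact (Finset.sum_eq_sum_iff_of_le fun q _ => hle q).1 this q (Finset.mem_range.2 hq)
  have hsurj : ∀ q < I.n2, ∀ o < 3 * I.L, ∃ v ∈ S, I.gad v = q ∧ (v : ℕ) % (3 * I.L) = o := by
    intro q hq o ho
    obtain ⟨v, hv, hvo⟩ := Finset.surjOn_of_injOn_of_card_le _ (hmaps q) (hinj q)
      (by rw [heq q hq]; simp) (Finset.mem_coe.2 (Finset.mem_range.2 ho))
    obtain ⟨hv, hv'⟩ := Finset.mem_filter.1 (Finset.mem_coe.1 hv)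
    exact ⟨v, hv, hv', hvo⟩
  have hg : ∀ q, ∃ g, q < I.n2 → g / (I.N * I.N * I.N) = q ∧
      ∀ o < 3 * I.L, ∃ v ∈ S, (v : ℕ) = g * (3 * I.L) + o := by
    intro q
    by_cases hq : q < I.n2
    · obtain ⟨v, hv, hvq, -⟩ := hsurj q hq 0 (by omega)
      refine ⟨I.grp v, fun _ => ⟨hvq, fun o ho => ?_⟩⟩
      obtain ⟨u, hu, huq, huo⟩ := hsurj q hq o ho
      refine ⟨u, hu, ?_⟩
      rw [hgrp v hv u hu (hvq.trans huq.symm), grp, ← huo, mul_comm, Nat.div_add_mod]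
    · exact ⟨0, fun h => absurd h hq⟩
  choose g hg using hg
  -- A bad group is a clique, so two of its vertices suffice for a contradiction; they exist as `3 *
  -- L ≥ 3`.
  have hgood : ∀ q < I.n2, I.Good (g q) := by
    intro q hq
    obtain ⟨u, hu, hu'⟩ := (hg q hq).2 0 (by omega)
    obtain ⟨v, hv, hv'⟩ := (hg q hq).2 1 (by omega)
    have := hS u hu v hv (fun h => by have := congrArg Fin.val h; omega)
    rw [Conflict, hu', hv', (decode_vertex (by omega)).1, (decode_vertex (by omega)).1,
      if_pos rfl, not_not] at this
    exact this
  -- the vertex of a chosen group for a given slot and bit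
  have hvert : ∀ q < I.n2, ∀ s < 3, ∀ b < I.L, ∃ v ∈ S, I.grp v = g q ∧ I.gad v = q ∧
      I.slot v = s ∧ I.bit v = b := by
    intro q hq s hs b hb
    have ho : s * I.L + b < 3 * I.L := by
      have : (s + 1) * I.L ≤ 3 * I.L := Nat.mul_le_mul_right _ hs
      rw [add_mul] at this
      omega
    obtain ⟨v, hv, hv'⟩ := (hg q hq).2 _ ho
    obtain ⟨h1, h2, h3⟩ := decode_vertex (I := I) (g := g q) ho
    refine ⟨v, hv, by rw [hv', h1], by rw [gad, hv', h1, (hg q hq).1], ?_, ?_⟩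
    · rw [hv', h2, mul_comm, Nat.mul_add_div hL, Nat.div_eq_of_lt hb, add_zero]
    · rw [hv', h3, mul_comm, Nat.mul_add_mod, Nat.mod_eq_of_lt hb]
  have hq : ∀ i < I.t, ∀ p < I.r, i * I.r + p < I.n2 ∧ (i * I.r + p) / I.r = i ∧
      (i * I.r + p) % I.r = p := by
    intro i hi p hp
    have : (i + 1) * I.r ≤ I.n2 := Nat.mul_le_mul_right _ hi
    rw [add_mul] at this
    refine ⟨by omega, ?_, ?_⟩
    · rw [mul_comm, Nat.mul_add_div hr, Nat.div_eq_of_lt hp, add_zero]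
    · rw [mul_comm, Nat.mul_add_mod, Nat.mod_eq_of_lt hp]
  -- The bound must cover `N` itself, because `y + 1` can be `N`.
  have hpow : I.N < 2 ^ I.L := Nat.lt_size_self _
  have hx : ∀ i < I.t, ∀ p < I.r, I.gx (g (i * I.r + p)) = I.gx (g (i * I.r + 0)) := by
    intro i hi p hp
    rcases Nat.eq_zero_or_pos p with rfl | hp0
    · rfl
    obtain ⟨a1, a2, a3⟩ := hq i hi p hp
    obtain ⟨b1, b2, b3⟩ := hq i hi 0 hr
    refine Nat.eq_of_bits (L := I.L) ((Nat.mod_lt _ hN).trans hpow) ((Nat.mod_lt _ hN).trans hpow)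
      fun b hb => ?_
    obtain ⟨u, hu, u1, u2, u3, u4⟩ := hvert _ a1 0 (by omega) b hb
    obtain ⟨v, hv, v1, v2, v3, v4⟩ := hvert _ b1 0 (by omega) b hb
    have hgad : I.gad u ≠ I.gad v := by omega
    have := hS u hu v hv (fun h => hgad (by rw [h]))
    rw [Conflict, if_neg (fun h => hgad (by rw [gad, gad, h])), if_neg hgad,
      if_pos (by rw [rnd, rnd, u2, v2, a2, b2])] at this
    by_contra hne
    refine this ⟨u3, v3, by rw [u4, v4], ?_⟩
    rwa [val, val, u1, v1, u3, v3, u4, v4, num, num, if_pos rfl, if_pos rfl]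
  have hz : ∀ i, i + 1 < I.t → ∀ p < I.r,
      I.gy (g (i * I.r + p)) + 1 = I.gz (g ((i + 1) * I.r + p)) := by
    intro i hi p hp
    obtain ⟨a1, a2, a3⟩ := hq i (by omega) p hp
    obtain ⟨b1, b2, b3⟩ := hq (i + 1) hi p hp
    refine Nat.eq_of_bits (L := I.L) (lt_of_le_of_lt (Nat.mod_lt _ hN) hpow)
      ((Nat.mod_lt _ hN).trans hpow) fun b hb => ?_
    obtain ⟨u, hu, u1, u2, u3, u4⟩ := hvert _ a1 1 (by omega) b hb
    obtain ⟨v, hv, v1, v2, v3, v4⟩ := hvert _ b1 2 (by omega) b hb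
    have hru : I.rnd u = i := by rw [rnd, u2, a2]
    have hrv : I.rnd v = i + 1 := by rw [rnd, v2, b2]
    have hgad : I.gad u ≠ I.gad v := fun h => by
      have : I.rnd u = I.rnd v := by rw [rnd, rnd, h]
      omega
    have := hS u hu v hv (fun h => hgad (by rw [h]))
    rw [Conflict, if_neg (fun h => hgad (by rw [gad, gad, h])), if_neg hgad,
      if_neg (by omega), if_pos (by omega)] at this
    by_contra hne
    refine this ⟨u3, v3, by rw [row, row, u2, v2, a3, b3], by rw [u4, v4], ?_⟩
    rwa [val, val, u1, v1, u3, v3, u4, v4, num, num, if_neg (by omega), if_pos rfl,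
      if_neg (by omega), if_neg (by omega)]
  have hgood' : ∀ i < I.t, ∀ p < I.r, I.sym 0 (I.gx (g (i * I.r + p))) =
      I.sym p (I.gy (g (i * I.r + p))) ∧ I.gz (g (i * I.r + p)) ≤ I.gy (g (i * I.r + p)) := by
    intro i hi p hp
    obtain ⟨a1, a2, a3⟩ := hq i hi p hp
    have := hgood _ a1
    rwa [Good, (hg _ a1).1, a3] at this
  refine isYes_iff.2 ⟨fun p i => I.gy (g (i * I.r + p)), fun p _ i _ => Nat.mod_lt _ hN, ?_, ?_⟩
  · intro p hp i hi
    have h1 := (hgood' (i + 1) hi p hp).2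
    have h2 := hz i hi p hp
    simp only
    omega
  · intro p hp i hi
    simp only
    -- Admissibility in string `p`, agreement of `x` over the round, and admissibility in string 0.
    rw [← (hgood' i hi p hp).1, hx i hi p hp, (hgood' i hi 0 hr).1]

theorem toIS_isYes_iff : I.toIS.IsYes ↔ I.IsYes := ⟨isYes_of_toIS_isYes, toIS_isYes_of_isYes⟩

end LCSInstance

/-! ### The input array of the Independent Set instance, entry by entry -/

theorem List.getD_append_ite {α : Type*} (l l' : List α) (d : α) (j : ℕ) :
    (l ++ l').getD j d = if j < l.length then l.getD j d else l'.getD (j - l.length) d := by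
  split_ifs with h
  · exact List.getD_append _ _ _ _ h
  · exact List.getD_append_right _ _ _ _ (by omega)

theorem List.getD_flatten_ofFn_div {a b : ℕ} {α : Type*} (f : Fin a → List α)
    (hf : ∀ i, (f i).length = b) {j : ℕ} (hj : j < a * b) (d : α) :
    ∃ h : j / b < a, (List.ofFn f).flatten.getD j d = (f ⟨j / b, h⟩).getD (j % b) d := by
  have hb : 0 < b := Nat.pos_of_ne_zero fun h => by simp [h] at hj
  have h : j / b < a := (Nat.div_lt_iff_lt_mul hb).2 hj
  refine ⟨h, ?_⟩
  have := List.getD_flatten_ofFn f hf ⟨j / b, h⟩ (Nat.mod_lt j hb) d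
  rwa [mul_comm, Nat.div_add_mod] at this

theorem List.getD_ofFn {a : ℕ} {α : Type*} (f : Fin a → α) {j : ℕ} (hj : j < a) (d : α) :
    (List.ofFn f).getD j d = f ⟨j, hj⟩ := by
  simp [List.getD_eq_getElem?_getD, hj]

namespace LCSInstance

variable (I : LCSInstance)

/-- Length of the description of a node. -/
def nodeLen : ℕ := 1 + I.labels + I.labels * I.labels

open Classical in
/-- The description of a node. -/
noncomputable def nodeEntry (a o : ℕ) : ℕ :=
  if o < 1 then I.par a
  else if o - 1 < I.labels then I.renAt a (o - 1)
  else if I.MatAt a ((o - 1 - I.labels) / I.labels) ((o - 1 - I.labels) % I.labels) then 1 else 0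

/-- The part of the input array that describes the vertices and the nodes. -/
noncomputable def modelEntry (j : ℕ) : ℕ :=
  if j < I.n0 * 2 then (if j % 2 = 0 then j / 2 else I.label (j / 2))
  else I.nodeEntry ((j - I.n0 * 2) / I.nodeLen) ((j - I.n0 * 2) % I.nodeLen)

/-- The part of the input array from the number of labels on. -/
noncomputable def tailEntry (j : ℕ) : ℕ :=
  if j < I.labels then 1
  else if j - I.labels < 3 then
    (if j - I.labels = 0 then 0 else if j - I.labels = 1 then I.nodes else I.nodes - 1)
  else I.modelEntry (j - I.labels - 3)

open Classical in
/-- The input array of the instance of Independent Set. -/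
noncomputable def entry (j : ℕ) : ℕ :=
  if j < 2 then (if j = 0 then I.n0 else I.n2 * (3 * I.L))
  else if j - 2 < I.n0 * I.n0 then
    (if (j - 2) / I.n0 ≠ (j - 2) % I.n0 ∧ I.Conflict ((j - 2) / I.n0) ((j - 2) % I.n0)
      then 1 else 0)
  else I.tailEntry (j - 2 - I.n0 * I.n0)

/-- The length of the input array of the instance of Independent Set. -/
def len : ℕ := 2 + (I.n0 * I.n0 + (I.labels + (3 + (I.n0 * 2 + I.nodes * I.nodeLen))))

/-- The description of a node, as a list. -/
noncomputable def nodeList (a : Fin I.nodes) : List ℕ :=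
  [I.par a] ++ (List.ofFn fun i : Fin I.labels => I.renAt a i) ++
    (List.ofFn fun i : Fin I.labels => List.ofFn fun j : Fin I.labels =>
      (decide (I.MatAt a i j)).toNat).flatten

theorem nodeList_length (a : Fin I.nodes) : (I.nodeList a).length = I.nodeLen := by
  unfold nodeList nodeLen
  rw [List.length_append, List.length_append,
    List.length_flatten_ofFn _ (fun _ => List.length_ofFn)]
  simp

theorem nodeList_getD (a : Fin I.nodes) {o : ℕ} (ho : o < I.nodeLen) :
    (I.nodeList a).getD o 0 = I.nodeEntry a o := by
  unfold nodeList nodeEntry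
  rw [List.append_assoc, List.getD_append_ite, List.getD_append_ite]
  simp only [List.length_cons, List.length_nil, zero_add, List.length_ofFn]
  split_ifs with h1 h2 h3
  · obtain rfl : o = 0 := by omega
    rfl
  · rw [List.getD_ofFn _ h2]
  all_goals
    have hlt : o - 1 - I.labels < I.labels * I.labels := by unfold nodeLen at ho; omega
    obtain ⟨h, e⟩ := List.getD_flatten_ofFn_div (a := I.labels) (b := I.labels)
      (fun i => List.ofFn fun j : Fin I.labels => (decide (I.MatAt a i j)).toNat)
      (fun _ => List.length_ofFn) hlt 0
    have hpos : 0 < I.labels := by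
      have := I.lw_pos
      unfold labels; omega
    rw [e, List.getD_ofFn _ (Nat.mod_lt _ hpos)]
    simp [h3]

open Classical in
-- Regrouped to the right, so that each block costs one subtraction from the index. The `0` that
-- ends the unary `k` joins the number of nodes and the root in a block of three.
theorem toIS_encode : I.toIS.encode = [I.n0, I.n2 * (3 * I.L)] ++
    ((List.ofFn fun u : Fin I.n0 => List.ofFn fun v : Fin I.n0 =>
      if I.graph.Adj u v then 1 else 0).flatten ++ (List.replicate I.labels 1 ++
      ([0, I.nodes, I.nodes - 1] ++ ((List.ofFn fun v : Fin I.n0 => [(v : ℕ), I.label v]).flatten ++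
        (List.ofFn I.nodeList).flatten)))) := by
  simp only [ISInstance.encode, List.append_assoc]
  rfl

theorem toIS_encode_length : I.toIS.encode.length = I.len := by
  rw [toIS_encode]
  simp only [List.length_append]
  rw [List.length_flatten_ofFn _ (fun _ => List.length_ofFn),
    List.length_flatten_ofFn (b := 2) _ (fun _ => rfl),
    List.length_flatten_ofFn _ I.nodeList_length]
  simp [len]

theorem model_getD {j : ℕ} (hj : j < I.n0 * 2 + I.nodes * I.nodeLen) :
    ((List.ofFn fun v : Fin I.n0 => [(v : ℕ), I.label v]).flatten ++
      (List.ofFn I.nodeList).flatten).getD j 0 = I.modelEntry j := by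
  rw [List.getD_append_ite, List.length_flatten_ofFn (b := 2) _ (fun _ => rfl), modelEntry]
  by_cases h : j < I.n0 * 2
  · rw [if_pos h, if_pos h]
    obtain ⟨h', e⟩ := List.getD_flatten_ofFn_div (b := 2)
      (fun v : Fin I.n0 => [(v : ℕ), I.label v]) (fun _ => rfl) h 0
    rw [e]
    split_ifs with h2
    · rw [h2]; rfl
    · rw [show j % 2 = 1 by omega]; rfl
  · rw [if_neg h, if_neg h]
    have h1 : j - I.n0 * 2 < I.nodes * I.nodeLen := by omega
    obtain ⟨h', e⟩ := List.getD_flatten_ofFn_div I.nodeList I.nodeList_length h1 0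
    rw [e, nodeList_getD]
    exact Nat.mod_lt _ (by unfold nodeLen; omega)

theorem tail_getD {j : ℕ} (hj : j < I.labels + (3 + (I.n0 * 2 + I.nodes * I.nodeLen))) :
    (List.replicate I.labels 1 ++ ([0, I.nodes, I.nodes - 1] ++
      ((List.ofFn fun v : Fin I.n0 => [(v : ℕ), I.label v]).flatten ++
        (List.ofFn I.nodeList).flatten))).getD j 0 = I.tailEntry j := by
  rw [List.getD_append_ite, List.length_replicate, tailEntry]
  by_cases h : j < I.labels
  · rw [if_pos h, if_pos h]
    simp [List.getD_eq_getElem?_getD, h]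
  rw [if_neg h, if_neg h, List.getD_append_ite]
  by_cases h3 : j - I.labels < 3
  · rw [if_pos (show j - I.labels < [0, I.nodes, I.nodes - 1].length from h3), if_pos h3]
    generalize j - I.labels = i at h3
    interval_cases i <;> rfl
  · rw [if_neg (show ¬ j - I.labels < [0, I.nodes, I.nodes - 1].length from h3), if_neg h3]
    exact I.model_getD (j := j - I.labels - 3) (by omega)

/-- Each entry is an arithmetic function of its index, which is what the virtual input of
`relocate_exec` requires. -/
theorem toIS_encode_getD (j : ℕ) :
    I.toIS.encode.getD j 0 = if j < I.len then I.entry j else 0 := by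
  classical
  split_ifs with hj
  swap
  · exact List.getD_eq_default _ _ (by rw [toIS_encode_length]; omega)
  rw [toIS_encode, List.getD_append_ite, entry]
  unfold len at hj
  by_cases h : j < 2
  · rw [if_pos (show j < [I.n0, I.n2 * (3 * I.L)].length from h), if_pos h]
    interval_cases j <;> rfl
  rw [if_neg (show ¬ j < [I.n0, I.n2 * (3 * I.L)].length from h), if_neg h, List.getD_append_ite,
    List.length_flatten_ofFn _ (fun _ => List.length_ofFn)]
  simp only [List.length_cons, List.length_nil, zero_add, one_add_one_eq_two]
  by_cases h2 : j - 2 < I.n0 * I.n0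
  · rw [if_pos h2, if_pos h2]
    obtain ⟨h', e⟩ := List.getD_flatten_ofFn_div (b := I.n0)
      (fun u : Fin I.n0 => List.ofFn fun v : Fin I.n0 => if I.graph.Adj u v then 1 else 0)
      (fun _ => List.length_ofFn) h2 0
    rw [e, List.getD_ofFn _ (Nat.mod_lt _ ((Nat.zero_le _).trans_lt h'))]
    congr 1
    simp [graph, Fin.ext_iff]
  · rw [if_neg h2, if_neg h2]
    exact I.tail_getD (by omega)

end LCSInstance

namespace RAM

/-! ### Building expressions -/

namespace Expr

variable {V : ℕ}

instance : Add (Expr V) := ⟨op .add⟩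
instance : Sub (Expr V) := ⟨op .sub⟩
instance : Mul (Expr V) := ⟨op .mul⟩
instance : Div (Expr V) := ⟨op .div⟩
instance : Mod (Expr V) := ⟨fun a b => a - b * (a / b)⟩
instance (n : ℕ) : OfNat (Expr V) n := ⟨const n⟩

/-- `1` if the values are equal, else `0`. -/
def eqE (a b : Expr V) : Expr V := 1 - ((a - b) + (b - a))

/-- Nonzero if the condition `c` is zero. -/
def notE (c : Expr V) : Expr V := 1 - c

/-- Nonzero if the first value is less than the second. -/
def ltE (a b : Expr V) : Expr V := b - a

/-- Nonzero if the first value is at most the second. -/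
def leE (a b : Expr V) : Expr V := ltE a (b + 1)

/-- Case distinction on whether `c` is nonzero. -/
def iteE (c a b : Expr V) : Expr V := notE (notE c) * a + notE c * b

section

variable (x : List ℕ) (ρ : Fin V → ℕ) (a b c : Expr V)

@[simp] theorem eval_add : (a + b).eval x ρ = a.eval x ρ + b.eval x ρ := rfl
@[simp] theorem eval_sub : (a - b).eval x ρ = a.eval x ρ - b.eval x ρ := rfl
@[simp] theorem eval_mul : (a * b).eval x ρ = a.eval x ρ * b.eval x ρ := rfl
@[simp] theorem eval_div : (a / b).eval x ρ = a.eval x ρ / b.eval x ρ := rfl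
@[simp] theorem eval_mod : (a % b).eval x ρ = a.eval x ρ % b.eval x ρ :=
  (Nat.mod_eq_sub_mul_div).symm
@[simp] theorem eval_one : (1 : Expr V).eval x ρ = 1 := rfl
@[simp] theorem eval_ofNat (n : ℕ) : (no_index (OfNat.ofNat n) : Expr V).eval x ρ = OfNat.ofNat n :=
  rfl
@[simp] theorem eval_var (i : Fin V) : (var i).eval x ρ = ρ i := rfl
@[simp] theorem eval_input : (input a).eval x ρ = x.getD (a.eval x ρ) 0 := rfl

theorem eval_eqE : (eqE a b).eval x ρ ≠ 0 ↔ a.eval x ρ = b.eval x ρ := by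
  simp only [eqE, eval_sub, eval_add, eval_one]; omega

theorem eval_notE : (notE c).eval x ρ ≠ 0 ↔ ¬ c.eval x ρ ≠ 0 := by
  simp only [notE, eval_sub, eval_one]; omega

theorem eval_ltE : (ltE a b).eval x ρ ≠ 0 ↔ a.eval x ρ < b.eval x ρ := by
  simp only [ltE, eval_sub]; omega

theorem eval_iteE : (iteE c a b).eval x ρ =
    if c.eval x ρ ≠ 0 then a.eval x ρ else b.eval x ρ := by
  simp only [iteE, notE, eval_sub, eval_add, eval_mul, eval_one]
  split_ifs with h
  · rw [show 1 - c.eval x ρ = 0 by omega]; simp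
  · rw [show c.eval x ρ = 0 by omega]; simp

end

/-- With nonzero meaning true, a product over a range is a bounded universal quantifier; likewise a
sum is an existential one. -/
theorem foldr_mul_ne_zero {n : ℕ} {g : ℕ → ℕ} {c : ℕ} :
    (List.range n).foldr (fun a acc => Arith.mul.eval acc (g a)) c ≠ 0 ↔
      c ≠ 0 ∧ ∀ a < n, g a ≠ 0 := by
  induction n generalizing c with
  | zero => simp
  | succ n ih =>
    rw [List.range_succ, List.foldr_append, List.foldr_cons, List.foldr_nil, ih,
      Nat.forall_lt_succ_right]
    simp only [Arith.eval, ne_eq, mul_eq_zero]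
    tauto

theorem foldr_add_ne_zero {n : ℕ} {g : ℕ → ℕ} {c : ℕ} :
    (List.range n).foldr (fun a acc => Arith.add.eval acc (g a)) c ≠ 0 ↔
      c ≠ 0 ∨ ∃ a < n, g a ≠ 0 := by
  induction n generalizing c with
  | zero => simp
  | succ n ih =>
    rw [List.range_succ, List.foldr_append, List.foldr_cons, List.foldr_nil, ih,
      Nat.exists_lt_succ_right]
    simp only [Arith.eval, ne_eq, Nat.add_eq_zero_iff]
    by_cases h1 : c = 0 <;> by_cases h2 : g n = 0 <;> simp [h1, h2]

/-- The number of passes of a fold must be a variable. A power with a computed exponent `b` is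
therefore obtained from a longer product by filling up with ones. -/
theorem foldr_mul_ite {n b d : ℕ} (hb : b ≤ n) {c : ℕ} :
    (List.range n).foldr (fun a acc => Arith.mul.eval acc (if a < b then d else 1)) c =
      c * d ^ b := by
  induction n generalizing c b with
  | zero => obtain rfl : b = 0 := by omega
            simp
  | succ n ih =>
    rw [List.range_succ, List.foldr_append, List.foldr_cons, List.foldr_nil]
    rcases Nat.lt_or_ge n b with h | h
    · obtain rfl : b = n + 1 := by omega
      have := ih (b := n) le_rfl (c := Arith.mul.eval c d)
      simp only [Arith.eval] at this ⊢
      rw [if_pos (by omega)]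
      rw [pow_succ, ← mul_assoc, mul_right_comm, ← this]
      refine List.foldr_ext _ _ _ fun a ha acc => ?_
      have := List.mem_range.1 ha
      rw [if_pos this, if_pos (by omega)]
    · have := ih h (c := c)
      simp only [Arith.eval] at this ⊢
      rw [if_neg (by omega), mul_one, this]

theorem foldr_mul_const {n d : ℕ} {c : ℕ} :
    (List.range n).foldr (fun _ acc => Arith.mul.eval acc d) c = c * d ^ n := by
  rw [← foldr_mul_ite (d := d) le_rfl]
  refine List.foldr_ext _ _ _ fun a ha acc => ?_
  rw [if_pos (List.mem_range.1 ha)]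

theorem foldr_add_size {n N : ℕ} {c : ℕ} :
    (List.range n).foldr (fun a acc => Arith.add.eval acc (if 2 ^ a < N + 1 then 1 else 0)) c =
      c + min n (Nat.size N) := by
  induction n generalizing c with
  | zero => simp
  | succ n ih =>
    rw [List.range_succ, List.foldr_append, List.foldr_cons, List.foldr_nil, ih]
    have := Nat.lt_size (m := n) (n := N)
    simp only [Arith.eval]
    split_ifs with h <;> omega

/-- The value of `e` is `n`, whatever the value of the variable `j`. -/
def Ev (x : List ℕ) (ρ : Fin V → ℕ) (j : Fin V) (e : Expr V) (n : ℕ) : Prop :=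
  ∀ a, e.eval x (Function.update ρ j a) = n

/-- The value of `e` is nonzero iff `p` holds, whatever the value of the variable `j`. -/
def EvP (x : List ℕ) (ρ : Fin V → ℕ) (j : Fin V) (e : Expr V) (p : Prop) : Prop :=
  ∀ a, e.eval x (Function.update ρ j a) ≠ 0 ↔ p

variable {x : List ℕ} {ρ : Fin V → ℕ} {j : Fin V} {a b c d : Expr V} {m n k l : ℕ} {p q r : Prop}

/-- Starts a calculus of composition rules, by which the correctness of a compound expression is a
term of the same shape as the expression. -/
theorem Ev.add (ha : Ev x ρ j a m) (hb : Ev x ρ j b n) : Ev x ρ j (a + b) (m + n) := fun i => by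
  rw [eval_add, ha, hb]

theorem Ev.sub (ha : Ev x ρ j a m) (hb : Ev x ρ j b n) : Ev x ρ j (a - b) (m - n) := fun i => by
  rw [eval_sub, ha, hb]

theorem Ev.mul (ha : Ev x ρ j a m) (hb : Ev x ρ j b n) : Ev x ρ j (a * b) (m * n) := fun i => by
  rw [eval_mul, ha, hb]

theorem Ev.div (ha : Ev x ρ j a m) (hb : Ev x ρ j b n) : Ev x ρ j (a / b) (m / n) := fun i => by
  rw [eval_div, ha, hb]

theorem Ev.mod (ha : Ev x ρ j a m) (hb : Ev x ρ j b n) : Ev x ρ j (a % b) (m % n) := fun i => by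
  rw [eval_mod, ha, hb]

theorem Ev.num (n : ℕ) : Ev x ρ j (OfNat.ofNat n : Expr V) n := fun _ => rfl

theorem Ev.input (ha : Ev x ρ j a m) : Ev x ρ j (input a) (x.getD m 0) := fun i => by
  rw [eval_input, ha]

theorem Ev.ite [Decidable p] (hc : EvP x ρ j c p) (ha : Ev x ρ j a m) (hb : Ev x ρ j b n) :
    Ev x ρ j (iteE c a b) (if p then m else n) := fun i => by
  rw [eval_iteE, ha, hb]
  exact if_congr (hc i) rfl rfl

theorem Ev.eq (ha : Ev x ρ j a m) (hb : Ev x ρ j b n) : EvP x ρ j (eqE a b) (m = n) := fun i => by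
  rw [eval_eqE, ha, hb]

theorem Ev.lt (ha : Ev x ρ j a m) (hb : Ev x ρ j b n) : EvP x ρ j (ltE a b) (m < n) := fun i => by
  rw [eval_ltE, ha, hb]

theorem Ev.le (ha : Ev x ρ j a m) (hb : Ev x ρ j b n) : EvP x ρ j (leE a b) (m ≤ n) := fun i => by
  rw [leE, eval_ltE, eval_add, eval_one, ha, hb, Nat.lt_succ_iff]

theorem EvP.not (hc : EvP x ρ j c p) : EvP x ρ j (notE c) (¬ p) := fun i => by
  rw [eval_notE, hc]

theorem EvP.and (hc : EvP x ρ j c p) (hd : EvP x ρ j d q) : EvP x ρ j (c * d) (p ∧ q) := fun i => by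
  rw [eval_mul, mul_ne_zero_iff, hc, hd]

theorem EvP.or (hc : EvP x ρ j c p) (hd : EvP x ρ j d q) : EvP x ρ j (c + d) (p ∨ q) := fun i => by
  rw [eval_add, ← hc i, ← hd i]; omega

theorem EvP.true : EvP x ρ j 1 True := fun i => by simp

theorem EvP.false : EvP x ρ j 0 False := fun i => by simp

theorem EvP.ite [Decidable p] (hc : EvP x ρ j c p) (ha : EvP x ρ j a q) (hb : EvP x ρ j b r) :
    EvP x ρ j (iteE c a b) (if p then q else r) := fun i => by
  rw [eval_iteE]
  have := hc i
  split_ifs with h1 h2 h2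
  · exact ha i
  · exact absurd (this.1 h1) h2
  · exact absurd (this.2 h2) h1
  · exact hb i

/-- The power `d ^ b`, where `b` is at most the variable `n`; the variable `j` is used. -/
def powE (n j : Fin V) (d b : Expr V) : Expr V := fold .mul 1 n j (iteE (ltE (var j) b) d 1)

/-- The fold in `powE` overwrites `j`, which is harmless because the values of both arguments do not
depend on `j`; this is why `Ev` quantifies over it. -/
theorem Ev.pow {i : Fin V} (hij : i ≠ j) (ha : Ev x ρ j a m) (hb : Ev x ρ j b n) (hn : n ≤ ρ i) :
    Ev x ρ j (powE i j a b) (m ^ n) := fun i => by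
  simp only [powE, eval, Function.update_of_ne hij, Function.update_idem]
  rw [← one_mul (m ^ n), ← foldr_mul_ite hn]
  refine List.foldr_ext _ _ _ fun a _ acc => ?_
  rw [eval_iteE, ha]
  congr 1
  refine if_congr ?_ rfl (eval_one _ _)
  rw [eval_ltE, hb, eval_var, Function.update_self]

end Expr

end RAM

namespace LCSInstance

open RAM RAM.Expr

/-! ### Expressions for the reduction

The variables `0`, `1`, `2`, `3` hold `N`, `t`, `r` and the number of bits, the variable `11` is
used for the computation of powers. -/

def vN : Expr 12 := .var 0
def vt : Expr 12 := .var 1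
def vr : Expr 12 := .var 2
def vL : Expr 12 := .var 3

/-- The variables hold the parameters of the instance. -/
structure IsEnv (I : LCSInstance) (ρ : Fin 12 → ℕ) : Prop where
  N : ρ 0 = I.N
  t : ρ 1 = I.t
  r : ρ 2 = I.r
  L : ρ 3 = I.L

variable {I : LCSInstance} {ρ : Fin 12 → ℕ} {e u v a b c d : Expr 12}
  {n m k l o : ℕ}

/-- The value of `e` is `n`, whatever the value of the variable `11`. -/
abbrev Eq11 (I : LCSInstance) (ρ : Fin 12 → ℕ) (e : Expr 12) (n : ℕ) : Prop := Ev I.encode ρ 11 e n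

/-- The value of `e` is nonzero iff `p` holds, whatever the value of the variable `11`. -/
abbrev Iff11 (I : LCSInstance) (ρ : Fin 12 → ℕ) (e : Expr 12) (p : Prop) : Prop :=
  EvP I.encode ρ 11 e p

def cubeE : Expr 12 := vN * vN * vN
def n2E : Expr 12 := vt * vr
def n1E : Expr 12 := n2E * cubeE
def n0E : Expr 12 := n1E * (3 * vL)
def baseE : Expr 12 := n0E + n1E + n2E
def nodesE : Expr 12 := baseE + vt
def lwE : Expr 12 := 2 * (vr * vL)
def labelsE : Expr 12 := 5 * lwE
def nodeLenE : Expr 12 := 1 + labelsE + labelsE * labelsE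
def lenE : Expr 12 := 2 + (n0E * n0E + (labelsE + (3 + (n0E * 2 + nodesE * nodeLenE))))

theorem ev_N (h : IsEnv I ρ) : Eq11 I ρ vN I.N := fun _ => h.N
theorem ev_t (h : IsEnv I ρ) : Eq11 I ρ vt I.t := fun _ => h.t
theorem ev_r (h : IsEnv I ρ) : Eq11 I ρ vr I.r := fun _ => h.r
theorem ev_L (h : IsEnv I ρ) : Eq11 I ρ vL I.L := fun _ => h.L

theorem ev_cube (h : IsEnv I ρ) : Eq11 I ρ cubeE (I.N * I.N * I.N) :=
  ((ev_N h).mul (ev_N h)).mul (ev_N h)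

theorem ev_n2 (h : IsEnv I ρ) : Eq11 I ρ n2E I.n2 := (ev_t h).mul (ev_r h)

theorem ev_n1 (h : IsEnv I ρ) : Eq11 I ρ n1E I.n1 := (ev_n2 h).mul (ev_cube h)

theorem ev_3L (h : IsEnv I ρ) : Eq11 I ρ (3 * vL) (3 * I.L) := (Ev.num 3).mul (ev_L h)

theorem ev_n0 (h : IsEnv I ρ) : Eq11 I ρ n0E I.n0 := (ev_n1 h).mul (ev_3L h)

theorem ev_base (h : IsEnv I ρ) : Eq11 I ρ baseE I.base := ((ev_n0 h).add (ev_n1 h)).add (ev_n2 h)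

theorem ev_nodes (h : IsEnv I ρ) : Eq11 I ρ nodesE I.nodes := (ev_base h).add (ev_t h)

theorem ev_lw (h : IsEnv I ρ) : Eq11 I ρ lwE I.lw := (Ev.num 2).mul ((ev_r h).mul (ev_L h))

theorem ev_labels (h : IsEnv I ρ) : Eq11 I ρ labelsE I.labels := (Ev.num 5).mul (ev_lw h)

theorem ev_nodeLen (h : IsEnv I ρ) : Eq11 I ρ nodeLenE I.nodeLen :=
  ((Ev.num 1).add (ev_labels h)).add ((ev_labels h).mul (ev_labels h))

theorem ev_len (h : IsEnv I ρ) : Eq11 I ρ lenE I.len :=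
  (Ev.num 2).add (((ev_n0 h).mul (ev_n0 h)).add ((ev_labels h).add ((Ev.num 3).add
    (((ev_n0 h).mul (Ev.num 2)).add ((ev_nodes h).mul (ev_nodeLen h))))))

def symE (p j : Expr 12) : Expr 12 := .input (4 + (p * vN + j))

theorem ev_sym (h : IsEnv I ρ) (ha : Eq11 I ρ a n) (hb : Eq11 I ρ b m) :
    Eq11 I ρ (symE a b) (I.sym n m) :=
  ((Ev.num 4).add ((ha.mul (ev_N h)).add hb)).input

def grpE (v : Expr 12) : Expr 12 := v / (3 * vL)
def gadE (v : Expr 12) : Expr 12 := grpE v / cubeE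
def rndE (v : Expr 12) : Expr 12 := gadE v / vr
def rowE (v : Expr 12) : Expr 12 := gadE v % vr
def slotE (v : Expr 12) : Expr 12 := v % (3 * vL) / vL
def bitE (v : Expr 12) : Expr 12 := v % vL
def gxE (g : Expr 12) : Expr 12 := g / (vN * vN) % vN
def gyE (g : Expr 12) : Expr 12 := g / vN % vN
def gzE (g : Expr 12) : Expr 12 := g % vN
def numE (g s : Expr 12) : Expr 12 :=
  iteE (eqE s 0) (gxE g) (iteE (eqE s 1) (gyE g + 1) (gzE g))
def valE (v : Expr 12) : Expr 12 := numE (grpE v) (slotE v) / powE 3 11 2 (bitE v) % 2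

theorem ev_grp (h : IsEnv I ρ) (hv : Eq11 I ρ v n) : Eq11 I ρ (grpE v) (I.grp n) := hv.div (ev_3L h)

theorem ev_gad (h : IsEnv I ρ) (hv : Eq11 I ρ v n) : Eq11 I ρ (gadE v) (I.gad n) :=
  (ev_grp h hv).div (ev_cube h)

theorem ev_rnd (h : IsEnv I ρ) (hv : Eq11 I ρ v n) : Eq11 I ρ (rndE v) (I.rnd n) :=
  (ev_gad h hv).div (ev_r h)

theorem ev_row (h : IsEnv I ρ) (hv : Eq11 I ρ v n) : Eq11 I ρ (rowE v) (I.row n) :=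
  (ev_gad h hv).mod (ev_r h)

theorem ev_slot (h : IsEnv I ρ) (hv : Eq11 I ρ v n) : Eq11 I ρ (slotE v) (I.slot n) :=
  (hv.mod (ev_3L h)).div (ev_L h)

theorem ev_bit (h : IsEnv I ρ) (hv : Eq11 I ρ v n) : Eq11 I ρ (bitE v) (I.bit n) := hv.mod (ev_L h)

theorem ev_gx (h : IsEnv I ρ) (hv : Eq11 I ρ v n) : Eq11 I ρ (gxE v) (I.gx n) :=
  (hv.div ((ev_N h).mul (ev_N h))).mod (ev_N h)

theorem ev_gy (h : IsEnv I ρ) (hv : Eq11 I ρ v n) : Eq11 I ρ (gyE v) (I.gy n) :=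
  (hv.div (ev_N h)).mod (ev_N h)

theorem ev_gz (h : IsEnv I ρ) (hv : Eq11 I ρ v n) : Eq11 I ρ (gzE v) (I.gz n) := hv.mod (ev_N h)

theorem ev_num (h : IsEnv I ρ) (ha : Eq11 I ρ a n) (hb : Eq11 I ρ b m) :
    Eq11 I ρ (numE a b) (I.num n m) :=
  Ev.ite (hb.eq (Ev.num 0)) (ev_gx h ha) (Ev.ite (hb.eq (Ev.num 1)) ((ev_gy h ha).add (Ev.num 1))
    (ev_gz h ha))

theorem ev_val (h : IsEnv I ρ) (hv : Eq11 I ρ v n) : Eq11 I ρ (valE v) (I.val n) :=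
  ((ev_num h (ev_grp h hv) (ev_slot h hv)).div (Ev.pow (by decide) (Ev.num 2) (ev_bit h hv)
    (h.L ▸ bit_lt.le))).mod (Ev.num 2)

def goodE (g : Expr 12) : Expr 12 :=
  eqE (symE 0 (gxE g)) (symE (g / cubeE % vr) (gyE g)) * leE (gzE g) (gyE g)

theorem ev_good (h : IsEnv I ρ) (hv : Eq11 I ρ v n) : Iff11 I ρ (goodE v) (I.Good n) :=
  (Ev.eq (ev_sym h (Ev.num 0) (ev_gx h hv))
    (ev_sym h ((hv.div (ev_cube h)).mod (ev_r h)) (ev_gy h hv))).and ((ev_gz h hv).le (ev_gy h hv))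

def linkE (u v : Expr 12) : Expr 12 :=
  eqE (slotE u) 1 * (eqE (slotE v) 2 * (eqE (rowE u) (rowE v) * (eqE (bitE u) (bitE v) *
    notE (eqE (valE u) (valE v)))))

theorem ev_link (h : IsEnv I ρ) (hu : Eq11 I ρ u n) (hv : Eq11 I ρ v m) :
    Iff11 I ρ (linkE u v) (I.Link n m) :=
  ((ev_slot h hu).eq (Ev.num 1)).and (((ev_slot h hv).eq (Ev.num 2)).and
    (((ev_row h hu).eq (ev_row h hv)).and (((ev_bit h hu).eq (ev_bit h hv)).and
      ((ev_val h hu).eq (ev_val h hv)).not)))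

def conflictE (u v : Expr 12) : Expr 12 :=
  iteE (eqE (grpE u) (grpE v)) (notE (goodE (grpE u))) <|
  iteE (eqE (gadE u) (gadE v)) 1 <|
  iteE (eqE (rndE u) (rndE v)) (eqE (slotE u) 0 * (eqE (slotE v) 0 * (eqE (bitE u) (bitE v) *
    notE (eqE (valE u) (valE v))))) <|
  iteE (eqE (rndE u + 1) (rndE v)) (linkE u v) <|
  iteE (eqE (rndE v + 1) (rndE u)) (linkE v u) 0

theorem ev_conflict (h : IsEnv I ρ) (hu : Eq11 I ρ u n) (hv : Eq11 I ρ v m) :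
    Iff11 I ρ (conflictE u v) (I.Conflict n m) :=
  EvP.ite ((ev_grp h hu).eq (ev_grp h hv)) (ev_good h (ev_grp h hu)).not <|
  EvP.ite ((ev_gad h hu).eq (ev_gad h hv)) EvP.true <|
  EvP.ite ((ev_rnd h hu).eq (ev_rnd h hv))
    (((ev_slot h hu).eq (Ev.num 0)).and (((ev_slot h hv).eq (Ev.num 0)).and
      (((ev_bit h hu).eq (ev_bit h hv)).and ((ev_val h hu).eq (ev_val h hv)).not))) <|
  EvP.ite (((ev_rnd h hu).add (Ev.num 1)).eq (ev_rnd h hv)) (ev_link h hu hv) <|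
  EvP.ite (((ev_rnd h hv).add (Ev.num 1)).eq (ev_rnd h hu)) (ev_link h hv hu) EvP.false

def labelE (v : Expr 12) : Expr 12 := slotE v * lwE + ((rowE v * vL + bitE v) * 2 + valE v)

theorem ev_label (h : IsEnv I ρ) (hv : Eq11 I ρ v n) : Eq11 I ρ (labelE v) (I.label n) :=
  ((ev_slot h hv).mul (ev_lw h)).add (((((ev_row h hv).mul (ev_L h)).add (ev_bit h hv)).mul
    (Ev.num 2)).add (ev_val h hv))

def renE (a l : Expr 12) : Expr 12 :=
  iteE (ltE a baseE) l (iteE (eqE (l / lwE) 1) (l + 2 * lwE) (4 * lwE))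

theorem ev_ren (h : IsEnv I ρ) (ha : Eq11 I ρ a n) (hb : Eq11 I ρ b m) :
    Eq11 I ρ (renE a b) (I.renAt n m) :=
  Ev.ite (ha.lt (ev_base h)) hb (Ev.ite ((hb.div (ev_lw h)).eq (Ev.num 1))
    (hb.add ((Ev.num 2).mul (ev_lw h))) ((Ev.num 4).mul (ev_lw h)))

def matSpineE (i j : Expr 12) : Expr 12 :=
  notE (eqE (i % lwE % 2) (j % lwE % 2)) *
    (eqE (i / lwE) 0 * (eqE (j / lwE) 0 * eqE (i % lwE / 2 % vL) (j % lwE / 2 % vL)) +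
      (eqE (i / lwE) 2 * eqE (j / lwE) 3 + eqE (i / lwE) 3 * eqE (j / lwE) 2) *
        eqE (i % lwE / 2) (j % lwE / 2))

theorem ev_matSpine (h : IsEnv I ρ) (ha : Eq11 I ρ a n) (hb : Eq11 I ρ b m) :
    Iff11 I ρ (matSpineE a b) (I.MatSpine n m) :=
  have hd := fun {a n} (ha : Eq11 I ρ a n) (k : ℕ) => (ha.div (ev_lw h)).eq (Ev.num k)
  have hm := fun {a n} (ha : Eq11 I ρ a n) => ha.mod (ev_lw h)
  (((hm ha).mod (Ev.num 2)).eq ((hm hb).mod (Ev.num 2))).not.and <|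
    ((hd ha 0).and ((hd hb 0).and ((((hm ha).div (Ev.num 2)).mod (ev_L h)).eq
      (((hm hb).div (Ev.num 2)).mod (ev_L h))))).or <|
    (((hd ha 2).and (hd hb 3)).or ((hd ha 3).and (hd hb 2))).and <|
      ((hm ha).div (Ev.num 2)).eq ((hm hb).div (Ev.num 2))

def matE (a i j : Expr 12) : Expr 12 :=
  iteE (ltE a n0E) 0 <| iteE (ltE a (n0E + n1E)) (notE (goodE (a - n0E))) <|
  iteE (ltE a baseE) 1 (matSpineE i j)

theorem ev_mat (h : IsEnv I ρ) (ha : Eq11 I ρ a n) (hb : Eq11 I ρ b m) (hc : Eq11 I ρ c k) :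
    Iff11 I ρ (matE a b c) (I.MatAt n m k) :=
  EvP.ite (ha.lt (ev_n0 h)) EvP.false <|
  EvP.ite (ha.lt ((ev_n0 h).add (ev_n1 h))) (ev_good h (ha.sub (ev_n0 h))).not <|
  EvP.ite (ha.lt (ev_base h)) EvP.true (ev_matSpine h hb hc)

def parE (a : Expr 12) : Expr 12 :=
  iteE (ltE a n0E) (n0E + a / (3 * vL)) <|
  iteE (ltE a (n0E + n1E)) (n0E + n1E + (a - n0E) / cubeE) <|
  iteE (ltE a baseE) (baseE + (a - (n0E + n1E)) / vr) <|
  iteE (ltE (a + 1) nodesE) (a + 1) a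

theorem ev_par (h : IsEnv I ρ) (ha : Eq11 I ρ a n) : Eq11 I ρ (parE a) (I.par n) :=
  have h01 := (ev_n0 h).add (ev_n1 h)
  Ev.ite (ha.lt (ev_n0 h)) ((ev_n0 h).add (ha.div (ev_3L h))) <|
  Ev.ite (ha.lt h01) (h01.add ((ha.sub (ev_n0 h)).div (ev_cube h))) <|
  Ev.ite (ha.lt (ev_base h)) ((ev_base h).add ((ha.sub h01).div (ev_r h))) <|
  Ev.ite ((ha.add (Ev.num 1)).lt (ev_nodes h)) (ha.add (Ev.num 1)) ha

def nodeEntryE (a o : Expr 12) : Expr 12 :=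
  iteE (ltE o 1) (parE a) <| iteE (ltE (o - 1) labelsE) (renE a (o - 1)) <|
  iteE (matE a ((o - 1 - labelsE) / labelsE) ((o - 1 - labelsE) % labelsE)) 1 0

theorem ev_nodeEntry (h : IsEnv I ρ) (ha : Eq11 I ρ a n) (hb : Eq11 I ρ b m) :
    Eq11 I ρ (nodeEntryE a b) (I.nodeEntry n m) :=
  have h1 := hb.sub (Ev.num 1)
  have h2 := h1.sub (ev_labels h)
  Ev.ite (hb.lt (Ev.num 1)) (ev_par h ha) <| Ev.ite (h1.lt (ev_labels h)) (ev_ren h ha h1) <|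
  Ev.ite (ev_mat h ha (h2.div (ev_labels h)) (h2.mod (ev_labels h))) (Ev.num 1) (Ev.num 0)

def modelEntryE (j : Expr 12) : Expr 12 :=
  iteE (ltE j (n0E * 2)) (iteE (eqE (j % 2) 0) (j / 2) (labelE (j / 2))) <|
  nodeEntryE ((j - n0E * 2) / nodeLenE) ((j - n0E * 2) % nodeLenE)

theorem ev_modelEntry (h : IsEnv I ρ) (ha : Eq11 I ρ a n) :
    Eq11 I ρ (modelEntryE a) (I.modelEntry n) :=
  have h1 := (ev_n0 h).mul (Ev.num 2)
  have h2 := ha.sub h1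
  Ev.ite (ha.lt h1) (Ev.ite ((ha.mod (Ev.num 2)).eq (Ev.num 0)) (ha.div (Ev.num 2))
    (ev_label h (ha.div (Ev.num 2)))) <|
  ev_nodeEntry h (h2.div (ev_nodeLen h)) (h2.mod (ev_nodeLen h))

def tailEntryE (j : Expr 12) : Expr 12 :=
  iteE (ltE j labelsE) 1 <| iteE (ltE (j - labelsE) 3)
    (iteE (eqE (j - labelsE) 0) 0 (iteE (eqE (j - labelsE) 1) nodesE (nodesE - 1))) <|
  modelEntryE (j - labelsE - 3)

theorem ev_tailEntry (h : IsEnv I ρ) (ha : Eq11 I ρ a n) :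
    Eq11 I ρ (tailEntryE a) (I.tailEntry n) :=
  have h1 := ha.sub (ev_labels h)
  Ev.ite (ha.lt (ev_labels h)) (Ev.num 1) <| Ev.ite (h1.lt (Ev.num 3))
    (Ev.ite (h1.eq (Ev.num 0)) (Ev.num 0) (Ev.ite (h1.eq (Ev.num 1)) (ev_nodes h)
      ((ev_nodes h).sub (Ev.num 1)))) <|
  ev_modelEntry h (h1.sub (Ev.num 3))

def entryE (j : Expr 12) : Expr 12 :=
  iteE (ltE j 2) (iteE (eqE j 0) n0E (n2E * (3 * vL))) <|
  iteE (ltE (j - 2) (n0E * n0E)) (iteE (notE (eqE ((j - 2) / n0E) ((j - 2) % n0E)) *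
    conflictE ((j - 2) / n0E) ((j - 2) % n0E)) 1 0) <|
  tailEntryE (j - 2 - n0E * n0E)

theorem ev_entry (h : IsEnv I ρ) (ha : Eq11 I ρ a n) : Eq11 I ρ (entryE a) (I.entry n) := by
  classical
  exact
  have h1 := ha.sub (Ev.num 2)
  have h2 := (ev_n0 h).mul (ev_n0 h)
  have hu := h1.div (ev_n0 h)
  have hv := h1.mod (ev_n0 h)
  Ev.ite (ha.lt (Ev.num 2)) (Ev.ite (ha.eq (Ev.num 0)) (ev_n0 h) ((ev_n2 h).mul (ev_3L h))) <|
  Ev.ite (h1.lt h2) (Ev.ite ((hu.eq hv).not.and (ev_conflict h hu hv)) (Ev.num 1) (Ev.num 0)) <|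
  ev_tailEntry h (h1.sub h2)

theorem Ev.eval_eq {x : List ℕ} {j : Fin 12} (h : Ev x ρ j e n) : e.eval x ρ = n := by
  rw [← h (ρ j), Function.update_eq_self]

theorem eval_lenE (h : IsEnv I ρ) : lenE.eval I.encode ρ = I.len := Ev.eval_eq (ev_len h)

theorem eval_entryE (h : IsEnv I ρ) :
    (entryE (.var 4)).eval I.encode ρ = I.entry (ρ 4) := Ev.eval_eq (ev_entry h fun _ => rfl)

/-- The number of bits. -/
def sizeE : Expr 12 := .fold .add 0 0 11 (iteE (ltE (powE 0 10 2 (.var 11)) (vN + 1)) 1 0)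

/-- The size of `N` is the number of `a` with `2 ^ a ≤ N`, and all of these are below `N`. As
variable 3 is not yet set, `N` itself bounds the loops; powers use variable 10, since 11 is the
outer index. -/
theorem eval_sizeE (x : List ℕ) : sizeE.eval x ρ = Nat.size (ρ 0) := by
  have h2 : Nat.size (ρ 0) ≤ ρ 0 := size_le_self _
  rw [sizeE, eval, ← min_eq_right h2, ← zero_add (min _ _), ← foldr_add_size]
  refine List.foldr_ext _ _ _ fun a ha acc => ?_
  congr 1
  have h1 : Ev x (Function.update ρ 11 a) 10 (powE 0 10 2 (.var 11)) (2 ^ a) :=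
    Ev.pow (by decide) (Ev.num 2) (fun _ => by simp) (by simpa using (List.mem_range.1 ha).le)
  have h3 : Ev x (Function.update ρ 11 a) 10 (vN + 1) (ρ 0 + 1) := fun _ => by simp [vN]
  exact Ev.eval_eq (Ev.ite (h1.lt h3) (Ev.num 1) (Ev.num 0))

/-! ### Exhaustive search -/

/-- The number of candidate sequences of positions. -/
def countE : Expr 12 := .fold .mul 1 1 11 vN

theorem eval_countE (x : List ℕ) : countE.eval x ρ = ρ 0 ^ ρ 1 := by
  simp only [countE, eval, vN, Function.update_of_ne (show (0 : Fin 12) ≠ 11 by decide)]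
  rw [foldr_mul_const, one_mul]

/-- The power of `N` with the exponent in the variable `10`. -/
def placeE : Expr 12 := .fold .mul 1 10 11 vN

theorem eval_placeE (x : List ℕ) : placeE.eval x ρ = ρ 0 ^ ρ 10 := by
  simp only [placeE, eval, vN, Function.update_of_ne (show (0 : Fin 12) ≠ 11 by decide)]
  rw [foldr_mul_const, one_mul]

/-- A condition that is nonzero if the instance is a yes-instance, when the variable `6` holds
`N ^ t`. -/
def searchE : Expr 12 :=
  .fold .add 0 6 7 <| .fold .mul 1 2 8 <| .fold .add 0 6 9 <| .fold .mul 1 1 10 <|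
    eqE (symE (.var 8) (.var 9 / placeE % vN)) (symE 0 (.var 7 / placeE % vN)) *
      (ltE vt (.var 10 + 2) + ltE (.var 9 / placeE % vN) (.var 9 / (placeE * vN) % vN))

/-- Base `N` digits code a sequence of positions by one number, so that one bounded quantifier
ranges over all sequences. -/
theorem exists_digits {N t : ℕ} {y : ℕ → ℕ} (hy : ∀ i < t, y i < N) :
    ∃ a < N ^ t, ∀ i < t, a / N ^ i % N = y i := by
  induction t generalizing y with
  | zero => exact ⟨0, by simp, by simp⟩
  | succ t ih =>
    obtain ⟨a, ha, hd⟩ := ih (y := fun i => y (i + 1)) fun i hi => hy _ (by omega)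
    have h0 := hy 0 (by omega)
    have hN : 0 < N := by omega
    refine ⟨a * N + y 0, ?_, fun i hi => ?_⟩
    · have : (a + 1) * N ≤ N ^ t * N := Nat.mul_le_mul_right _ ha
      rw [pow_succ]
      rw [add_mul] at this
      omega
    · cases i with
      | zero => rw [pow_zero, Nat.div_one, mul_comm, Nat.mul_add_mod, Nat.mod_eq_of_lt h0]
      | succ i =>
        rw [pow_succ', ← Nat.div_div_eq_div_mul, mul_comm a, Nat.mul_add_div hN,
          Nat.div_eq_of_lt h0, add_zero]
        exact hd i (by omega)

/-- The number `a` only names the letters and need not be increasing; the positions in string 0 come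
from the `q` for `p = 0`. The alternative `t < i + 2` exempts the last position, which has no
successor. -/
theorem isYes_iff_search : I.IsYes ↔ ∃ a < I.N ^ I.t, ∀ p < I.r, ∃ q < I.N ^ I.t, ∀ i < I.t,
    I.sym p (q / I.N ^ i % I.N) = I.sym 0 (a / I.N ^ i % I.N) ∧
      (I.t < i + 2 ∨ q / I.N ^ i % I.N < q / (I.N ^ i * I.N) % I.N) := by
  rw [isYes_iff]
  constructor
  · rintro ⟨y, h1, h2, h3⟩
    obtain ⟨a, ha, had⟩ := exists_digits (h1 0 I.r_pos)
    refine ⟨a, ha, fun p hp => ?_⟩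
    obtain ⟨q, hq, hqd⟩ := exists_digits (h1 p hp)
    refine ⟨q, hq, fun i hi => ⟨?_, ?_⟩⟩
    · rw [hqd i hi, had i hi, h3 p hp i hi]
    · rcases Nat.lt_or_ge I.t (i + 2) with h | h
      · exact Or.inl h
      · rw [← pow_succ, hqd i hi, hqd (i + 1) (by omega)]
        exact Or.inr (h2 p hp i (by omega))
  · rintro ⟨a, ha, hs⟩
    have hs' : ∀ p, ∃ q, p < I.r → ∀ i < I.t,
        I.sym p (q / I.N ^ i % I.N) = I.sym 0 (a / I.N ^ i % I.N) ∧
        (I.t < i + 2 ∨ q / I.N ^ i % I.N < q / (I.N ^ i * I.N) % I.N) := fun p => by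
      by_cases hp : p < I.r
      · obtain ⟨q, -, hq⟩ := hs p hp
        exact ⟨q, fun _ => hq⟩
      · exact ⟨0, fun h => absurd h hp⟩
    choose q hq using hs'
    refine ⟨fun p i => q p / I.N ^ i % I.N, fun p _ i _ => Nat.mod_lt _ I.N_pos, ?_, ?_⟩
    · intro p hp i hi
      have := ((hq p hp) i (by omega)).2
      rw [← pow_succ] at this
      exact this.resolve_left (by omega)
    · intro p hp i hi
      exact ((hq p hp) i hi).1.trans ((hq 0 I.r_pos) i hi).1.symm

theorem eval_fold_add {x : List ℕ} {n j : Fin 12} :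
    (fold .add 0 n j e).eval x ρ ≠ 0 ↔ ∃ a < ρ n, e.eval x (Function.update ρ j a) ≠ 0 := by
  rw [eval, foldr_add_ne_zero]; simp

theorem eval_fold_mul {x : List ℕ} {n j : Fin 12} :
    (fold .mul 1 n j e).eval x ρ ≠ 0 ↔ ∀ a < ρ n, e.eval x (Function.update ρ j a) ≠ 0 := by
  rw [eval, foldr_mul_ne_zero]; simp

theorem eval_searchE (h : IsEnv I ρ) (h6 : ρ 6 = I.N ^ I.t) :
    searchE.eval I.encode ρ ≠ 0 ↔ I.IsYes := by
  rw [isYes_iff_search, searchE, eval_fold_add, h6]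
  refine exists_congr fun a => and_congr_right fun _ => ?_
  rw [eval_fold_mul, Function.update_of_ne (by decide), h.r]
  refine forall₂_congr fun p _ => ?_
  rw [eval_fold_add, Function.update_of_ne (by decide), Function.update_of_ne (by decide), h6]
  refine exists_congr fun q => and_congr_right fun _ => ?_
  rw [eval_fold_mul, Function.update_of_ne (by decide), Function.update_of_ne (by decide),
    Function.update_of_ne (by decide), h.t]
  refine forall₂_congr fun i _ => ?_
  generalize hρ : Function.update (Function.update (Function.update (Function.update ρ 7 a) 8 p) 9 q)
    10 i = ρ'
  have e0 : ρ' 0 = I.N := by rw [← h.N, ← hρ]; simp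
  have e1 : ρ' 1 = I.t := by rw [← h.t, ← hρ]; simp
  have e7 : ρ' 7 = a := by rw [← hρ]; simp
  have e8 : ρ' 8 = p := by rw [← hρ]; simp
  have e9 : ρ' 9 = q := by rw [← hρ]; simp
  have e10 : ρ' 10 = i := by rw [← hρ]; simp
  rw [eval_mul, mul_ne_zero_iff, eval_eqE, eval_add,
    show ∀ m n : ℕ, m + n ≠ 0 ↔ m ≠ 0 ∨ n ≠ 0 from fun m n => by omega, eval_ltE, eval_ltE]
  simp only [symE, vN, vt, sym, eval_input, eval_add, eval_mul, eval_div, eval_mod, eval_var,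
    eval_placeE, eval_ofNat, e0, e1, e7, e8, e9, e10]

end LCSInstance

namespace LCSInstance

open RAM RAM.Expr

/-! ### The program -/

/-- Assign the value of an expression to a variable. -/
def assign (i : Fin 12) (e : Expr 12) : Program := .seq (e.compile 12) (.move i 12)

/-- A list of the expressions that the program evaluates. -/
def exprs : List (Expr 12) :=
  [.input 0, .input 1, .input 3, sizeE, leE vr vN, countE, searchE, lenE, entryE (.var 4)]

/-- The number of reserved registers. -/
@[irreducible] def reserved : ℕ := 14 + (exprs.map regs).sum

/-- An exponent that governs the time and the space of all evaluations. -/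
@[irreducible] def degree : ℕ := (exprs.map deg).sum

/-- Load the parameters of the instance, and compare the number of strings with their length. -/
def setup : Program :=
  .seq (assign 0 (.input 0)) <| .seq (assign 1 (.input 1)) <| .seq (assign 2 (.input 3)) <|
  .seq (assign 3 sizeE) (assign 5 (leE vr vN))

/-- Solve the instance by exhaustive search. -/
def search : Program := .seq (assign 6 countE) (assign 0 searchE)

/-- Solve the instance with a program for Independent Set. -/
def reduce (P : Program) : Program :=
  .seq (assign 6 lenE) <| .seq (P.relocate reserved (entryE (.var 4)) 6 4) (.move 0 reserved)

/-- The program that solves Longest Common Subsequence with a program for Independent Set. -/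
def solver (P : Program) : Program := .seq setup (.branch 5 (reduce P) search)

theorem le_sum_map {α : Type*} (f : α → ℕ) {a : α} {l : List α} (ha : a ∈ l) :
    f a ≤ (l.map f).sum :=
  List.single_le_sum (fun _ _ => Nat.zero_le _) _ (List.mem_map_of_mem ha)

theorem regs_le {e : Expr 12} (he : e ∈ exprs) : 14 + e.regs ≤ reserved := by
  unfold reserved
  generalize exprs = l at he ⊢
  exact Nat.add_le_add_left (le_sum_map regs he) 14

theorem deg_le {e : Expr 12} (he : e ∈ exprs) : e.deg ≤ degree := by
  unfold degree
  exact le_sum_map deg he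

variable {I : LCSInstance} {B W T S : ℕ} {m : Mem} {x : List ℕ} {P : Program}

theorem assign_runs (hx : ∀ i, Nat.size (x.getD i 0) ≤ B) {e : Expr 12} (he : e ∈ exprs)
    (i : Fin 12) (hW : (B + 2) ^ degree ≤ W) (hm : ∀ i < reserved, Nat.size (m i) ≤ W)
    (hB : ∀ i : Fin 12, m i ≤ B) :
    ∃ m', Runs reserved W x (assign i e) m m' ((B + 2) ^ degree + 2) ∧
      m' i = e.eval x (fun i => m i) ∧ ∀ k : Fin 12, k ≠ i → m' k = m k := by
  have h1 := regs_le he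
  have h2 : (B + 2) ^ e.deg ≤ (B + 2) ^ degree := Nat.pow_le_pow_right (by omega) (deg_le he)
  have hi := i.2
  obtain ⟨m1, r1, e1, l1⟩ := e.compile_runs (s := 12) hx le_rfl (by omega) (h2.trans hW) hm hB
  have r2 := Runs.move (x := x) (i := i) (j := 12) r1.2.2 (by omega) (by omega)
    (by rw [e1]; exact (e.size_eval_le hx hB).trans (h2.trans hW))
  refine ⟨_, (r1.seq r2).mono (by omega), by simp [e1], fun k hk => ?_⟩
  have : (k : ℕ) ≠ i := fun h => hk (Fin.ext h)
  simp [Function.update_of_ne this, l1 k k.2]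

theorem setup_runs (hx : ∀ i, Nat.size (I.encode.getD i 0) ≤ B) (hW : (B + 2) ^ degree ≤ W)
    (hN : I.N + 1 ≤ B) (ht : I.t ≤ B) (hr : I.r ≤ B) :
    ∃ m, Runs reserved W I.encode setup 0 m (5 * ((B + 2) ^ degree + 2)) ∧
      IsEnv I (fun i => m i) ∧ (m 5 ≠ 0 ↔ I.r ≤ I.N) ∧ ∀ i : Fin 12, m i ≤ B := by
  have hL : I.L ≤ B := (size_le_self _).trans (by omega)
  obtain ⟨m1, r1, e1, l1⟩ := assign_runs (m := 0) hx (e := .input 0) (by simp [exprs]) 0 hW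
    (by simp) (by simp)
  have e1 : m1 0 = I.N := e1
  have b1 : ∀ i : Fin 12, m1 i ≤ B := fun i => by
    by_cases hi : i = 0
    · subst hi; exact e1.trans_le (by omega)
    · rw [l1 i hi]; simp
  obtain ⟨m2, r2, e2, l2⟩ := assign_runs hx (e := .input 1) (by simp [exprs]) 1 hW r1.2.2 b1
  have e2 : m2 1 = I.t := e2
  have b2 : ∀ i : Fin 12, m2 i ≤ B := fun i => by
    by_cases hi : i = 1
    · subst hi; exact e2.trans_le (by omega)
    · rw [l2 i hi]; exact b1 i
  obtain ⟨m3, r3, e3, l3⟩ := assign_runs hx (e := .input 3) (by simp [exprs]) 2 hW r2.2.2 b2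
  have e3 : m3 2 = I.r := e3
  have b3 : ∀ i : Fin 12, m3 i ≤ B := fun i => by
    by_cases hi : i = 2
    · subst hi; exact e3.trans_le (by omega)
    · rw [l3 i hi]; exact b2 i
  have e30 : m3 0 = I.N := (l3 0 (by decide)).trans ((l2 0 (by decide)).trans e1)
  have e31 : m3 1 = I.t := (l3 1 (by decide)).trans e2
  obtain ⟨m4, r4, e4, l4⟩ := assign_runs hx (e := sizeE) (by simp [exprs]) 3 hW r3.2.2 b3
  have e4 : m4 3 = I.L := by
    refine e4.trans ?_
    rw [eval_sizeE]
    exact congrArg Nat.size e30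
  have b4 : ∀ i : Fin 12, m4 i ≤ B := fun i => by
    by_cases hi : i = 3
    · subst hi; exact e4.trans_le (by omega)
    · rw [l4 i hi]; exact b3 i
  have e40 : m4 0 = I.N := (l4 0 (by decide)).trans e30
  have e41 : m4 1 = I.t := (l4 1 (by decide)).trans e31
  have e42 : m4 2 = I.r := (l4 2 (by decide)).trans e3
  obtain ⟨m5, r5, e5, l5⟩ := assign_runs hx (e := leE vr vN) (by simp [exprs]) 5 hW r4.2.2 b4
  have e5 : m5 5 = I.N + 1 - I.r := by
    refine e5.trans ?_
    change m4 0 + 1 - m4 2 = _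
    rw [e40, e42]
  refine ⟨m5, (r1.seq (r2.seq (r3.seq (r4.seq r5)))).mono (by omega), ⟨?_, ?_, ?_, ?_⟩, ?_, ?_⟩
  · exact (l5 0 (by decide)).trans e40
  · exact (l5 1 (by decide)).trans e41
  · exact (l5 2 (by decide)).trans e42
  · exact (l5 3 (by decide)).trans e4
  · rw [e5]; omega
  · intro i
    by_cases hi : i = 5
    · subst hi; exact e5.trans_le (by omega)
    · rw [l5 i hi]; exact b4 i

theorem highBits_zero (h : ℕ) : highBits h 0 = 0 := by simp [highBits]

/-- Variable 6 holds `N ^ t` as a loop bound, so `B` has to dominate this number as well. -/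
theorem search_decides (hx : ∀ i, Nat.size (I.encode.getD i 0) ≤ B) (hN : I.N + 1 ≤ B)
    (ht : I.t ≤ B) (hr : I.r ≤ B) (hB : I.N ^ I.t ≤ B) (hrN : I.N < I.r) :
    (solver P).Decides I.encode I.IsYes (8 * ((B + 2) ^ degree + 2))
      (reserved * (reserved + (B + 2) ^ degree)) := by
  obtain ⟨m1, r1, h1, hf, b1⟩ := setup_runs hx le_rfl hN ht hr
  obtain ⟨m2, r2, e2, l2⟩ := assign_runs hx (e := countE) (by simp [exprs]) 6 le_rfl r1.2.2 b1
  have e2 : m2 6 = I.N ^ I.t := by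
    refine e2.trans ?_
    rw [eval_countE, h1.N, h1.t]
  have h2 : IsEnv I (fun i => m2 i) :=
    ⟨(l2 0 (by decide)).trans h1.N, (l2 1 (by decide)).trans h1.t, (l2 2 (by decide)).trans h1.r,
      (l2 3 (by decide)).trans h1.L⟩
  have b2 : ∀ i : Fin 12, m2 i ≤ B := fun i => by
    by_cases hi : i = 6
    · subst hi; exact e2.trans_le hB
    · rw [l2 i hi]; exact b1 i
  obtain ⟨m3, r3, e3, -⟩ := assign_runs hx (e := searchE) (by simp [exprs]) 0 le_rfl r2.2.2 b2
  obtain ⟨⟨t, s, he, ht, hs⟩, -⟩ :=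
    r1.seq (Runs.branch_else (P := reduce P) (by by_contra hcon; have := hf.1 hcon; omega)
      (r2.seq r3))
  refine ⟨m3, t, s, he, by omega, ?_, ?_⟩
  · rwa [highBits_zero, add_zero] at hs
  · rw [← eval_searchE h2 e2, ← e3]; rfl

/-- Here `B` dominates the length of the virtual input, hence every index at which an entry is
evaluated. -/
theorem reduce_decides (hx : ∀ i, Nat.size (I.encode.getD i 0) ≤ B) (hN : I.N + 1 ≤ B)
    (ht : I.t ≤ B) (hB : I.len ≤ B) (hrN : I.r ≤ I.N)
    (hP : P.Decides I.toIS.encode I.toIS.IsYes T S) :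
    (solver P).Decides I.encode I.IsYes ((T + 9) * ((B + 2) ^ degree + 12))
      (reserved * (reserved + (S + 2 * reserved + B + (B + 2) ^ degree)) + (reserved + 2) * S) := by
  obtain ⟨m', t, s, he, htT, hsS, hyes⟩ := hP
  have hE : entryE (.var 4) ∈ exprs := by simp [exprs]
  have hval : ∀ {ρ}, IsEnv I ρ → (entryE (.var 4)).eval I.encode ρ = I.entry (ρ 4) := eval_entryE
  unfold solver reduce
  generalize entryE (.var 4) = E at hE hval ⊢
  have hreg := regs_le hE
  have hdeg : (B + 2) ^ E.deg ≤ (B + 2) ^ degree := Nat.pow_le_pow_right (by omega) (deg_le hE)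
  generalize hW : S + 2 * reserved + B + (B + 2) ^ degree = W
  have hXW : (B + 2) ^ degree ≤ W := by omega
  obtain ⟨m1, r1, h1, hf, b1⟩ := setup_runs hx hXW hN ht (by omega)
  obtain ⟨m2, r2, e2, l2⟩ := assign_runs hx (e := lenE) (by simp [exprs]) 6 hXW r1.2.2 b1
  have e2 : m2 6 = I.len := e2.trans (eval_lenE h1)
  have h2 : IsEnv I (fun i => m2 i) :=
    ⟨(l2 0 (by decide)).trans h1.N, (l2 1 (by decide)).trans h1.t, (l2 2 (by decide)).trans h1.r,
      (l2 3 (by decide)).trans h1.L⟩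
  have b2 : ∀ i : Fin 12, m2 i ≤ B := fun i => by
    by_cases hi : i = 6
    · subst hi; exact e2.trans_le hB
    · rw [l2 i hi]; exact b1 i
  -- The virtual memory starts at zero, as nothing has been written above `reserved` so far.
  have hrep : Represents reserved W B (fun i : Fin 12 => m2 i) 4 0 m2 := by
    refine ⟨fun i => ?_, r2.2.2, fun _ _ => rfl, b2 4⟩
    rw [r2.2.1 _ (by omega), r1.2.1 _ (by omega)]; rfl
  have hy : ∀ j, I.toIS.encode.getD j 0 = if j < (fun i : Fin 12 => m2 i) 6 then
      E.eval I.encode (Function.update (fun i : Fin 12 => m2 i) 4 j) else 0 := by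
    intro j
    have h3 : IsEnv I (Function.update (fun i : Fin 12 => m2 i) 4 j) :=
      ⟨h2.N, h2.t, h2.r, h2.L⟩
    rw [toIS_encode_getD, hval h3]
    change _ = if j < m2 6 then _ else _
    rw [e2, Function.update_self]
  obtain ⟨m3, t3, s3, he3, ht3, hs3, h3⟩ := relocate_exec (S := S) (by omega) (by omega)
    (by decide) hx b2 hy (by omega) he hsS hrep
  have h0 : m3 reserved = m' 0 := by have := h3.high 0; rwa [zero_add] at this
  have hms : memBits m' ≤ S := he.memBits_final_le.trans hsS
  have hsz : Nat.size (m' 0) ≤ W := by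
    have := size_le_memBits m' 0
    omega
  have r4 := Runs.move (x := I.encode) (i := 0) (j := reserved) h3.low (by omega) (by omega)
    (by rw [h0]; exact hsz)
  rw [h0] at r4
  obtain ⟨⟨t4, s4, he4, ht4, hs4⟩, -⟩ := r4
  obtain ⟨⟨t1, s1, he1, ht1, hs1⟩, hh1, -⟩ := r1
  have hh1 := highBits_congr hh1
  obtain ⟨⟨t2, s2, he2, ht2, hs2⟩, hh2, -⟩ := r2
  refine ⟨_, _, _, he1.seq (.branch_then (hf.2 hrN) (he2.seq (he3.seq he4))), ?_, ?_, ?_⟩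
  · have e1 : t * ((B + 2) ^ E.deg + 12) ≤ T * ((B + 2) ^ degree + 12) :=
      Nat.mul_le_mul htT (by omega)
    rw [add_mul]
    omega
  · have g0 : ∀ a, a ≤ a + (reserved + 2) * S := fun a => Nat.le_add_right _ _
    refine max_le ?_ (max_le ?_ (max_le ?_ ?_))
    · rw [highBits_zero] at hs1; exact hs1.trans (g0 _)
    · rw [hh1, highBits_zero] at hs2; exact hs2.trans (g0 _)
    · exact hs3
    · refine hs4.trans (Nat.add_le_add_left ((highBits_le h3.high).trans ?_) _)
      exact Nat.mul_le_mul_left _ hms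
  · rw [← toIS_isYes_iff, ← hyes]
    simp

end LCSInstance

/-! ## Conclusion -/

theorem RAM.length_le_bitSize (x : List ℕ) : x.length ≤ RAM.bitSize x := by
  unfold RAM.bitSize
  induction x with
  | nil => simp
  | cons a x ih => simp only [List.length_cons, List.map_cons, List.sum_cons]; omega

theorem RAM.size_getD_le_bitSize (x : List ℕ) (i : ℕ) :
    Nat.size (x.getD i 0) ≤ RAM.bitSize x := by
  unfold RAM.bitSize
  induction x generalizing i with
  | nil => simp
  | cons a x ih =>
    simp only [List.map_cons, List.sum_cons]
    cases i with
    | zero => simp only [List.getD_cons_zero]; omega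
    | succ i =>
      have := ih i
      simp only [List.getD_cons_succ]; omega

/-! ### Bookkeeping with powers of the instance size -/

section Bounds

variable {M a b x y : ℕ}

theorem mul_le_pow_add (hx : x ≤ M ^ a) (hy : y ≤ M ^ b) : x * y ≤ M ^ (a + b) := by
  rw [pow_add]; exact Nat.mul_le_mul hx hy

/-- Products add exponents and sums cost one more. The explicit exponents below arise by applying
these two rules mechanically. -/
theorem add_le_pow_add (hM : 2 ≤ M) (hx : x ≤ M ^ a) (hy : y ≤ M ^ b) :
    x + y ≤ M ^ (a + b + 1) := by
  have ha : 1 ≤ M ^ a := Nat.one_le_pow _ _ (by omega)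
  have hb : 1 ≤ M ^ b := Nat.one_le_pow _ _ (by omega)
  have h1 : M ^ a ≤ M ^ a * M ^ b := Nat.le_mul_of_pos_right _ hb
  have h2 : M ^ b ≤ M ^ a * M ^ b := Nat.le_mul_of_pos_left _ ha
  have h3 : M ^ a * M ^ b * 2 ≤ M ^ a * M ^ b * M := Nat.mul_le_mul_left _ hM
  rw [pow_succ, pow_add]
  omega

theorem le_pow_self (hM : 2 ≤ M) (n : ℕ) : n ≤ M ^ n := (Nat.lt_pow_self hM).le

theorem pow_le_pow_mul (n : ℕ) (hx : x ≤ M ^ a) : x ^ n ≤ M ^ (a * n) := by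
  rw [pow_mul]; exact Nat.pow_le_pow_left hx n

end Bounds

/-! ### Size of the reduction; time and space of the solver -/

namespace LCSInstance

variable {I : LCSInstance}

theorem length_encode : I.encode.length = 4 + I.r * I.N := by
  unfold encode
  rw [List.length_append, List.length_flatten_ofFn _ (fun _ => List.length_ofFn)]
  rfl

theorem le_size : 4 + I.r * I.N ≤ I.size := by
  rw [← length_encode]; exact RAM.length_le_bitSize _

theorem N_lt_size : I.N + 1 ≤ I.size := by
  have := le_size (I := I)
  have := Nat.le_mul_of_pos_left I.N I.r_pos
  omega

theorem r_lt_size : I.r + 1 ≤ I.size := by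
  have := le_size (I := I)
  have := Nat.le_mul_of_pos_right I.r I.N_pos
  omega

theorem L_le : I.L ≤ I.N := RAM.size_le_self _

theorem two_le_size : 2 ≤ I.size := by
  have := le_size (I := I); omega

theorem two_pow_L_le : 2 ^ I.L ≤ 2 * I.N := by
  obtain ⟨s, hs⟩ := Nat.exists_eq_succ_of_ne_zero I.L_pos.ne'
  rw [hs, pow_succ', Nat.mul_le_mul_left_iff (by omega)]
  exact Nat.lt_size.1 (by unfold L at hs; omega)

theorem n0_le (ht : I.t ≤ I.N) : I.n0 ≤ I.size ^ 9 := by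
  have hM := I.two_le_size
  have hN : I.N ≤ I.size ^ 1 := by have := I.N_lt_size; rw [pow_one]; omega
  have hr : I.r ≤ I.size ^ 1 := by have := I.r_lt_size; rw [pow_one]; omega
  exact mul_le_pow_add (mul_le_pow_add (mul_le_pow_add (ht.trans hN) hr)
    (mul_le_pow_add (mul_le_pow_add hN hN) hN)) (mul_le_pow_add (le_pow_self hM 3) (L_le.trans hN))

theorem len_le (ht : I.t ≤ I.N) : I.len ≤ I.size ^ 97 := by
  have hM := I.two_le_size
  have hN : I.N ≤ I.size ^ 1 := by have := I.N_lt_size; rw [pow_one]; omega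
  have hr : I.r ≤ I.size ^ 1 := by have := I.r_lt_size; rw [pow_one]; omega
  have h2 : I.n2 ≤ I.size ^ 2 := mul_le_pow_add (ht.trans hN) hr
  have h1 : I.n1 ≤ I.size ^ 5 := mul_le_pow_add h2 (mul_le_pow_add (mul_le_pow_add hN hN) hN)
  have h0 := n0_le ht
  have hb : I.base ≤ I.size ^ 18 := add_le_pow_add hM (add_le_pow_add hM h0 h1) h2
  have hn : I.nodes ≤ I.size ^ 20 := add_le_pow_add hM hb (ht.trans hN)
  have hk : I.labels ≤ I.size ^ 9 := mul_le_pow_add (le_pow_self hM 5)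
    (mul_le_pow_add (le_pow_self hM 2) (mul_le_pow_add hr (L_le.trans hN)))
  have hl : I.nodeLen ≤ I.size ^ 29 := add_le_pow_add hM
    (add_le_pow_add hM (pow_zero I.size).ge hk) (mul_le_pow_add hk hk)
  exact add_le_pow_add hM (le_pow_self hM 2) (add_le_pow_add hM (mul_le_pow_add h0 h0)
    (add_le_pow_add hM hk (add_le_pow_add hM (le_pow_self hM 3) (add_le_pow_add hM
      (mul_le_pow_add h0 (le_pow_self hM 2)) (mul_le_pow_add hn hl)))))

/-- Since `k = 10 * r * L` and `2 ^ L ≤ 2 * N ≤ M ^ 2`, exponential time in `k` is polynomial in `M`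
with an exponent linear in `r`. -/
theorem two_pow_labels_le (c : ℕ) : 2 ^ (c * I.labels) ≤ I.size ^ (20 * (c * I.r)) := by
  have hM := I.two_le_size
  have h2 : 2 ^ I.L ≤ I.size ^ 2 := by
    have := I.N_lt_size
    rw [pow_two]
    exact two_pow_L_le.trans (Nat.mul_le_mul hM (by omega))
  have e : c * I.labels = I.L * (10 * (c * I.r)) := by unfold labels lw; ring
  rw [e, pow_mul]
  refine (pow_le_pow_mul (10 * (c * I.r)) h2).trans_eq ?_
  congr 1; ring

open RAM

/-- A constant for the bounds on time and space. -/
def bigConst (c : ℕ) : ℕ := 200 * (c + degree + reserved + 1) + reserved * (reserved + 1)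

/-- The function of the number of strings in the bounds on time and space. -/
def bound (c r : ℕ) : ℕ := bigConst c * (r + 1) + bigConst c * (r ^ r) ^ bigConst c

theorem mul_add_le_bound {c r a b : ℕ} (ha : a ≤ bigConst c) (hb : b ≤ bigConst c) :
    a * r + b ≤ bound c r := by
  have := Nat.mul_le_mul_right r ha
  unfold bound
  rw [mul_add]
  omega

/-- Only the factor `2 ^ (c * k)` of the running time brings `r` into the exponent; the space stays
polynomial in `M` with a fixed exponent. -/
theorem solver_decides_few {P : Program} {c : ℕ} (ht : I.t ≤ I.N) (hr : I.r ≤ I.N)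
    (hP : P.Decides I.toIS.encode I.toIS.IsYes (c * 2 ^ (c * I.labels) * I.n0 ^ c)
      (c * I.n0 ^ c)) :
    (solver P).Decides I.encode I.IsYes (I.size ^ bound c I.r)
      (bound c I.r * I.size ^ bigConst c) := by
  have hM := I.two_le_size
  have hMB : I.size ≤ I.size ^ 97 := Nat.le_self_pow (by omega) _
  obtain ⟨m, t, s, he, h1, h2, h3⟩ := reduce_decides (B := I.size ^ 97)
    (fun i => (size_getD_le_bitSize _ i).trans hMB) (N_lt_size.trans hMB)
    (ht.trans ((Nat.le_succ _).trans (N_lt_size.trans hMB))) (len_le ht) hr hP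
  have hX : I.size ^ 97 + 2 ≤ I.size ^ 100 := add_le_pow_add hM le_rfl (le_pow_self hM 2)
  have hXD := pow_le_pow_mul degree hX
  have hc := le_pow_self hM c
  have hn := pow_le_pow_mul c (n0_le ht)
  have hS := mul_le_pow_add hc hn
  have hH := le_pow_self hM reserved
  have h1M : 1 ≤ I.size := by omega
  refine ⟨m, t, s, he, h1.trans ?_, h2.trans ?_, h3⟩
  · refine (mul_le_pow_add (add_le_pow_add hM (mul_le_pow_add (mul_le_pow_add hc
      (two_pow_labels_le c)) hn) (le_pow_self hM 9)) (add_le_pow_add hM hXD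
        (le_pow_self hM 12))).trans (Nat.pow_le_pow_right h1M ?_)
    refine le_trans (Eq.le ?_) (mul_add_le_bound (a := 20 * c) (b := 10 * c + 100 * degree + 23)
      (by unfold bigConst; omega) (by unfold bigConst; omega))
    ring
  · refine le_trans ?_ (Nat.le_mul_of_pos_left _ (?_ : 0 < bound c I.r))
    · refine (add_le_pow_add hM (mul_le_pow_add hH (add_le_pow_add hM hH (add_le_pow_add hM
        (add_le_pow_add hM (add_le_pow_add hM hS (mul_le_pow_add (le_pow_self hM 2) hH)) le_rfl)
        hXD))) (mul_le_pow_add (add_le_pow_add hM hH (le_pow_self hM 2)) hS)).trans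
        (Nat.pow_le_pow_right h1M ?_)
      unfold bigConst
      omega
    · have := mul_add_le_bound (c := c) (r := I.r) (a := 0) (b := 1) (by omega)
        (by unfold bigConst; omega)
      omega

/-- From `t ≤ N < r` follows `N ^ t ≤ r ^ r`. In the time bound this is absorbed by `M ^ r`; in the
space bound it stays a factor depending on `r`, the second summand of `bound`. -/
theorem solver_decides_many {P : Program} (c : ℕ) (ht : I.t ≤ I.N) (hr : I.N < I.r) :
    (solver P).Decides I.encode I.IsYes (I.size ^ bound c I.r)
      (bound c I.r * I.size ^ bigConst c) := by
  have hM := I.two_le_size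
  have hr0 := I.r_pos
  have hR : 0 < I.r ^ I.r := by positivity
  have hMB : I.size ≤ I.size * I.r ^ I.r := Nat.le_mul_of_pos_right _ hR
  have hNt : I.N ^ I.t ≤ I.size * I.r ^ I.r :=
    ((Nat.pow_le_pow_right I.N_pos (by omega)).trans
      (Nat.pow_le_pow_left hr.le I.r)).trans (Nat.le_mul_of_pos_left _ (by omega))
  obtain ⟨m, t, s, he, h1, h2, h3⟩ := search_decides (P := P) (B := I.size * I.r ^ I.r)
    (fun i => (size_getD_le_bitSize _ i).trans hMB) (N_lt_size.trans hMB)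
    (ht.trans ((Nat.le_succ _).trans (N_lt_size.trans hMB)))
    ((Nat.le_succ _).trans (r_lt_size.trans hMB)) hNt hr
  have h1M : 1 ≤ I.size := by omega
  refine ⟨m, t, s, he, h1.trans ?_, h2.trans ?_, h3⟩
  · have hrM : I.r ^ I.r ≤ I.size ^ (1 * I.r) :=
      pow_le_pow_mul _ (by have := I.r_lt_size; rw [pow_one]; omega)
    have hX := add_le_pow_add hM (mul_le_pow_add (pow_one I.size).ge hrM) (le_pow_self hM 2)
    refine (mul_le_pow_add (le_pow_self hM 8) (add_le_pow_add hM (pow_le_pow_mul degree hX)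
      (le_pow_self hM 2))).trans (Nat.pow_le_pow_right h1M ?_)
    refine le_trans (Eq.le ?_) (mul_add_le_bound (a := degree) (b := 4 * degree + 11)
      (by unfold bigConst; omega) (by unfold bigConst; omega))
    ring
  · have hX : I.size * I.r ^ I.r + 2 ≤ I.size ^ 2 * I.r ^ I.r := by
      have h4 := le_size (I := I)
      have : 2 * (I.size * I.r ^ I.r) ≤ I.size * (I.size * I.r ^ I.r) :=
        Nat.mul_le_mul_right _ hM
      rw [pow_two, mul_assoc]
      omega
    have hXD : (I.size * I.r ^ I.r + 2) ^ degree ≤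
        (I.r ^ I.r) ^ bigConst c * I.size ^ bigConst c := by
      refine (Nat.pow_le_pow_left hX degree).trans ?_
      rw [mul_pow, ← pow_mul, mul_comm]
      exact Nat.mul_le_mul (Nat.pow_le_pow_right hR (by unfold bigConst; omega))
        (Nat.pow_le_pow_right h1M (by unfold bigConst; omega))
    have hpos : 0 < (I.r ^ I.r) ^ bigConst c * I.size ^ bigConst c := by positivity
    generalize hY : (I.r ^ I.r) ^ bigConst c * I.size ^ bigConst c = Y at *
    calc _ ≤ reserved * (reserved * Y + Y) := by
          refine Nat.mul_le_mul_left _ (Nat.add_le_add (Nat.le_mul_of_pos_right _ hpos) hXD)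
      _ = reserved * (reserved + 1) * Y := by ring
      _ ≤ bigConst c * Y := Nat.mul_le_mul_right _ (by unfold bigConst; omega)
      _ ≤ bound c I.r * I.size ^ bigConst c := by
          rw [← hY, ← mul_assoc]
          exact Nat.mul_le_mul_right _ (Nat.le_add_left _ _)

end LCSInstance

/-! ### Slowing down `δ` computably -/

section Computability

theorem primrec_pow : Primrec₂ ((· ^ ·) : ℕ → ℕ → ℕ) :=
  (Primrec.nat_rec (f := fun _ : ℕ => 1) (g := fun (a : ℕ) (p : ℕ × ℕ) => p.2 * a)
    (Primrec.const 1) (Primrec.nat_mul.comp (Primrec.snd.comp Primrec.snd) Primrec.fst).to₂).of_eq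
    fun a n => by
      induction n with
      | zero => rfl
      | succ n ih => rw [pow_succ, ← ih]

theorem computable_bound (c : ℕ) : Computable (LCSInstance.bound c) := by
  refine Primrec.to_comp ?_
  refine Primrec.nat_add.comp (Primrec.nat_mul.comp (Primrec.const _)
    (Primrec.nat_add.comp Primrec.id (Primrec.const 1)))
    (Primrec.nat_mul.comp (Primrec.const _) (primrec_pow.comp
      (primrec_pow.comp Primrec.id Primrec.id) (Primrec.const _)))

/-- The minimum of `N` and of the values of `δ` at the arguments `k < b` with `N < 2 ^ k`. -/
def windowMin (δ : ℕ → ℕ) (N b : ℕ) : ℕ :=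
  Nat.rec N (fun k m => if 2 ^ k ≤ N then m else min m (δ k)) b

theorem le_windowMin_iff {δ : ℕ → ℕ} {N b v : ℕ} :
    v ≤ windowMin δ N b ↔ v ≤ N ∧ ∀ k < b, N < 2 ^ k → v ≤ δ k := by
  induction b with
  | zero => simp [windowMin]
  | succ b ih =>
    have e : windowMin δ N (b + 1) =
      if 2 ^ b ≤ N then windowMin δ N b else min (windowMin δ N b) (δ b) := rfl
    rw [e, Nat.forall_lt_succ_right]
    split_ifs with h
    · rw [ih]
      have : ¬ N < 2 ^ b := by omega
      tauto
    · rw [le_min_iff, ih]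
      have : N < 2 ^ b := by omega
      tauto

/-- A bound on the length of the subsequence for which the reduction applies. -/
def slowed (δ : ℕ → ℕ) (N : ℕ) : ℕ := windowMin δ N (10 * (N * N) + 1) - 3

theorem computable_slowed {δ : ℕ → ℕ} (hδ : Computable δ) : Computable (slowed δ) := by
  have hb : Primrec fun N : ℕ => 10 * (N * N) + 1 :=
    Primrec.succ.comp (Primrec.nat_mul.comp (Primrec.const 10)
      (Primrec.nat_mul.comp Primrec.id Primrec.id))
  have hk : Computable fun p : ℕ × ℕ × ℕ => p.2.1 := Computable.fst.comp Computable.snd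
  have hm : Computable fun p : ℕ × ℕ × ℕ => p.2.2 := Computable.snd.comp Computable.snd
  have hc : Computable fun p : ℕ × ℕ × ℕ => decide (2 ^ p.2.1 ≤ p.1) :=
    (Primrec.nat_le.comp (primrec_pow.comp (Primrec.const 2) (Primrec.fst.comp Primrec.snd))
      Primrec.fst).decide.to_comp
  have hstep : Computable₂ fun (N : ℕ) (p : ℕ × ℕ) =>
      bif decide (2 ^ p.1 ≤ N) then p.2 else min p.2 (δ p.1) :=
    (Computable.cond hc hm (Primrec.nat_min.to_comp.comp hm (hδ.comp hk))).to₂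
  have hrec := Computable.nat_rec hb.to_comp Computable.id hstep
  refine (Primrec.nat_sub.to_comp.comp hrec (Computable.const 3)).of_eq fun N => ?_
  simp only [slowed, windowMin, Bool.cond_decide, id]

/-- Every `k` in the window has `2 ^ k > N`, so a large `N` keeps the whole window where `δ` is
large. Monotonicity of `δ` is not needed. -/
theorem tendsto_slowed {δ : ℕ → ℕ} (hδ : Filter.Tendsto δ Filter.atTop Filter.atTop) :
    Filter.Tendsto (slowed δ) Filter.atTop Filter.atTop := by
  rw [Filter.tendsto_atTop_atTop] at *
  intro v
  obtain ⟨K, hK⟩ := hδ (v + 3)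
  refine ⟨max (2 ^ K) (v + 3), fun N hN => ?_⟩
  have h : v + 3 ≤ windowMin δ N (10 * (N * N) + 1) := by
    refine le_windowMin_iff.2 ⟨(le_max_right _ _).trans hN, fun k _ hk => hK k ?_⟩
    exact ((Nat.pow_lt_pow_iff_right (by omega)).1
      (((le_max_left _ _).trans hN).trans_lt hk)).le
  unfold slowed
  omega

end Computability

/-- For `r ≤ N` the number of labels lies in the window: it is at most `10 * N ^ 2`, and at least
`L`, where `2 ^ L > N`. -/
theorem LCSInstance.le_of_le_slowed {I : LCSInstance} {δ : ℕ → ℕ} (h : I.t ≤ slowed δ I.N) :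
    I.t ≤ I.N ∧ (I.r ≤ I.N → I.t + 3 ≤ δ I.labels) := by
  have ht := I.t_pos
  -- As `t` is positive, the subtraction of `3` in `slowed` was not truncated.
  have h' : I.t + 3 ≤ windowMin δ I.N (10 * (I.N * I.N) + 1) := by unfold slowed at h; omega
  obtain ⟨h1, h2⟩ := le_windowMin_iff.1 h'
  refine ⟨by omega, fun hr => h2 _ ?_ ?_⟩
  · have := Nat.mul_le_mul hr (L_le (I := I))
    unfold labels lw
    omega
  · have h3 : I.L ≤ I.labels := by
      have := Nat.le_mul_of_pos_left I.L I.r_pos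
      unfold labels lw
      omega
    exact (Nat.lt_size_self I.N).trans_le (Nat.pow_le_pow_right (by omega) h3)

theorem LCSSolvable.of_isSolvable {δ : ℕ → ℕ} (h : ISSolvable δ) : LCSSolvable (slowed δ) := by
  obtain ⟨P, c, hP⟩ := h
  refine ⟨LCSInstance.solver P, LCSInstance.bound c, LCSInstance.bigConst c, computable_bound c,
    fun I hI => ?_⟩
  obtain ⟨ht, hd⟩ := LCSInstance.le_of_le_slowed hI
  rcases Nat.lt_or_ge I.N I.r with hr | hr
  · exact LCSInstance.solver_decides_many c ht hr
  · exact LCSInstance.solver_decides_few ht hr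
      (hP I.toIS (LCSInstance.tree_depth_le.trans (hd hr)))

theorem theorem4
    (hLCS : ∀ δ : ℕ → ℕ, Computable δ → Filter.Tendsto δ Filter.atTop Filter.atTop →
      ¬ LCSSolvable δ) :
    ∀ δ : ℕ → ℕ, Computable δ → Filter.Tendsto δ Filter.atTop Filter.atTop →
      ¬ ISSolvable δ := by
  intro δ hδ hlim h
  exact hLCS _ (computable_slowed hδ) (tendsto_slowed hlim) (LCSSolvable.of_isSolvable h)
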